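/- **Lazy Bureaucrat Problem (preemptive, constraint II, makespan, common deadline).** An instance consists of jobs $1,\dots,n$; job $i$ has an arrival time $a_i$, a processing time $t_i$ and a deadline $d_i$, all nonnegative integers. A schedule on the single processor (the bureaucrat) consists of finitely many pairwise disjoint time intervals $[s,e)$, $0\le s<e$, with real end points, during each of which one job is worked on; outside them the processor is idle. Let $y_i(\tau)$ be the amount of work done on job $i$ before time $\tau$. Job $i$ is *executable* at time $\tau$ if $a_i\le\tau\le d_i$, it is not yet completed ($y_i(\tau)<t_i$), and it can still be completed by its deadline: $\tau\le d_i-t_i+y_i(\tau)$. (So a job with $t_i=0$ requires no work.) A schedule is *feasible* if at every time only an executable job is worked on and, at every time $\tau\ge 0$ at which some job is executable, the bureaucrat is working. The *makespan* of a feasible schedule is the time at which its last piece of work ends, which is also the last completion time of a job; it is $0$ if no work is done. **Theorem.** When all jobs have a common deadline ($d_i=D$ for all $i$), minimizing the makespan over the feasible schedules is solvable in polynomial time, in the following sense. (The minimum need not be attained.) 1. There is an algorithm that, given an instance with a common deadline, computes the optimal makespan, i.e. the infimum $T^*$ of the makespans of its feasible schedules, exactly, as a fraction $p/q$ of integers.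 2. There is an algorithm that, given an instance with a common deadline and a rational number $T\ge 0$ (as a fraction of integers), decides whether there is a feasible schedule of makespan at most $T$, and outputs one with rational end points if there is. (Applied with $T=T^*$, it decides whether the minimum is attained and, if so, produces an optimal schedule.) Both algorithms run in time polynomial in the total bit length of the input, on a random access machine whose unit-cost arithmetic operations are addition, truncated subtraction and halving of natural numbers (a model that is polynomially equivalent to Turing machines). -/

import Mathlib

namespace LazyBureaucrat

/-! ### The Lazy Bureaucrat Problem with preemption under constraint II -/

/-- An instance: `n` jobs, job `i` having arrival time `arrival i`, processing time `len i` and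
deadline `deadline i`, all of them nonnegative integers. -/
structure Instance where
  n : ℕ
  arrival : Fin n → ℕ
  len : Fin n → ℕ
  deadline : Fin n → ℕ

/-- All jobs have the same deadline. -/
def Instance.CommonDeadline (I : Instance) : Prop :=
  ∃ D : ℕ, ∀ i, I.deadline i = D

/-- A piece of a schedule: the processor works on `job` throughout the time interval
`[startTime, endTime)`. -/
structure Piece (I : Instance) where
  job : Fin I.n
  startTime : ℝ
  endTime : ℝ

/-- A (preemptive) schedule is a finite list of pieces; the processor is idle outside of them.
That the pieces are nondegenerate, disjoint and listed in order of time is part of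
`Schedule.Feasible`. -/
abbrev Schedule (I : Instance) : Type := List (Piece I)

variable {I : Instance}

/-- The amount of work done on job `i` during `[0, τ)`. -/
noncomputable def Schedule.workDone (S : Schedule I) (i : Fin I.n) (τ : ℝ) : ℝ :=
  ((S.filter fun p => p.job = i).map fun p => min τ p.endTime - min τ p.startTime).sum

/-- Constraint II: job `i` can be worked on at time `τ` if `τ` lies in its window, it has not been
completed yet, and it can still be completed by its deadline, that is, `τ` is at most the adjusted
critical time `d - t + y`, where `y` is the amount of job `i` done before time `τ`. -/
def Schedule.Executable (S : Schedule I) (i : Fin I.n) (τ : ℝ) : Prop :=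
  (I.arrival i : ℝ) ≤ τ ∧ τ ≤ (I.deadline i : ℝ) ∧
    S.workDone i τ < (I.len i : ℝ) ∧
    τ ≤ (I.deadline i : ℝ) - (I.len i : ℝ) + S.workDone i τ

/-- The feasible schedules of the Lazy Bureaucrat Problem with preemption under constraint II. -/
structure Schedule.Feasible (S : Schedule I) : Prop where
  /-- Pieces are nonempty time intervals, at nonnegative times. -/
  nondegenerate : ∀ p ∈ S, 0 ≤ p.startTime ∧ p.startTime < p.endTime
  /-- Only one job is worked on at a time. -/
  ordered : S.Pairwise fun p q => p.endTime ≤ q.startTime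
  /-- Only executable jobs are worked on. -/
  allowed : ∀ p ∈ S, ∀ τ : ℝ, p.startTime ≤ τ → τ < p.endTime → S.Executable p.job τ
  /-- The busy requirement: whenever some job is executable, the bureaucrat works. -/
  busy : ∀ τ : ℝ, 0 ≤ τ → (∃ i, S.Executable i τ) → ∃ p ∈ S, p.startTime ≤ τ ∧ τ < p.endTime

/-- The makespan (the time at which the bureaucrat goes home): the time at which the last piece of
work ends, and `0` if there is no work at all. In a feasible schedule the last piece always ends
with the completion of its job, since a job that is being worked on stays executable until it is
completed. -/
noncomputable def Schedule.makespan (S : Schedule I) : ℝ :=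
  (S.map fun p => p.endTime).foldr max 0

/-- The set of the makespans of all feasible schedules. -/
def Instance.makespans (I : Instance) : Set ℝ :=
  {T | ∃ S : Schedule I, S.Feasible ∧ S.makespan = T}

/-- Instances as lists of natural numbers: `n, a₁, t₁, d₁, …, aₙ, tₙ, dₙ`. -/
def Instance.encode (I : Instance) : List ℕ :=
  I.n :: (List.finRange I.n).flatMap fun i => [I.arrival i, I.len i, I.deadline i]

/-- A piece with rational end points, written with four natural numbers: job `job` is worked on
during `[startNum / den, endNum / den)`. -/
structure PieceCode (I : Instance) where
  job : Fin I.n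
  startNum : ℕ
  endNum : ℕ
  den : ℕ

/-- The piece that is written by a code. (In a feasible schedule `den` cannot be zero, because a
piece is nondegenerate.) -/
noncomputable def PieceCode.toPiece (c : PieceCode I) : Piece I where
  job := c.job
  startTime := (c.startNum : ℝ) / (c.den : ℝ)
  endTime := (c.endNum : ℝ) / (c.den : ℝ)

/-- The schedule that is written by a list of codes. -/
noncomputable def toSchedule (L : List (PieceCode I)) : Schedule I :=
  L.map PieceCode.toPiece

/-- Lists of codes of pieces as lists of natural numbers; jobs are numbered `0, …, n - 1`. -/
def encodePieces (L : List (PieceCode I)) : List ℕ :=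
  L.flatMap fun c => [(c.job : ℕ), c.startNum, c.endNum, c.den]

/-! ### Random access machines

Programs over registers and arrays of natural numbers. The only arithmetic that takes unit time is
addition, truncated subtraction and halving, so that in `k` steps the numbers grow by at most `k`
bits; polynomial time in this model is polynomial time on Turing machines. -/

/-- Expressions: constants, registers, array entries, addition, truncated subtraction, halving. -/
inductive Expr where
  | const (k : ℕ)
  | reg (r : ℕ)
  | get (a : ℕ) (idx : Expr)
  | add (e₁ e₂ : Expr)
  | sub (e₁ e₂ : Expr)
  | half (e : Expr)

/-- Programs. A program mentions only finitely many registers and arrays. -/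
inductive Program where
  /-- Do nothing. -/
  | skip
  /-- Put the value of `e` into register `r`. -/
  | assign (r : ℕ) (e : Expr)
  /-- Put the value of `e` into the entry of array `a` whose index is the value of `idx`. -/
  | store (a : ℕ) (idx e : Expr)
  /-- Append the value of `e` to the output. -/
  | emit (e : Expr)
  /-- Run one program, then another one. -/
  | seq (c₁ c₂ : Program)
  /-- Run `c₁` if the value of `e` is nonzero, and `c₂` otherwise. -/
  | ite (e : Expr) (c₁ c₂ : Program)
  /-- Repeat `c` as long as the value of `e` is nonzero. -/
  | loop (e : Expr) (c : Program)

/-- States: contents of the registers and of the arrays, and the output written so far. -/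
structure State where
  reg : ℕ → ℕ
  arr : ℕ → ℕ → ℕ
  out : List ℕ

/-- The initial state: the input is in array `0`, its length is in register `0`, all other
registers and array entries are `0`, and nothing has been output. -/
def State.init (input : List ℕ) : State where
  reg := fun r => if r = 0 then input.length else 0
  arr := fun a j => if a = 0 then input.getD j 0 else 0
  out := []

/-- The value of an expression. -/
def Expr.eval (s : State) : Expr → ℕ
  | .const k => k
  | .reg r => s.reg r
  | .get a idx => s.arr a (idx.eval s)
  | .add e₁ e₂ => e₁.eval s + e₂.eval s
  | .sub e₁ e₂ => e₁.eval s - e₂.eval s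
  | .half e => e.eval s / 2

/-- The number of steps that it takes to evaluate an expression: one for each operation. -/
def Expr.cost : Expr → ℕ
  | .const _ => 1
  | .reg _ => 1
  | .get _ idx => idx.cost + 1
  | .add e₁ e₂ => e₁.cost + e₂.cost + 1
  | .sub e₁ e₂ => e₁.cost + e₂.cost + 1
  | .half e => e.cost + 1

/-- `Exec c s k s'`: program `c`, started in state `s`, halts after exactly `k` steps in
state `s'`. -/
inductive Exec : Program → State → ℕ → State → Prop where
  | skip (s : State) : Exec .skip s 1 s
  | assign (r : ℕ) (e : Expr) (s : State) :
      Exec (.assign r e) s (e.cost + 1) { s with reg := Function.update s.reg r (e.eval s) }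
  | store (a : ℕ) (idx e : Expr) (s : State) :
      Exec (.store a idx e) s (idx.cost + e.cost + 1)
        { s with
          arr := Function.update s.arr a (Function.update (s.arr a) (idx.eval s) (e.eval s)) }
  | emit (e : Expr) (s : State) :
      Exec (.emit e) s (e.cost + 1) { s with out := s.out ++ [e.eval s] }
  | seq {c₁ c₂ : Program} {s s₁ s₂ : State} {k₁ k₂ : ℕ} :
      Exec c₁ s k₁ s₁ → Exec c₂ s₁ k₂ s₂ → Exec (.seq c₁ c₂) s (k₁ + k₂) s₂
  | ite_true {e : Expr} {c₁ c₂ : Program} {s s₁ : State} {k : ℕ} :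
      e.eval s ≠ 0 → Exec c₁ s k s₁ → Exec (.ite e c₁ c₂) s (e.cost + 1 + k) s₁
  | ite_false {e : Expr} {c₁ c₂ : Program} {s s₁ : State} {k : ℕ} :
      e.eval s = 0 → Exec c₂ s k s₁ → Exec (.ite e c₁ c₂) s (e.cost + 1 + k) s₁
  | loop_done {e : Expr} {c : Program} {s : State} :
      e.eval s = 0 → Exec (.loop e c) s (e.cost + 1) s
  | loop_step {e : Expr} {c : Program} {s s₁ s₂ : State} {k₁ k₂ : ℕ} :
      e.eval s ≠ 0 → Exec c s k₁ s₁ → Exec (.loop e c) s₁ k₂ s₂ →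
        Exec (.loop e c) s (e.cost + 1 + k₁ + k₂) s₂

/-- The size of an input: the total number of bits of its entries, plus the number of entries. -/
def inputSize (input : List ℕ) : ℕ :=
  (input.map fun w => Nat.size w + 1).sum

/-- There is a program which, for each `x` satisfying `valid`, when it is run on the encoding of
`x`, halts after a number of steps that is at most a fixed polynomial in the size of the encoding,
with an output that is correct for `x` in the sense of `correct`. -/
def SolvableInPolyTime {α : Type} (valid : α → Prop) (encode : α → List ℕ)
    (correct : α → List ℕ → Prop) : Prop :=
  ∃ (c : Program) (P : Polynomial ℕ), ∀ x, valid x →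
    ∃ (k : ℕ) (s : State), Exec c (State.init (encode x)) k s ∧
      k ≤ P.eval (inputSize (encode x)) ∧ correct x s.out

/-! ### The two computational tasks -/

/-- A correct answer to "what is the optimal makespan of `I`?": a pair of natural numbers `p, q`
such that `p / q` is the infimum of the makespans of the feasible schedules. -/
def CorrectOptimum (I : Instance) (out : List ℕ) : Prop :=
  ∃ p q : ℕ, 0 < q ∧ out = [p, q] ∧ IsGLB I.makespans ((p : ℝ) / (q : ℝ))

/-- A correct answer to "find a feasible schedule of `I` with makespan at most `T`": the number `0`
if there is none, and otherwise the number `1` followed by such a schedule. -/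
def CorrectSchedule (I : Instance) (T : ℝ) (out : List ℕ) : Prop :=
  (out = [0] ∧ ¬ ∃ S : Schedule I, S.Feasible ∧ S.makespan ≤ T) ∨
    ∃ L : List (PieceCode I), out = 1 :: encodePieces L ∧
      (toSchedule L).Feasible ∧ (toSchedule L).makespan ≤ T

end LazyBureaucrat

namespace LazyBureaucrat

/-! ### A program logic for the random access machine -/

/-! Only jobs with positive length and `a i + t i ≤ D` can ever be worked on; number them `0, …, m -
1` by arrival. For a candidate makespan `C` put `δ = D - C`, and let `N` be the set of jobs that are
started in vain or not at all. When the bureaucrat goes home at `C`, every job of `N` must be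
overdue, so it has received strictly less than `t i - δ`; the other jobs must be complete by then.

The predicate `Valid` expresses this combinatorially. Let `finish` be the completion time of a
work-conserving processor and `lastStart` the last job that finds this processor without waiting
work. The jobs of `N` all come after `lastStart`. They have to be longer than `δ`; the kept jobs
alone have to fit before `C`; the work available when the jobs of `N` are cut by `δ` has to exceed
what is needed to stay busy until each later arrival, and until `C`; and some job from `lastStart`
on has to be kept, because work can only end with the completion of a job.

Necessity (`Sorted.exists_valid`): take for `N` the unfinished jobs from the last start on. If the
processor works throughout, the capacity bounds just compare work done with elapsed time. If it
idles earlier, at `σ`, then some arrived job is already overdue there, and its unused capacity up to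
`t i - δ` exceeds `C - σ`, which pays for the rest.

Sufficiency (`plan_of_valid`, `terminates_simulate`): choose the unit of time so small that all data
are multiples of some `g > m`. Then every strict inequality has a gap of at least `g`, and cutting
each job of `N` by `δ + 1` instead of `δ` is harmless. The jobs of `N` share, in order of arrival,
the amount of work that makes everything end exactly at `C`: an initial part of them is cut by
exactly `δ + 1`, at most one gets a partial amount, the others get nothing. Serving `N` before the
kept jobs, and later arrivals first, keeps each job executable while it is served: the partial job
runs from its arrival on, and a job cut by `δ + 1` is served at a time when some kept job still
needs a unit of work, so that it ends by `C - 1`.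

For fixed `C`, a valid `N` is found by dynamic programming over the arrivals. The conditions on a
prefix depend on `N` only through its number of elements there, so for each number it suffices to
know the least completion time of the kept jobs (`table_le_iff`). A witness is recovered by deciding
the jobs one after the other.

Validity is monotone in `C`, and all its conditions compare integers with `q * C` for some `q ≤ m`.
So it is constant strictly between consecutive multiples of `1 / n!`. Bisection over multiples of `1
/ (2 n!)`, that is over these points and the midpoints between them, determines the infimum even
when it is not attained (`Sorted.isGLB_makespans`). Since `n!` has polynomially many bits, this
takes polynomial time.

For the machine model it is enough to bound the number of iterations of each loop (`Program.bound`);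
correctness is shown by a Hoare-style calculus in which the frame of a program records what it
leaves alone. -/

instance : Add Expr := ⟨Expr.add⟩
instance : Sub Expr := ⟨Expr.sub⟩
instance (k : ℕ) : OfNat Expr k := ⟨Expr.const k⟩

@[simp] theorem Expr.eval_add (s : State) (e f : Expr) : (e + f).eval s = e.eval s + f.eval s := rfl
@[simp] theorem Expr.eval_sub (s : State) (e f : Expr) : (e - f).eval s = e.eval s - f.eval s := rfl
@[simp] theorem Expr.eval_const (s : State) (k : ℕ) : (Expr.const k).eval s = k := rfl
@[simp] theorem Expr.eval_zero (s : State) : (0 : Expr).eval s = 0 := rfl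
@[simp] theorem Expr.eval_one (s : State) : (1 : Expr).eval s = 1 := rfl
@[simp] theorem Expr.eval_reg (s : State) (r : ℕ) : (Expr.reg r).eval s = s.reg r := rfl
@[simp] theorem Expr.eval_get (s : State) (a : ℕ) (e : Expr) :
    (Expr.get a e).eval s = s.arr a (e.eval s) := rfl
@[simp] theorem Expr.eval_half (s : State) (e : Expr) : (Expr.half e).eval s = e.eval s / 2 := rfl

infix:55 " ::= " => Program.assign
infixr:50 " ;; " => Program.seq

/-- The state with register `r` overwritten. -/
def State.setReg (s : State) (r v : ℕ) : State := { s with reg := Function.update s.reg r v }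

/-- The state with an array entry overwritten. -/
def State.setArr (s : State) (a i v : ℕ) : State :=
  { s with arr := Function.update s.arr a (Function.update (s.arr a) i v) }

/-- The state with a number appended to the output. -/
def State.write (s : State) (v : ℕ) : State := { s with out := s.out ++ [v] }

@[simp] theorem State.setReg_reg (s : State) (r v r' : ℕ) :
    (s.setReg r v).reg r' = if r' = r then v else s.reg r' := by
  simp [State.setReg, Function.update_apply]
@[simp] theorem State.setReg_arr (s : State) (r v : ℕ) : (s.setReg r v).arr = s.arr := rfl
@[simp] theorem State.setReg_out (s : State) (r v : ℕ) : (s.setReg r v).out = s.out := rfl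
@[simp] theorem State.setArr_reg (s : State) (a i v : ℕ) : (s.setArr a i v).reg = s.reg := rfl
@[simp] theorem State.setArr_out (s : State) (a i v : ℕ) : (s.setArr a i v).out = s.out := rfl
@[simp] theorem State.setArr_arr (s : State) (a i v a' i' : ℕ) :
    (s.setArr a i v).arr a' i' = if a' = a ∧ i' = i then v else s.arr a' i' := by
  by_cases h : a' = a
  · subst h; simp [State.setArr, Function.update_apply]
  · simp [State.setArr, h]
@[simp] theorem State.write_reg (s : State) (v : ℕ) : (s.write v).reg = s.reg := rfl
@[simp] theorem State.write_arr (s : State) (v : ℕ) : (s.write v).arr = s.arr := rfl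
@[simp] theorem State.write_out (s : State) (v : ℕ) : (s.write v).out = s.out ++ [v] := rfl

/-- A bound for the running time of a program all of whose loops run at most `B` times. -/
def Program.bound (B : ℕ) : Program → ℕ
  | .skip => 1
  | .assign _ e => e.cost + 1
  | .store _ idx e => idx.cost + e.cost + 1
  | .emit e => e.cost + 1
  | .seq c₁ c₂ => c₁.bound B + c₂.bound B
  | .ite e c₁ c₂ => e.cost + 1 + (c₁.bound B + c₂.bound B)
  | .loop e c => (B + 1) * (e.cost + 1 + c.bound B)

/-- The program is fixed, so its nesting depth is a constant; each loop contributes one more factor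
`B + 1`. This reduces polynomial running time to a uniform bound on loop iterations. -/
theorem Program.exists_polynomial_bound (c : Program) :
    ∃ P : Polynomial ℕ, ∀ B, P.eval B = c.bound B := by
  induction c with
  | skip => exact ⟨1, fun B => by simp [Program.bound]⟩
  | assign r e => exact ⟨(e.cost + 1 : ℕ), fun B => by
      simp only [Polynomial.eval_natCast, Program.bound]; rfl⟩
  | store a i e => exact ⟨(i.cost + e.cost + 1 : ℕ), fun B => by
      simp only [Polynomial.eval_natCast, Program.bound]; rfl⟩
  | emit e => exact ⟨(e.cost + 1 : ℕ), fun B => by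
      simp only [Polynomial.eval_natCast, Program.bound]; rfl⟩
  | seq c₁ c₂ h₁ h₂ =>
    obtain ⟨P, hP⟩ := h₁
    obtain ⟨Q, hQ⟩ := h₂
    exact ⟨P + Q, fun B => by simp [Program.bound, hP, hQ]⟩
  | ite e c₁ c₂ h₁ h₂ =>
    obtain ⟨P, hP⟩ := h₁
    obtain ⟨Q, hQ⟩ := h₂
    exact ⟨(e.cost + 1 : ℕ) + (P + Q), fun B => by
      simp only [Polynomial.eval_add, Polynomial.eval_natCast, Program.bound, hP, hQ]; rfl⟩
  | loop e c h =>
    obtain ⟨P, hP⟩ := h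
    exact ⟨(Polynomial.X + 1) * (((e.cost + 1 : ℕ) : Polynomial ℕ) + P), fun B => by
      simp only [Polynomial.eval_mul, Polynomial.eval_add, Polynomial.eval_natCast,
        Program.bound, hP, Polynomial.eval_X, Polynomial.eval_one]; rfl⟩

/-- Run from `s`, the program `c` halts within its time bound in a state satisfying `Q`. -/
def Terminates (B : ℕ) (c : Program) (Q : State → Prop) (s : State) : Prop :=
  ∃ k s', Exec c s k s' ∧ k ≤ c.bound B ∧ Q s'

/-- The registers that a program may write. -/
def Program.regs : Program → List ℕ
  | .skip => []
  | .assign r _ => [r]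
  | .store _ _ _ => []
  | .emit _ => []
  | .seq c₁ c₂ => c₁.regs ++ c₂.regs
  | .ite _ c₁ c₂ => c₁.regs ++ c₂.regs
  | .loop _ c => c.regs

/-- The arrays that a program may write. -/
def Program.arrs : Program → List ℕ
  | .skip => []
  | .assign _ _ => []
  | .store a _ _ => [a]
  | .emit _ => []
  | .seq c₁ c₂ => c₁.arrs ++ c₂.arrs
  | .ite _ c₁ c₂ => c₁.arrs ++ c₂.arrs
  | .loop _ c => c.arrs

/-- Whether a program may produce output. -/
def Program.emits : Program → Bool
  | .skip => false
  | .assign _ _ => false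
  | .store _ _ _ => false
  | .emit _ => true
  | .seq c₁ c₂ => c₁.emits || c₂.emits
  | .ite _ c₁ c₂ => c₁.emits || c₂.emits
  | .loop _ c => c.emits

/-- Two states differ only in what the program `c` may write. -/
structure Frame (c : Program) (s s' : State) : Prop where
  reg : ∀ r, r ∉ c.regs → s'.reg r = s.reg r
  arr : ∀ a, a ∉ c.arrs → s'.arr a = s.arr a
  out : c.emits = false → s'.out = s.out

theorem Frame.refl (c : Program) (s : State) : Frame c s s :=
  ⟨fun _ _ => rfl, fun _ _ => rfl, fun _ => rfl⟩

theorem Frame.trans {c : Program} {s₁ s₂ s₃ : State} (h : Frame c s₁ s₂) (h' : Frame c s₂ s₃) :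
    Frame c s₁ s₃ :=
  ⟨fun r hr => (h'.reg r hr).trans (h.reg r hr), fun a ha => (h'.arr a ha).trans (h.arr a ha),
    fun ho => (h'.out ho).trans (h.out ho)⟩

theorem Frame.mono {c c' : Program} {s s' : State} (h : Frame c s s')
    (hr : c.regs ⊆ c'.regs) (ha : c.arrs ⊆ c'.arrs) (ho : c'.emits = false → c.emits = false) :
    Frame c' s s' :=
  ⟨fun r hr' => h.reg r fun h' => hr' (hr h'), fun a ha' => h.arr a fun h' => ha' (ha h'),
    fun ho' => h.out (ho ho')⟩

theorem Exec.frame {c : Program} {s s' : State} {k : ℕ} (h : Exec c s k s') : Frame c s s' := by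
  induction h with
  | skip s => exact Frame.refl _ _
  | assign r e s =>
    refine ⟨fun r' hr => ?_, fun _ _ => rfl, fun _ => rfl⟩
    simp only [Program.regs, List.mem_singleton] at hr
    simp [hr]
  | store a i e s =>
    refine ⟨fun _ _ => rfl, fun a' ha => ?_, fun _ => rfl⟩
    simp only [Program.arrs, List.mem_singleton] at ha
    simp [ha]
  | emit e s => exact ⟨fun _ _ => rfl, fun _ _ => rfl, fun h => by simp [Program.emits] at h⟩
  | seq _ _ h₁ h₂ =>
    exact (h₁.mono (List.subset_append_left _ _) (List.subset_append_left _ _)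
      (by simp +contextual [Program.emits])).trans
      (h₂.mono (List.subset_append_right _ _) (List.subset_append_right _ _)
      (by simp +contextual [Program.emits]))
  | ite_true _ _ h =>
    exact h.mono (List.subset_append_left _ _) (List.subset_append_left _ _)
      (by simp +contextual [Program.emits])
  | ite_false _ _ h =>
    exact h.mono (List.subset_append_right _ _) (List.subset_append_right _ _)
      (by simp +contextual [Program.emits])
  | loop_done _ => exact Frame.refl _ _
  | loop_step _ _ _ h₁ h₂ =>
    exact Frame.trans (h₁.mono (fun _ h => h) (fun _ h => h) (fun h => h)) h₂

namespace Terminates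

variable {B : ℕ} {c c₁ c₂ : Program} {Q R : State → Prop} {s : State}

/-- The frame comes for free from the syntax of `c`. Specifications of subprograms can therefore
mention only what is computed; that other registers and arrays are preserved is later settled mostly
by `decide`. -/
theorem mono (h : Terminates B c R s) (hQ : ∀ s', Frame c s s' → R s' → Q s') :
    Terminates B c Q s := by
  obtain ⟨k, s', he, hk, hR⟩ := h
  exact ⟨k, s', he, hk, hQ s' he.frame hR⟩

theorem skip (h : Q s) : Terminates B .skip Q s := ⟨_, _, .skip s, le_rfl, h⟩

theorem assign {r : ℕ} {e : Expr} (h : Q (s.setReg r (e.eval s))) :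
    Terminates B (.assign r e) Q s := ⟨_, _, .assign r e s, le_rfl, h⟩

theorem store {a : ℕ} {i e : Expr} (h : Q (s.setArr a (i.eval s) (e.eval s))) :
    Terminates B (.store a i e) Q s := ⟨_, _, .store a i e s, le_rfl, h⟩

theorem emit {e : Expr} (h : Q (s.write (e.eval s))) :
    Terminates B (.emit e) Q s := ⟨_, _, .emit e s, le_rfl, h⟩

theorem seq (h : Terminates B c₁ (Terminates B c₂ Q) s) : Terminates B (.seq c₁ c₂) Q s := by
  obtain ⟨k₁, s₁, h₁, hk₁, k₂, s₂, h₂, hk₂, hQ⟩ := h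
  exact ⟨_, _, .seq h₁ h₂, Nat.add_le_add hk₁ hk₂, hQ⟩

theorem seq_of (h₁ : Terminates B c₁ R s) (h₂ : ∀ s', Frame c₁ s s' → R s' → Terminates B c₂ Q s') :
    Terminates B (.seq c₁ c₂) Q s := seq (h₁.mono h₂)

theorem ite {e : Expr} (h₁ : e.eval s ≠ 0 → Terminates B c₁ Q s)
    (h₂ : e.eval s = 0 → Terminates B c₂ Q s) : Terminates B (.ite e c₁ c₂) Q s := by
  by_cases he : e.eval s = 0
  · obtain ⟨k, s', h, hk, hQ⟩ := h₂ he
    exact ⟨_, _, .ite_false he h, by simp only [Program.bound]; omega, hQ⟩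
  · obtain ⟨k, s', h, hk, hQ⟩ := h₁ he
    exact ⟨_, _, .ite_true he h, by simp only [Program.bound]; omega, hQ⟩

/-- The rule for loops: `Inv n` is the invariant when at most `n` iterations are left. -/
theorem loop {e : Expr} (Inv : ℕ → State → Prop) {n : ℕ} (hn : n ≤ B) (h₀ : Inv n s)
    (hstep : ∀ n s', Frame c s s' → Inv n s' → e.eval s' ≠ 0 →
      ∃ k, n = k + 1 ∧ Terminates B c (Inv k) s')
    (hQ : ∀ n s', Frame c s s' → Inv n s' → e.eval s' = 0 → Q s') :
    Terminates B (.loop e c) Q s := by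
  suffices H : ∀ n s', Frame c s s' → Inv n s' →
      ∃ k s'', Exec (.loop e c) s' k s'' ∧ k ≤ (n + 1) * (e.cost + 1 + c.bound B) ∧ Q s'' by
    obtain ⟨k, s'', h, hk, hq⟩ := H n s (Frame.refl _ _) h₀
    exact ⟨k, s'', h, hk.trans (Nat.mul_le_mul_right _ (by omega)), hq⟩
  intro n
  induction n with
  | zero =>
    intro s' hf hI
    by_cases he : e.eval s' = 0
    · exact ⟨_, _, .loop_done he, by omega, hQ _ _ hf hI he⟩
    · obtain ⟨k, hk, -⟩ := hstep _ _ hf hI he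
      omega
  | succ n ih =>
    intro s' hf hI
    by_cases he : e.eval s' = 0
    · exact ⟨_, _, .loop_done he, by nlinarith, hQ _ _ hf hI he⟩
    · obtain ⟨k, hk, k₁, s₁, h₁, hk₁, hI₁⟩ := hstep _ _ hf hI he
      obtain rfl : n = k := by omega
      obtain ⟨k₂, s₂, h₂, hk₂, hq⟩ := ih s₁ (hf.trans h₁.frame) hI₁
      exact ⟨_, _, .loop_step he h₁ h₂, by nlinarith, hq⟩

end Terminates

/-- `for r := 0, …, e - 1 do c`. -/
def Program.forLoop (r : ℕ) (e : Expr) (c : Program) : Program :=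
  r ::= 0 ;; .loop (e - .reg r) (c ;; r ::= .reg r + 1)

namespace Terminates

variable {B : ℕ} {c : Program} {Q : State → Prop} {s : State}

/-- The limit `e` is re-evaluated in every round, hence the demand that its value survive everything
the loop may write. The body has to restore the invariant for the state in which the counter has
already been advanced. -/
theorem forLoop {r : ℕ} {e : Expr} (n : ℕ) (hn : n ≤ B) (hr : r ∉ c.regs)
    (he : ∀ s', Frame (.forLoop r e c) s s' → e.eval s' = n)
    (Inv : ℕ → State → Prop) (h₀ : Inv 0 (s.setReg r 0))
    (hstep : ∀ i < n, ∀ s', Frame (.forLoop r e c) s s' → s'.reg r = i → Inv i s' →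
      Terminates B c (fun s'' => Inv (i + 1) (s''.setReg r (i + 1))) s')
    (hQ : ∀ s', Frame (.forLoop r e c) s s' → Inv n s' → Q s') :
    Terminates B (.forLoop r e c) Q s := by
  have hfr : ∀ s', Frame (c ;; r ::= .reg r + 1) (s.setReg r 0) s' →
      Frame (.forLoop r e c) s s' := fun s' h =>
    Frame.trans (s₂ := s.setReg r 0)
      ⟨fun r' hr' => by
        have : r' ≠ r := fun h => hr' (by simp [Program.forLoop, Program.regs, h])
        simp [this], fun _ _ => rfl, fun _ => rfl⟩
      (h.mono (fun x hx => by simpa [Program.forLoop, Program.regs] using Or.inr hx)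
        (fun x hx => by simpa [Program.forLoop, Program.arrs] using hx)
        (by simp [Program.forLoop, Program.emits]))
  refine seq (assign ?_)
  change Terminates B _ _ (s.setReg r 0)
  refine loop (fun k s' => ∃ i, i + k = n ∧ s'.reg r = i ∧ Inv i s') hn
    ⟨0, by omega, by simp, h₀⟩ ?_ ?_
  · rintro k s' hf ⟨i, hik, hri, hI⟩ hne
    have he' := he s' (hfr s' hf)
    simp only [Expr.eval_sub, he', Expr.eval_reg, hri] at hne
    refine ⟨k - 1, by omega, seq ((hstep i (by omega) s' (hfr s' hf) hri hI).mono ?_)⟩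
    intro s'' hf' hI'
    have hr' : s''.reg r = i := (hf'.reg r hr).trans hri
    refine assign ⟨i + 1, by omega, by simp [hr'], ?_⟩
    simpa [hr'] using hI'
  · rintro k s' hf ⟨i, hik, hri, hI⟩ h0
    have he' := he s' (hfr s' hf)
    simp only [Expr.eval_sub, he', Expr.eval_reg, hri] at h0
    obtain rfl : i = n := by omega
    exact hQ s' (hfr s' hf) hI

end Terminates

/-! ### Work-conserving completion times -/

section Finish

variable {α : Type*} [Semiring α] [LinearOrder α]

/-- The completion time of the first `j` jobs, if job `i` is released at time `a i` and `w i` units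
of work are spent on it, by a processor that never idles without need. -/
def finish (a w : ℕ → α) : ℕ → α
  | 0 => 0
  | j + 1 => max (finish a w j) (a j) + w j

/-- The last of the first `j` jobs that finds no work waiting at its arrival. -/
def lastStart (a t : ℕ → α) : ℕ → ℕ
  | 0 => 0
  | j + 1 => if finish a t j ≤ a j then j else lastStart a t j

/-- The number of jobs among the first `j` ones that belong to `N`. -/
def count (N : ℕ → Bool) : ℕ → ℕ
  | 0 => 0
  | j + 1 => count N j + if N j then 1 else 0

/-- Processing times, with the jobs that belong to `N` left out. -/
def keep (t : ℕ → α) (N : ℕ → Bool) (i : ℕ) : α := if N i then 0 else t i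

/-- The combinatorial conditions under which the jobs outside of `N` can be completed until time
`C`, such that the jobs in `N` cannot be completed any more at that time. -/
structure Valid (m : ℕ) (a t : ℕ → α) (D C : α) (N : ℕ → Bool) : Prop where
  long : ∀ i < m, N i = true → D < C + t i
  fits : finish a (keep t N) m ≤ C
  busy : ∀ j < m, count N j = 0 ∨ a j + count N j * D < finish a t j + count N j * C
  last : count N m = 0 ∨
    (count N m + lastStart a t m < m ∧ C + count N m * D < finish a t m + count N m * C)

/-! ### Counting, completion times and the last start -/

theorem count_mono (N : ℕ → Bool) {i j : ℕ} (h : i ≤ j) : count N i ≤ count N j := by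
  induction j, h using Nat.le_induction with
  | base => exact le_rfl
  | succ j _ ih => exact ih.trans (by simp [count])

theorem count_le (N : ℕ → Bool) (j : ℕ) : count N j ≤ j := by
  induction j with
  | zero => simp [count]
  | succ j ih => simp only [count]; split <;> omega

theorem count_pos {N : ℕ → Bool} {i j : ℕ} (h : i < j) (hN : N i = true) : 0 < count N j :=
  lt_of_lt_of_le (by simp [count, hN]) (count_mono N h)

theorem count_eq_zero {N : ℕ → Bool} {i j : ℕ} (h : count N j = 0) (hi : i < j) : N i = false := by
  by_contra hN
  have := count_pos hi (by simpa using hN)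
  omega

theorem count_eq_zero_of {N : ℕ → Bool} {j : ℕ} (h : ∀ i < j, N i = false) : count N j = 0 := by
  induction j with
  | zero => rfl
  | succ j ih => simp [count, ih fun i hi => h i (by omega), h j (by omega)]

theorem count_congr {N N' : ℕ → Bool} {j : ℕ} (h : ∀ i < j, N i = N' i) :
    count N j = count N' j := by
  induction j with
  | zero => rfl
  | succ j ih => simp [count, ih fun i hi => h i (by omega), h j (by omega)]

theorem count_add_of_forall {N : ℕ → Bool} {i j : ℕ} (hij : i ≤ j)
    (h : ∀ l, i ≤ l → l < j → N l = true) : count N j + i = count N i + j := by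
  induction j, hij using Nat.le_induction with
  | base => rfl
  | succ j hj ih =>
    have := ih fun l h₁ h₂ => h l h₁ (by omega)
    simp [count, h j hj (by omega)]
    omega

theorem finish_congr {a w w' : ℕ → α} {j : ℕ} (h : ∀ i < j, w i = w' i) :
    finish a w j = finish a w' j := by
  induction j with
  | zero => rfl
  | succ j ih => simp [finish, ih fun i hi => h i (by omega), h j (by omega)]

theorem lastStart_lt {a t : ℕ → α} {m : ℕ} (hm : 0 < m) : lastStart a t m < m := by
  induction m with
  | zero => omega
  | succ j ih =>
    simp only [lastStart]
    split
    · omega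
    · rcases Nat.eq_zero_or_pos j with rfl | hj
      · simp [lastStart]
      · have := ih hj
        omega

theorem lt_finish_of_lastStart_lt {a t : ℕ → α} {m j : ℕ} (h : lastStart a t m < j) (hj : j < m) :
    a j < finish a t j := by
  induction m with
  | zero => omega
  | succ k ih =>
    simp only [lastStart] at h
    split at h
    · omega
    · rcases Nat.lt_or_ge j k with hk | hk
      · exact ih h hk
      · obtain rfl : j = k := by omega
        exact not_le.mp (by assumption)

theorem finish_lastStart_le {a t : ℕ → α} {m : ℕ} (ha : 0 ≤ a 0) :
    finish a t (lastStart a t m) ≤ a (lastStart a t m) := by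
  induction m with
  | zero => simpa [lastStart, finish] using ha
  | succ k ih =>
    simp only [lastStart]
    split
    · assumption
    · exact ih

/-- A work-conserving processor is last out of work at some arrival `a i` (or never), and then needs
exactly the work of the jobs `i, …, j - 1`. Together with `add_sum_le_finish` this turns completion
times into suffix sums. -/
theorem finish_le {a w : ℕ → α} {j : ℕ} {v : α} (hv : ∑ l ∈ Finset.range j, w l ≤ v)
    (h : ∀ i < j, a i + ∑ l ∈ Finset.Ico i j, w l ≤ v) : finish a w j ≤ v := by
  suffices H : ∀ k ≤ j, finish a w k + ∑ l ∈ Finset.Ico k j, w l ≤ v by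
    simpa using H j le_rfl
  intro k
  induction k with
  | zero => intro _; simpa [finish] using hv
  | succ k ih =>
    intro hk
    have h₁ := ih (by omega)
    have h₂ := h k (by omega)
    rw [Finset.sum_eq_sum_Ico_succ_bot (show k < j by omega), ← add_assoc] at h₁ h₂
    simp only [finish]
    rcases le_total (finish a w k) (a k) with h' | h'
    · rwa [max_eq_right h']
    · rwa [max_eq_left h']

theorem finish_eq_add_sum {a w : ℕ → α} {i j : ℕ} (h : i ≤ j)
    (hb : ∀ l, i ≤ l → l < j → a l ≤ finish a w l) :
    finish a w j = finish a w i + ∑ l ∈ Finset.Ico i j, w l := by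
  induction j, h using Nat.le_induction with
  | base => simp
  | succ j hj ih =>
    rw [Finset.sum_Ico_succ_top hj, ← add_assoc, ← ih fun l h₁ h₂ => hb l h₁ (by omega), finish,
      max_eq_left (hb j hj (by omega))]

/-- After the last start no maximum in `finish` is attained by an arrival, so the completion time is
linear in the work. This is the form in which capacities are compared with `finish`. -/
theorem finish_eq_lastStart {a t : ℕ → α} {m j : ℕ} (ha : 0 ≤ a 0) (hj : lastStart a t m < j)
    (hjm : j ≤ m) : finish a t j =
      a (lastStart a t m) + ∑ l ∈ Finset.Ico (lastStart a t m) j, t l := by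
  rw [finish_eq_add_sum (show lastStart a t m + 1 ≤ j from hj)
    fun l h₁ h₂ => (lt_finish_of_lastStart_lt (by omega : lastStart a t m < l) (by omega)).le,
    finish, max_eq_right (finish_lastStart_le ha), Finset.sum_eq_sum_Ico_succ_bot hj, add_assoc]

variable [IsStrictOrderedRing α]

theorem finish_add_sum_le (a w : ℕ → α) {i j : ℕ} (h : i ≤ j) :
    finish a w i + ∑ l ∈ Finset.Ico i j, w l ≤ finish a w j := by
  induction j, h using Nat.le_induction with
  | base => simp
  | succ j hj ih =>
    rw [Finset.sum_Ico_succ_top hj, ← add_assoc]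
    exact add_le_add_left (ih.trans (le_max_left _ _)) _

theorem add_sum_le_finish (a w : ℕ → α) {i j : ℕ} (h : i < j) :
    a i + ∑ l ∈ Finset.Ico i j, w l ≤ finish a w j := by
  have h₁ := finish_add_sum_le a w (show i + 1 ≤ j from h)
  rw [Finset.sum_eq_sum_Ico_succ_bot h, ← add_assoc]
  exact (add_le_add_left (add_le_add_left (le_max_right _ _) _) _).trans h₁

/-- The maximum with an arrival time can only absorb part of a cut, so a cut never saves more time
than its size. It gives lower bounds for completion times after the jobs of `N` have been shortened.
-/
theorem finish_le_finish_add (a t w u : ℕ → α) (j : ℕ) (h : ∀ i < j, t i ≤ w i + u i)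
    (hu : ∀ i < j, 0 ≤ u i) :
    finish a t j ≤ finish a w j + ∑ l ∈ Finset.range j, u l := by
  induction j with
  | zero => simp [finish]
  | succ j ih =>
    have h₁ := ih (fun i hi => h i (by omega)) (fun i hi => hu i (by omega))
    have h₂ : 0 ≤ ∑ l ∈ Finset.range j, u l :=
      Finset.sum_nonneg fun i hi => hu i (by simp at hi; omega)
    simp only [finish, Finset.sum_range_succ]
    have h₃ : max (finish a t j) (a j) ≤ max (finish a w j) (a j) + ∑ l ∈ Finset.range j, u l :=
      max_le (h₁.trans (add_le_add_left (le_max_left _ _) _))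
        ((le_max_right _ _).trans (le_add_of_nonneg_right h₂))
    calc _ ≤ (max (finish a w j) (a j) + ∑ l ∈ Finset.range j, u l) + (w j + u j) :=
          add_le_add h₃ (h j (by omega))
      _ = _ := by abel

end Finish

/-! ### Change of scale -/

theorem finish_cast (a w : ℕ → ℕ) (j : ℕ) :
    ((finish a w j : ℕ) : ℝ) = finish (fun i => (a i : ℝ)) (fun i => (w i : ℝ)) j := by
  induction j with
  | zero => simp [finish]
  | succ j ih => simp [finish, ih]

theorem lastStart_cast (a t : ℕ → ℕ) (j : ℕ) :
    lastStart (fun i => (a i : ℝ)) (fun i => (t i : ℝ)) j = lastStart a t j := by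
  induction j with
  | zero => rfl
  | succ j ih => simp [lastStart, ih, ← finish_cast]

theorem valid_cast {m : ℕ} {a t : ℕ → ℕ} {D C : ℕ} {N : ℕ → Bool} :
    Valid m (fun i => (a i : ℝ)) (fun i => (t i : ℝ)) D C N ↔ Valid m a t D C N := by
  have hk : keep (fun i => (t i : ℝ)) N = fun i => ((keep t N i : ℕ) : ℝ) := by
    funext i; simp [keep]
  constructor
  · rintro ⟨h₁, h₂, h₃, h₄⟩
    rw [hk, ← finish_cast] at h₂
    simp only [← finish_cast, lastStart_cast] at h₃ h₄
    exact ⟨by exact_mod_cast h₁, by exact_mod_cast h₂, by exact_mod_cast h₃,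
      by exact_mod_cast h₄⟩
  · rintro ⟨h₁, h₂, h₃, h₄⟩
    refine ⟨by exact_mod_cast h₁, ?_, ?_, ?_⟩
    · rw [hk, ← finish_cast]; exact_mod_cast h₂
    · simp only [← finish_cast]; exact_mod_cast h₃
    · simp only [← finish_cast, lastStart_cast]; exact_mod_cast h₄

theorem finish_scale {c : ℝ} (hc : 0 < c) (a w : ℕ → ℝ) (j : ℕ) :
    finish (fun i => c * a i) (fun i => c * w i) j = c * finish a w j := by
  induction j with
  | zero => simp [finish]
  | succ j ih => simp [finish, ih, mul_add, mul_max_of_nonneg _ _ hc.le]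

theorem lastStart_scale {c : ℝ} (hc : 0 < c) (a t : ℕ → ℝ) (j : ℕ) :
    lastStart (fun i => c * a i) (fun i => c * t i) j = lastStart a t j := by
  induction j with
  | zero => rfl
  | succ j ih => simp [lastStart, ih, finish_scale hc, hc]

theorem valid_scale {c : ℝ} (hc : 0 < c) {m : ℕ} {a t : ℕ → ℝ} {D C : ℝ} {N : ℕ → Bool} :
    Valid m (fun i => c * a i) (fun i => c * t i) (c * D) (c * C) N ↔ Valid m a t D C N := by
  have hk : keep (fun i => c * t i) N = fun i => c * keep t N i := by
    funext i; simp [keep]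
  have e₁ : ∀ x y z u v : ℝ, x + y * (c * z) < c * u + y * (c * v) ↔
      x + c * (y * z) < c * (u + y * v) := fun x y z u v => by ring_nf
  have h₁ : (∀ i < m, N i = true → c * D < c * C + c * t i) ↔
      ∀ i < m, N i = true → D < C + t i := by
    simp only [← mul_add, mul_lt_mul_iff_right₀ hc]
  have h₂ : finish (fun i => c * a i) (keep (fun i => c * t i) N) m ≤ c * C ↔
      finish a (keep t N) m ≤ C := by
    rw [hk, finish_scale hc, mul_le_mul_iff_right₀ hc]
  constructor
  · rintro ⟨g₁, g₂, g₃, g₄⟩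
    simp only [finish_scale hc, lastStart_scale hc, e₁, ← mul_add, mul_lt_mul_iff_right₀ hc]
      at g₃ g₄
    exact ⟨h₁.1 g₁, h₂.1 g₂, g₃, g₄⟩
  · rintro ⟨g₁, g₂, g₃, g₄⟩
    refine ⟨h₁.2 g₁, h₂.2 g₂, ?_, ?_⟩ <;>
    simp only [finish_scale hc, lastStart_scale hc, e₁, ← mul_add, mul_lt_mul_iff_right₀ hc]
    exacts [g₃, g₄]

/-! ### Dependence of validity on the makespan -/

/-- A later `C` shrinks the cuts `D - C`. In the last condition `C` also occurs on the unfavourable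
side, but only once, and there are at least as many cuts as that when `N` is nonempty. -/
theorem Valid.mono {m : ℕ} {a t : ℕ → ℝ} {D C C' : ℝ} {N : ℕ → Bool} (h : Valid m a t D C N)
    (hC : C ≤ C') : Valid m a t D C' N := by
  refine ⟨fun i hi hN => (h.long i hi hN).trans_le (by linarith), h.fits.trans hC,
    fun j hj => (h.busy j hj).imp_right fun h' => ?_, ?_⟩
  · have : (count N j : ℝ) * C ≤ count N j * C' := by gcongr
    linarith
  · rcases Nat.eq_zero_or_pos (count N m) with h0 | h0
    · exact Or.inl h0
    · refine Or.inr ⟨(h.last.resolve_left (by omega)).1, ?_⟩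
      have h' := (h.last.resolve_left (by omega)).2
      have : (1 : ℝ) ≤ count N m := by exact_mod_cast h0
      nlinarith

/-- Between two consecutive multiples of `1 / f`, validity does not depend on the makespan. -/
theorem Valid.of_same_interval {m : ℕ} {a t : ℕ → ℕ} {D f k : ℕ} {C C' : ℝ} {N : ℕ → Bool}
    (hf : ∀ q, 0 < q → q ≤ m → q ∣ f) (hf0 : 0 < f)
    (h : Valid m (fun i => (a i : ℝ)) (fun i => (t i : ℝ)) D C N)
    (hC : f * C < k + 1) (hC' : (k : ℝ) < f * C') :
    Valid m (fun i => (a i : ℝ)) (fun i => (t i : ℝ)) D C' N := by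
  have hfR : (0 : ℝ) < f := by exact_mod_cast hf0
  -- With `f = q * e`, the inequality becomes `r * e < f * C < k + 1`. Both ends are integers, so `r
  -- * e ≤ k < f * C'`.
  have key : ∀ (r : ℤ) (q : ℕ), 0 < q → q ∣ f → (r : ℝ) < q * C → (r : ℝ) < q * C' := by
    rintro r q hq ⟨e, he⟩ hr
    have heq : (f : ℝ) = q * e := by exact_mod_cast he
    have he0 : (0 : ℝ) < e := by
      rcases Nat.eq_zero_or_pos e with h0 | h0
      · simp [h0] at he; omega
      · exact_mod_cast h0
    have h₁ : (r : ℝ) * e < k + 1 := by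
      rw [heq] at hC
      nlinarith
    have h₂ : r * (e : ℤ) < k + 1 := by exact_mod_cast h₁
    have h₃ : ((r * (e : ℤ) : ℤ) : ℝ) ≤ (k : ℤ) := by exact_mod_cast (by omega : r * (e : ℤ) ≤ k)
    push_cast at h₃
    rw [heq] at hC'
    by_contra hcon
    push Not at hcon
    nlinarith
  have hk : keep (fun i => (t i : ℝ)) N = fun i => ((keep t N i : ℕ) : ℝ) := by
    funext i; simp [keep]
  refine ⟨fun i hi hN => ?_, ?_, fun j hj => ?_, ?_⟩
  · have := key ((D : ℤ) - t i) 1 one_pos (one_dvd _)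
      (by push_cast; linarith [h.long i hi hN])
    push_cast at this
    linarith
  · have h' := h.fits
    rw [hk, ← finish_cast] at h' ⊢
    have h₁ : (f : ℝ) * (finish a (keep t N) m : ℕ) < k + 1 := by nlinarith
    have h₂ : f * finish a (keep t N) m < k + 1 := by exact_mod_cast h₁
    have h₃ : (f : ℝ) * (finish a (keep t N) m : ℕ) ≤ k := by
      exact_mod_cast (by omega : f * finish a (keep t N) m ≤ k)
    by_contra hcon
    push Not at hcon
    nlinarith
  · rcases Nat.eq_zero_or_pos (count N j) with h0 | h0
    · exact Or.inl h0
    · right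
      have h' := (h.busy j hj).resolve_left (by omega)
      rw [← finish_cast] at h' ⊢
      have := key ((a j : ℤ) + count N j * D - finish a t j) (count N j) h0
        (hf _ h0 ((count_le N j).trans hj.le)) (by push_cast; linarith)
      push_cast at this
      linarith
  · rcases Nat.eq_zero_or_pos (count N m) with h0 | h0
    · exact Or.inl h0
    · obtain ⟨h₁, h'⟩ := h.last.resolve_left (by omega)
      refine Or.inr ⟨h₁, ?_⟩
      rw [← finish_cast] at h' ⊢
      -- One copy of `C` cancels: the effective coefficient is `count N m - 1`, and if this is zero
      -- the condition does not involve `C`.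
      obtain ⟨q, hq⟩ : ∃ q, count N m = q + 1 := ⟨count N m - 1, by omega⟩
      rw [hq] at h' ⊢
      push_cast at h' ⊢
      rcases Nat.eq_zero_or_pos q with rfl | hq0
      · simp at h' ⊢; linarith
      · have := key (((q : ℤ) + 1) * D - finish a t m) q hq0
          (hf _ hq0 (by have := count_le N m; omega)) (by push_cast; linarith)
        push_cast at this
        linarith

/-- At `C = D` nothing is cut. Either all jobs fit before `D`, or dropping every job after the last
start leaves exactly the jobs that end by `D`, while the dropped ones provide enough work to stay
busy. This gives the bisection its upper end. -/
theorem exists_valid_deadline {m : ℕ} {a t : ℕ → ℕ} {D : ℕ}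
    (hmono : ∀ i j, i ≤ j → j < m → a i ≤ a j)
    (hw : ∀ i < m, a i + t i ≤ D) (ht : ∀ i < m, 0 < t i) : ∃ N, Valid m a t D D N := by
  rcases Nat.eq_zero_or_pos m with rfl | hm
  · exact ⟨fun _ => false, by simp, by simp [finish], by simp, by simp [count]⟩
  have hlt := lastStart_lt (a := a) (t := t) hm
  by_cases hfit : finish a t m ≤ D
  · refine ⟨fun _ => false, by simp, ?_, fun j _ => Or.inl (count_eq_zero_of (by simp)),
      Or.inl (count_eq_zero_of (by simp))⟩
    rwa [finish_congr (w' := t) (by simp [keep])]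
  push Not at hfit
  set b := lastStart a t m with hb
  let N : ℕ → Bool := fun i => decide (b < i)
  have hN0 : ∀ j ≤ b + 1, count N j = 0 := fun j hj =>
    count_eq_zero_of fun i hi => by simp [N]; omega
  have hcm : count N m + (b + 1) = m := by
    have := count_add_of_forall (N := N) (i := b + 1) (j := m) (by omega) (by simp [N]; omega)
    rw [hN0 _ le_rfl] at this
    omega
  refine ⟨N, fun i hi _ => by have := ht i hi; omega, ?_, fun j hj => ?_,
    Or.inr ⟨by omega, by simpa using hfit⟩⟩
  · have h₁ : ∀ j ≤ m, b + 1 ≤ j → finish a (keep t N) j ≤ D := by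
      intro j hj hbj
      induction j, hbj using Nat.le_induction with
      | base =>
        rw [finish_congr (w' := t) fun i hi => by simp [keep, N]; omega, finish,
          max_eq_right (finish_lastStart_le (Nat.zero_le _))]
        exact hw _ hlt
      | succ j hbj ih =>
        have : keep t N j = 0 := by simp [keep, N]; omega
        rw [finish, this, add_zero]
        have := hw j (by omega)
        exact max_le (ih (by omega)) (by omega)
    exact h₁ m le_rfl hlt
  · by_cases hbj : j ≤ b
    · exact Or.inl (hN0 j (by omega))
    · right
      have := lt_finish_of_lastStart_lt (by omega : lastStart a t m < j) hj
      simpa using this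

/-! ### The dynamic program -/

section Table

variable (a t : ℕ → ℕ) (D C : ℕ) (XN XK : ℕ → ℕ)

/-- The first part of a step of the dynamic program: the arrival of job `j`. -/
def release (j : ℕ) (V : ℕ → ℕ) (q : ℕ) : ℕ :=
  if q = 0 ∨ a j + q * (D - C) < finish a t j then max (V q) (a j) else C + 1

/-- The second part of a step of the dynamic program: the decision about job `j`. -/
def extend (j : ℕ) (V : ℕ → ℕ) (q : ℕ) : ℕ :=
  min (if XN j = 0 then min (C + 1) (V q + t j) else C + 1)
    (if q ≠ 0 ∧ D < C + t j ∧ XK j = 0 then V (q - 1) else C + 1)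

/-- The table of the dynamic program: the least completion time (or a number exceeding `C`) of the
jobs to be completed among the first `j` ones, if `q` of these are not to be completed. -/
def table : ℕ → ℕ → ℕ
  | 0 => fun q => if q = 0 then 0 else C + 1
  | j + 1 => extend t D C XN XK j (release a t D C j (table j))

/-- The choice `N` is consistent with the jobs that are forced into it or out of it. -/
def Consistent (m : ℕ) (N : ℕ → Bool) : Prop :=
  ∀ i < m, (N i = true → XK i = 0) ∧ (N i = false → XN i = 0)

/-- The condition at an arrival depends on the previous choices only through `q`, and the completion
time is monotone in that of the shorter prefix, so keeping the minimum for each `q` loses nothing.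
Values above `C` mean failure and are never compared with each other; hence the restriction `v ≤ C`.
-/
theorem table_le_iff (hCD : C ≤ D) (j q v : ℕ) (hv : v ≤ C) :
    table a t D C XN XK j q ≤ v ↔ ∃ N : ℕ → Bool, Consistent XN XK j N ∧ count N j = q ∧
      finish a (keep t N) j ≤ v ∧ (∀ i < j, N i = true → D < C + t i) ∧
      ∀ i < j, count N i = 0 ∨ a i + count N i * D < finish a t i + count N i * C := by
  -- The table works with the truncated difference `D - C`, whereas `Valid` avoids subtraction; for
  -- `C ≤ D` they agree.
  have hsub : ∀ x y q : ℕ, x + q * (D - C) < y ↔ x + q * D < y + q * C := by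
    intro x y q
    obtain ⟨d, rfl⟩ := Nat.exists_eq_add_of_le hCD
    rw [Nat.add_sub_cancel_left, mul_add]
    omega
  have hrelease : ∀ j V q v, v ≤ C → (release a t D C j V q ≤ v ↔
      V q ≤ v ∧ a j ≤ v ∧ (q = 0 ∨ a j + q * D < finish a t j + q * C)) := by
    intro j V q v hv
    simp only [release, hsub]
    split
    · simp only [max_le_iff]; tauto
    · constructor
      · intro; omega
      · tauto
  induction j generalizing q v with
  | zero =>
    simp only [table, Consistent]
    constructor
    · intro h
      refine ⟨fun _ => false, by simp, ?_, by simp [finish], by simp, by simp⟩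
      split at h
      · simp [count, *]
      · omega
    · rintro ⟨N, -, rfl, -⟩
      simp [count]
  | succ j ih =>
    have hxt : table a t D C XN XK (j + 1) q ≤ v ↔
        (XN j = 0 ∧ release a t D C j (table a t D C XN XK j) q + t j ≤ v) ∨
        (q ≠ 0 ∧ D < C + t j ∧ XK j = 0 ∧
          release a t D C j (table a t D C XN XK j) (q - 1) ≤ v) := by
      simp only [table, extend, min_le_iff]
      refine or_congr ?_ ?_
      · split
        · simp only [min_le_iff, *]
          constructor
          · intro; exact ⟨trivial, by omega⟩
          · exact fun h => Or.inr h.2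
        · constructor
          · intro; omega
          · tauto
      · split
        · tauto
        · constructor
          · intro; omega
          · tauto
    rw [hxt]
    constructor
    · rintro (⟨hX, h⟩ | ⟨hq, hl, hX, h⟩)
      · have h' := (hrelease j (table a t D C XN XK j) q (v - t j) (by omega)).1 (by omega)
        obtain ⟨N, hc, hcnt, hfin, hlong, hbusy⟩ := (ih q (v - t j) (by omega)).1 h'.1
        have hco : ∀ i < j, Function.update N j false i = N i := fun i hi =>
          Function.update_of_ne (by omega) _ _
        have hcc : ∀ i ≤ j, count (Function.update N j false) i = count N i := fun i hi =>
          count_congr fun l hl => hco l (by omega)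
        refine ⟨Function.update N j false, fun i hi => ?_, ?_, ?_, fun i hi => ?_, fun i hi => ?_⟩
        · rcases Nat.lt_succ_iff_lt_or_eq.1 hi with hi | rfl
          · rw [hco i hi]; exact hc i hi
          · simpa using hX
        · simp [count, hcc, hcnt]
        · rw [finish, finish_congr (w' := keep t N) fun i hi => by simp [keep, hco i hi]]
          have : keep t (Function.update N j false) j = t j := by simp [keep]
          have := max_le hfin h'.2.1
          omega
        · rcases Nat.lt_succ_iff_lt_or_eq.1 hi with hi | rfl
          · rw [hco i hi]; exact hlong i hi
          · simp
        · rw [hcc i (by omega)]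
          rcases Nat.lt_succ_iff_lt_or_eq.1 hi with hi | rfl
          · exact hbusy i hi
          · rw [hcnt]; exact h'.2.2
      · have h' := (hrelease _ _ _ v hv).1 h
        obtain ⟨N, hc, hcnt, hfin, hlong, hbusy⟩ := (ih (q - 1) v hv).1 h'.1
        have hco : ∀ i < j, Function.update N j true i = N i := fun i hi =>
          Function.update_of_ne (by omega) _ _
        have hcc : ∀ i ≤ j, count (Function.update N j true) i = count N i := fun i hi =>
          count_congr fun l hl => hco l (by omega)
        refine ⟨Function.update N j true, fun i hi => ?_, ?_, ?_, fun i hi => ?_, fun i hi => ?_⟩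
        · rcases Nat.lt_succ_iff_lt_or_eq.1 hi with hi | rfl
          · rw [hco i hi]; exact hc i hi
          · simpa using hX
        · simp [count, hcc, hcnt]; omega
        · rw [finish, finish_congr (w' := keep t N) fun i hi => by simp [keep, hco i hi]]
          have : keep t (Function.update N j true) j = 0 := by simp [keep]
          have := max_le hfin h'.2.1
          omega
        · rcases Nat.lt_succ_iff_lt_or_eq.1 hi with hi | rfl
          · rw [hco i hi]; exact hlong i hi
          · intro _; exact hl
        · rw [hcc i (by omega)]
          rcases Nat.lt_succ_iff_lt_or_eq.1 hi with hi | rfl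
          · exact hbusy i hi
          · rw [hcnt]; exact h'.2.2
    · rintro ⟨N, hc, hcnt, hfin, hlong, hbusy⟩
      simp only [finish] at hfin
      have hb := hbusy j (by omega)
      have hm : max (finish a (keep t N) j) (a j) ≤ v - keep t N j := by omega
      rw [max_le_iff] at hm
      have hc' : Consistent XN XK j N := fun i hi => hc i (by omega)
      cases hN : N j with
      | false =>
        have hk : keep t N j = t j := by simp [keep, hN]
        have hcnt' : count N j = q := by simpa [count, hN] using hcnt
        rw [hcnt'] at hb
        refine Or.inl ⟨(hc j (by omega)).2 hN, ?_⟩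
        have := (hrelease j (table a t D C XN XK j) q (v - t j) (by omega)).2
          ⟨(ih q _ (by omega)).2 ⟨N, hc', hcnt', by omega, fun i hi => hlong i (by omega),
            fun i hi => hbusy i (by omega)⟩, by omega, hb⟩
        omega
      | true =>
        have hk : keep t N j = 0 := by simp [keep, hN]
        have hcnt' : count N j = q - 1 ∧ q ≠ 0 := by
          simp [count, hN] at hcnt; omega
        rw [hcnt'.1] at hb
        refine Or.inr ⟨hcnt'.2, hlong j (by omega) hN, (hc j (by omega)).1 hN, ?_⟩
        exact (hrelease j (table a t D C XN XK j) (q - 1) v hv).2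
          ⟨(ih _ _ hv).2 ⟨N, hc', hcnt'.1, by omega, fun i hi => hlong i (by omega),
            fun i hi => hbusy i (by omega)⟩, by omega, hb⟩

/-- The final condition, too, sees `N` only through its number of elements, so it can be tested
entry by entry in the last row of the table. -/
theorem exists_valid_iff (hCD : C ≤ D) (m : ℕ) :
    (∃ N, Valid m a t D C N ∧ Consistent XN XK m N) ↔
      ∃ q < m + 1, table a t D C XN XK m q ≤ C ∧
        (q = 0 ∨ (q < m - lastStart a t m ∧ C + q * (D - C) < finish a t m)) := by
  have hsub : ∀ x y q : ℕ, x + q * (D - C) < y ↔ x + q * D < y + q * C := by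
    intro x y q
    obtain ⟨d, rfl⟩ := Nat.exists_eq_add_of_le hCD
    rw [Nat.add_sub_cancel_left, mul_add]
    omega
  simp only [table_le_iff a t D C XN XK hCD _ _ _ le_rfl, hsub]
  constructor
  · rintro ⟨N, ⟨h₁, h₂, h₃, h₄⟩, hc⟩
    exact ⟨count N m, by have := count_le N m; omega, ⟨N, hc, rfl, h₂, h₁, h₃⟩,
      h₄.imp_right fun h => ⟨by omega, h.2⟩⟩
  · rintro ⟨q, -, ⟨N, hc, rfl, h₂, h₁, h₃⟩, h₄⟩
    exact ⟨N, ⟨h₁, h₂, h₃, h₄.imp_right fun h => ⟨by omega, h.2⟩⟩, hc⟩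

end Table

/-! ### Elementary properties of schedules -/

variable {I : Instance}

/-- The part of a piece that lies before time `τ`. -/
noncomputable def Piece.before (p : Piece I) (τ : ℝ) : ℝ := min τ p.endTime - min τ p.startTime

/-- The processor works at time `τ`. -/
def Schedule.Working (S : Schedule I) (τ : ℝ) : Prop :=
  ∃ p ∈ S, p.startTime ≤ τ ∧ τ < p.endTime

theorem Piece.before_mono {p : Piece I} (hp : p.startTime ≤ p.endTime) : Monotone p.before := by
  intro x y h
  simp only [Piece.before]
  rcases le_total x p.startTime with h₁ | h₁ <;> rcases le_total x p.endTime with h₂ | h₂ <;>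
  rcases le_total y p.startTime with h₃ | h₃ <;> rcases le_total y p.endTime with h₄ | h₄ <;>
  simp only [min_eq_left, min_eq_right, h₁, h₂, h₃, h₄] <;> linarith

theorem Piece.before_of_le_start {p : Piece I} (hp : p.startTime ≤ p.endTime) {x : ℝ}
    (h : x ≤ p.startTime) : p.before x = 0 := by
  simp [Piece.before, h, h.trans hp]

theorem Piece.before_of_mem {p : Piece I} {x : ℝ} (h : p.startTime ≤ x) (h' : x ≤ p.endTime) :
    p.before x = x - p.startTime := by
  simp [Piece.before, h, h']

theorem Piece.before_of_end_le {p : Piece I} (hp : p.startTime ≤ p.endTime) {x : ℝ}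
    (h : p.endTime ≤ x) : p.before x = p.endTime - p.startTime := by
  simp [Piece.before, h, hp.trans h]

namespace Schedule

theorem workDone_nil (i : Fin I.n) (τ : ℝ) : workDone ([] : Schedule I) i τ = 0 := rfl

theorem workDone_cons (p : Piece I) (S : Schedule I) (i : Fin I.n) (τ : ℝ) :
    workDone (p :: S) i τ = (if p.job = i then p.before τ else 0) + workDone S i τ := by
  simp only [workDone, List.filter_cons]
  split <;> simp_all [Piece.before]

theorem workDone_append (S S' : Schedule I) (i : Fin I.n) (τ : ℝ) :
    workDone (S ++ S') i τ = workDone S i τ + workDone S' i τ := by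
  simp [workDone, List.filter_append]

theorem continuous_workDone (S : Schedule I) (i : Fin I.n) : Continuous (workDone S i) := by
  induction S with
  | nil => exact continuous_const
  | cons p S ih =>
    have : workDone (p :: S) i = fun τ =>
        (if p.job = i then p.before τ else 0) + workDone S i τ := by
      funext τ; exact workDone_cons p S i τ
    rw [this]
    refine Continuous.add ?_ ih
    split
    · unfold Piece.before; fun_prop
    · exact continuous_const

/-- Pieces are nondegenerate, and they are disjoint and ordered in time. -/
structure Neat (S : Schedule I) : Prop where
  nondegenerate : ∀ p ∈ S, 0 ≤ p.startTime ∧ p.startTime < p.endTime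
  ordered : S.Pairwise fun p q => p.endTime ≤ q.startTime

theorem Feasible.neat {S : Schedule I} (h : S.Feasible) : S.Neat := ⟨h.nondegenerate, h.ordered⟩

theorem Neat.tail {p : Piece I} {S : Schedule I} (h : Neat (p :: S)) : Neat S :=
  ⟨fun q hq => h.nondegenerate q (List.mem_cons_of_mem _ hq), (List.pairwise_cons.1 h.ordered).2⟩

theorem Neat.workDone_mono {S : Schedule I} (h : S.Neat) (i : Fin I.n) :
    Monotone (workDone S i) := by
  induction S with
  | nil => intro x y _; simp [workDone_nil]
  | cons p S ih =>
    intro x y hxy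
    rw [workDone_cons, workDone_cons]
    refine add_le_add ?_ (ih h.tail hxy)
    split
    · exact Piece.before_mono (h.nondegenerate p (by simp)).2.le hxy
    · exact le_rfl

theorem Neat.workDone_eq {S : Schedule I} (h : S.Neat) {i : Fin I.n} {x y : ℝ} (hxy : x ≤ y)
    (hS : ∀ p ∈ S, p.job = i → p.endTime ≤ x ∨ y ≤ p.startTime) :
    workDone S i y = workDone S i x := by
  induction S with
  | nil => rfl
  | cons p S ih =>
    rw [workDone_cons, workDone_cons, ih h.tail fun q hq => hS q (List.mem_cons_of_mem _ hq)]
    have hp := (h.nondegenerate p (by simp)).2.le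
    split
    · rcases hS p (by simp) (by assumption) with h' | h'
      · rw [Piece.before_of_end_le hp h', Piece.before_of_end_le hp (h'.trans hxy)]
      · rw [Piece.before_of_le_start hp h', Piece.before_of_le_start hp (hxy.trans h')]
    · rfl

theorem Neat.workDone_zero {S : Schedule I} (h : S.Neat) (i : Fin I.n) : workDone S i 0 = 0 := by
  induction S with
  | nil => rfl
  | cons p S ih =>
    have hp := h.nondegenerate p (by simp)
    rw [workDone_cons, ih h.tail, Piece.before_of_le_start hp.2.le hp.1]
    simp

theorem Neat.workDone_of_forall {S : Schedule I} (h : S.Neat) {i : Fin I.n} {x : ℝ}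
    (hS : ∀ p ∈ S, p.job = i → x ≤ p.startTime) : workDone S i x = 0 := by
  rcases le_total 0 x with h0 | h0
  · rw [h.workDone_eq h0 fun p hp hi => Or.inr (hS p hp hi), h.workDone_zero]
  · rw [← h.workDone_zero i, h.workDone_eq h0 fun p hp _ => Or.inr (h.nondegenerate p hp).1]

theorem Neat.workDone_nonneg {S : Schedule I} (h : S.Neat) (i : Fin I.n) {x : ℝ} (hx : 0 ≤ x) :
    0 ≤ workDone S i x := by
  rw [← h.workDone_zero i]
  exact h.workDone_mono i hx

theorem Neat.add_le_workDone {S : Schedule I} (h : S.Neat) {p : Piece I} (hp : p ∈ S) {x y : ℝ}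
    (hxy : x ≤ y) : workDone S p.job x + (p.before y - p.before x) ≤ workDone S p.job y := by
  induction S with
  | nil => simp at hp
  | cons q S ih =>
    rw [workDone_cons, workDone_cons]
    rcases List.mem_cons.1 hp with rfl | hp
    · have := h.tail.workDone_mono p.job hxy
      simp only [if_true]
      linarith
    · have h₁ := ih h.tail hp
      have h₂ := Piece.before_mono (h.nondegenerate q (by simp)).2.le hxy
      split <;> linarith

/-- The amount of work done before time `τ`. -/
noncomputable def total (S : Schedule I) (τ : ℝ) : ℝ := (S.map fun p => p.before τ).sum

theorem sum_workDone (S : Schedule I) (τ : ℝ) : ∑ i, workDone S i τ = total S τ := by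
  induction S with
  | nil => simp [workDone_nil, total]
  | cons p S ih =>
    simp only [workDone_cons, Finset.sum_add_distrib, ih]
    simp [total]

theorem total_cons (p : Piece I) (S : Schedule I) (τ : ℝ) :
    total (p :: S) τ = p.before τ + total S τ := by simp [total]

theorem total_of_forall {S : Schedule I} (h : S.Neat) {x : ℝ} (hS : ∀ p ∈ S, x ≤ p.startTime) :
    total S x = 0 := by
  rw [← sum_workDone]
  exact Finset.sum_eq_zero fun i _ => h.workDone_of_forall fun p hp _ => hS p hp

theorem Neat.total_sub_le {S : Schedule I} (h : S.Neat) {x y : ℝ} (hxy : x ≤ y) :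
    total S y - total S x ≤ y - x := by
  induction S generalizing x with
  | nil => simpa [total] using hxy
  | cons p S ih =>
    have hp := (h.nondegenerate p (by simp)).2.le
    have hS := (List.pairwise_cons.1 h.ordered).1
    rw [total_cons, total_cons]
    rcases le_total p.endTime x with h₁ | h₁
    · rw [Piece.before_of_end_le hp h₁, Piece.before_of_end_le hp (h₁.trans hxy)]
      linarith [ih h.tail hxy]
    · rw [total_of_forall h.tail fun q hq => h₁.trans (hS q hq)]
      rcases le_total y p.endTime with h₂ | h₂
      · rw [total_of_forall h.tail fun q hq => h₂.trans (hS q hq)]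
        rcases le_total y p.startTime with h₃ | h₃
        · rw [Piece.before_of_le_start hp h₃, Piece.before_of_le_start hp (hxy.trans h₃)]
          linarith
        · rw [Piece.before_of_mem h₃ h₂]
          rcases le_total x p.startTime with h₄ | h₄
          · rw [Piece.before_of_le_start hp h₄]; linarith
          · rw [Piece.before_of_mem h₄ h₁]; linarith
      · have h₃ := ih h.tail h₂
        rw [total_of_forall h.tail fun q hq => hS q hq] at h₃
        rw [Piece.before_of_end_le hp h₂]
        rcases le_total x p.startTime with h₄ | h₄
        · rw [Piece.before_of_le_start hp h₄]; linarith
        · rw [Piece.before_of_mem h₄ h₁]; linarith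

theorem Neat.total_sub_eq {S : Schedule I} (h : S.Neat) {x y : ℝ} (hxy : x ≤ y)
    (hw : ∀ τ, x ≤ τ → τ < y → S.Working τ) : total S y - total S x = y - x := by
  induction S generalizing x with
  | nil =>
    rcases hxy.eq_or_lt with rfl | hlt
    · simp
    · obtain ⟨p, hp, -⟩ := hw x le_rfl hlt
      simp at hp
  | cons p S ih =>
    have hp := (h.nondegenerate p (by simp)).2.le
    have hS := (List.pairwise_cons.1 h.ordered).1
    have hw' : ∀ τ, x ≤ τ → p.endTime ≤ τ → τ < y → Working S τ := by
      intro τ h₁ h₂ h₃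
      obtain ⟨q, hq, hq'⟩ := hw τ h₁ h₃
      rcases List.mem_cons.1 hq with rfl | hq
      · linarith
      · exact ⟨q, hq, hq'⟩
    rcases hxy.eq_or_lt with rfl | hlt
    · simp
    rw [total_cons, total_cons]
    rcases le_or_gt p.endTime x with h₁ | h₁
    · rw [Piece.before_of_end_le hp h₁, Piece.before_of_end_le hp (h₁.trans hxy)]
      linarith [ih h.tail hxy fun τ h₂ h₃ => hw' τ h₂ (h₁.trans h₂) h₃]
    · have hs : p.startTime ≤ x := by
        obtain ⟨q, hq, hq'⟩ := hw x le_rfl hlt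
        rcases List.mem_cons.1 hq with rfl | hq
        · exact hq'.1
        · linarith [hS q hq]
      rw [total_of_forall h.tail fun q hq => h₁.le.trans (hS q hq), Piece.before_of_mem hs h₁.le]
      rcases le_total y p.endTime with h₂ | h₂
      · rw [total_of_forall h.tail fun q hq => h₂.trans (hS q hq),
          Piece.before_of_mem (hs.trans hxy) h₂]
        linarith
      · have h₃ := ih h.tail h₂ fun τ h₃ h₄ => hw' τ (h₁.le.trans h₃) h₃ h₄
        rw [total_of_forall h.tail fun q hq => hS q hq] at h₃
        rw [Piece.before_of_end_le hp h₂]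
        linarith

theorem Neat.workDone_sub_le {S : Schedule I} (h : S.Neat) (i : Fin I.n) {x y : ℝ} (hxy : x ≤ y) :
    workDone S i y - workDone S i x ≤ y - x := by
  refine le_trans ?_ (h.total_sub_le hxy)
  rw [← sum_workDone, ← sum_workDone, ← Finset.sum_sub_distrib]
  exact Finset.single_le_sum (f := fun i => workDone S i y - workDone S i x)
    (fun i _ => sub_nonneg.2 (h.workDone_mono i hxy)) (Finset.mem_univ i)

/-- From every time on, the processor works until it becomes idle. -/
theorem Neat.exists_idle {S : Schedule I} (h : S.Neat) (b : ℝ) :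
    ∃ σ, b ≤ σ ∧ (∀ τ, b ≤ τ → τ < σ → S.Working τ) ∧ ¬ S.Working σ := by
  induction S generalizing b with
  | nil => exact ⟨b, le_rfl, fun τ h₁ h₂ => by linarith, fun ⟨p, hp, _⟩ => by simp at hp⟩
  | cons p S ih =>
    have hS := (List.pairwise_cons.1 h.ordered).1
    rcases lt_or_ge b p.startTime with h₁ | h₁
    · refine ⟨b, le_rfl, fun τ h₁ h₂ => by linarith, ?_⟩
      rintro ⟨q, hq, hq'⟩
      rcases List.mem_cons.1 hq with rfl | hq
      · linarith
      · linarith [hS q hq, (h.nondegenerate p (by simp)).2]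
    · obtain ⟨σ, h₂, h₃, h₄⟩ := ih h.tail (max b p.endTime)
      refine ⟨σ, (le_max_left _ _).trans h₂, fun τ h₅ h₆ => ?_, ?_⟩
      · rcases lt_or_ge τ p.endTime with h₇ | h₇
        · exact ⟨p, by simp, by linarith, h₇⟩
        · obtain ⟨q, hq, hq'⟩ := h₃ τ (max_le h₅ h₇) h₆
          exact ⟨q, List.mem_cons_of_mem _ hq, hq'⟩
      · rintro ⟨q, hq, hq'⟩
        rcases List.mem_cons.1 hq with rfl | hq
        · linarith [(le_max_right b q.endTime).trans h₂]
        · exact h₄ ⟨q, hq, hq'⟩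

/-- Before every time there is an interval of work that begins at time `x` or after an idle
interval. -/
theorem Neat.exists_busy_start {S : Schedule I} (h : S.Neat) {x b : ℝ} (hxb : x ≤ b)
    (hx : ∀ p ∈ S, x ≤ p.startTime) :
    ∃ β, x ≤ β ∧ β ≤ b ∧ (∀ τ, β ≤ τ → τ < b → S.Working τ) ∧
      (β = x ∨ ∃ β' < β, ∀ σ, β' ≤ σ → σ < β → ¬ S.Working σ) := by
  induction S generalizing x with
  | nil =>
    refine ⟨b, hxb, le_rfl, fun τ h₁ h₂ => by linarith, ?_⟩
    exact Or.inr ⟨b - 1, by linarith, fun σ _ _ ⟨p, hp, _⟩ => by simp at hp⟩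
  | cons p S ih =>
    have hS := (List.pairwise_cons.1 h.ordered).1
    have hp := h.nondegenerate p (by simp)
    have hxp := hx p (by simp)
    have hstart : ∀ q ∈ p :: S, p.startTime ≤ q.startTime := by
      intro q hq
      rcases List.mem_cons.1 hq with rfl | hq
      · exact le_rfl
      · linarith [hS q hq]
    have hidle : ∀ y ≤ p.startTime, y = x ∨ ∃ β' < y, ∀ σ, β' ≤ σ → σ < y →
        ¬ Working (p :: S) σ := by
      intro y hy
      refine Or.inr ⟨y - 1, by linarith, ?_⟩
      rintro σ h₁ h₂ ⟨q, hq, hq'⟩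
      linarith [hstart q hq]
    rcases le_total b p.startTime with h₁ | h₁
    · exact ⟨b, hxb, le_rfl, fun τ h₁ h₂ => by linarith, hidle b h₁⟩
    rcases le_total b p.endTime with h₂ | h₂
    · exact ⟨p.startTime, hxp, h₁, fun τ h₃ h₄ => ⟨p, by simp, h₃, by linarith⟩,
        hidle _ le_rfl⟩
    obtain ⟨β, h₃, h₄, h₅, h₆⟩ := ih h.tail h₂ hS
    have hw : ∀ τ, Working S τ → Working (p :: S) τ := fun τ ⟨q, hq, hq'⟩ =>
      ⟨q, List.mem_cons_of_mem _ hq, hq'⟩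
    rcases h₆ with rfl | ⟨β', hβ', h₆⟩
    · refine ⟨p.startTime, hxp, h₁, fun τ h₇ h₈ => ?_, hidle _ le_rfl⟩
      rcases lt_or_ge τ p.endTime with h₉ | h₉
      · exact ⟨p, by simp, h₇, h₉⟩
      · exact hw τ (h₅ τ h₉ h₈)
    · rcases h₃.eq_or_lt with rfl | h₃'
      · refine ⟨p.startTime, hxp, h₁, fun τ h₇ h₈ => ?_, hidle _ le_rfl⟩
        rcases lt_or_ge τ p.endTime with h₉ | h₉
        · exact ⟨p, by simp, h₇, h₉⟩
        · exact hw τ (h₅ τ h₉ h₈)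
      · refine ⟨β, by linarith, h₄, fun τ h₇ h₈ => hw τ (h₅ τ h₇ h₈), Or.inr
          ⟨max β' p.endTime, max_lt hβ' h₃', ?_⟩⟩
        rintro σ h₇ h₈ ⟨q, hq, hq'⟩
        rcases List.mem_cons.1 hq with rfl | hq
        · linarith [(le_max_right β' q.endTime).trans h₇]
        · exact h₆ σ ((le_max_left _ _).trans h₇) h₈ ⟨q, hq, hq'⟩

/-! ### Feasible schedules -/

section Feasible

variable {S : Schedule I}

/-- Going back in time, the work done decreases no faster than the clock, so the slack before the
adjusted critical time does not shrink. In contrapositive form: once an arrived job is not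
executable, it never will be again. -/
theorem Feasible.executable_of_le (h : S.Feasible) {i : Fin I.n} {x τ : ℝ}
    (hx : (I.arrival i : ℝ) ≤ x) (hxτ : x ≤ τ) (he : S.Executable i τ) : S.Executable i x := by
  obtain ⟨h₁, h₂, h₃, h₄⟩ := he
  have := h.neat.workDone_sub_le i hxτ
  exact ⟨hx, hxτ.trans h₂, (h.neat.workDone_mono i hxτ).trans_lt h₃, by linarith⟩

theorem Feasible.end_le (h : S.Feasible) {p : Piece I} (hp : p ∈ S) {x : ℝ}
    (hx : (I.arrival p.job : ℝ) ≤ x) (hn : ¬ S.Executable p.job x) : p.endTime ≤ x := by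
  by_contra hlt
  push Not at hlt
  exact hn (h.executable_of_le hx (le_max_left _ _) (h.allowed p hp (max x p.startTime)
    (le_max_right _ _) (max_lt hlt (h.nondegenerate p hp).2)))

theorem Feasible.workDone_eq (h : S.Feasible) {i : Fin I.n} {x y : ℝ} (hxy : x ≤ y)
    (hx : (I.arrival i : ℝ) ≤ x) (hn : ¬ S.Executable i x) :
    S.workDone i y = S.workDone i x := by
  refine h.neat.workDone_eq hxy ?_
  rintro p hp rfl
  exact Or.inl (h.end_le hp hx hn)

theorem Feasible.workDone_arrival (h : S.Feasible) {i : Fin I.n} {x : ℝ}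
    (hx : x ≤ (I.arrival i : ℝ)) : S.workDone i x = 0 := by
  refine h.neat.workDone_of_forall ?_
  rintro p hp rfl
  exact hx.trans (h.allowed p hp _ le_rfl (h.nondegenerate p hp).2).1

/-- Work grows continuously, so if it exceeded the length there would be a moment at which it equals
it; there the job stops being executable, and its work is frozen. -/
theorem Feasible.workDone_le (h : S.Feasible) {i : Fin I.n} (hi : 0 < I.len i) {x : ℝ}
    (hx : 0 ≤ x) : S.workDone i x ≤ I.len i := by
  by_contra hlt
  push Not at hlt
  have hpos : (0 : ℝ) < I.len i := by exact_mod_cast hi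
  obtain ⟨y, hy, hyt⟩ := intermediate_value_Icc hx (continuous_workDone S i).continuousOn
    (show (I.len i : ℝ) ∈ Set.Icc (S.workDone i 0) (S.workDone i x) by
      rw [h.neat.workDone_zero]; exact ⟨hpos.le, hlt.le⟩)
  have ha : (I.arrival i : ℝ) ≤ y := by
    by_contra hya
    push Not at hya
    rw [h.workDone_arrival hya.le] at hyt
    linarith
  have := h.workDone_eq hy.2 ha fun he => by linarith [he.2.2.1]
  linarith

theorem end_le_makespan {p : Piece I} (hp : p ∈ S) : p.endTime ≤ S.makespan := by
  induction S with
  | nil => simp at hp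
  | cons q S ih =>
    simp only [makespan, List.map_cons, List.foldr_cons]
    rcases List.mem_cons.1 hp with rfl | hp
    · exact le_max_left _ _
    · exact (ih hp).trans (le_max_right _ _)

theorem makespan_nonneg (S : Schedule I) : 0 ≤ S.makespan := by
  induction S with
  | nil => simp [makespan]
  | cons q S ih =>
    simp only [makespan, List.map_cons, List.foldr_cons]
    exact ih.trans (le_max_right _ _)

theorem makespan_le {v : ℝ} (hv : 0 ≤ v) (h : ∀ p ∈ S, p.endTime ≤ v) : S.makespan ≤ v := by
  induction S with
  | nil => simpa [makespan] using hv
  | cons q S ih =>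
    simp only [makespan, List.map_cons, List.foldr_cons]
    exact max_le (h q (by simp)) (ih fun p hp => h p (List.mem_cons_of_mem _ hp))

theorem exists_end_eq_makespan (h : 0 < S.makespan) : ∃ p ∈ S, p.endTime = S.makespan := by
  induction S with
  | nil => simp [makespan] at h
  | cons q S ih =>
    have hm : makespan (q :: S) = max q.endTime (makespan S) := rfl
    rw [hm] at h ⊢
    rcases le_total q.endTime (makespan S) with h' | h'
    · rw [max_eq_right h'] at h ⊢
      obtain ⟨p, hp, hp'⟩ := ih h
      exact ⟨p, List.mem_cons_of_mem _ hp, hp'⟩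
    · exact ⟨q, by simp, (max_eq_left h').symm⟩

theorem Feasible.not_executable_of_makespan_le (h : S.Feasible) {i : Fin I.n} {x : ℝ}
    (hx : S.makespan ≤ x) : ¬ S.Executable i x := by
  intro he
  obtain ⟨p, hp, -, hp'⟩ := h.busy x ((makespan_nonneg S).trans hx) ⟨i, he⟩
  linarith [end_le_makespan hp]

end Feasible

end Schedule

/-! ### Prefixes of feasible schedules -/

namespace Schedule

/-- `S` is a schedule for the times before `τ` and satisfies the feasibility conditions there. -/
structure FeasibleUntil (S : Schedule I) (τ : ℝ) : Prop extends S.Neat where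
  nonneg : 0 ≤ τ
  end_le : ∀ p ∈ S, p.endTime ≤ τ
  allowed : ∀ p ∈ S, ∀ x : ℝ, p.startTime ≤ x → x < p.endTime → S.Executable p.job x
  busy : ∀ x : ℝ, 0 ≤ x → x < τ → (∃ i, S.Executable i x) → S.Working x

theorem feasibleUntil_nil : FeasibleUntil ([] : Schedule I) 0 :=
  ⟨⟨by simp, by simp⟩, le_rfl, by simp, by simp, fun x h₁ h₂ => by linarith⟩

variable {S : Schedule I} {τ : ℝ}

theorem FeasibleUntil.workDone_eq (h : S.FeasibleUntil τ) (i : Fin I.n) {x : ℝ} (hx : τ ≤ x) :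
    S.workDone i x = S.workDone i τ :=
  h.toNeat.workDone_eq hx fun p hp _ => Or.inl (h.end_le p hp)

theorem FeasibleUntil.idle (h : S.FeasibleUntil τ) {σ : ℝ} (hσ : τ ≤ σ)
    (hi : ∀ x, τ ≤ x → x < σ → ∀ i, ¬ S.Executable i x) : S.FeasibleUntil σ := by
  refine ⟨h.toNeat, h.nonneg.trans hσ, fun p hp => (h.end_le p hp).trans hσ, h.allowed, ?_⟩
  rintro x h₁ h₂ ⟨i, hi'⟩
  rcases lt_or_ge x τ with h₃ | h₃
  · exact h.busy x h₁ h₃ ⟨i, hi'⟩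
  · exact absurd hi' (hi x h₃ h₂ i)

theorem FeasibleUntil.feasible (h : S.FeasibleUntil τ)
    (hi : ∀ x, τ ≤ x → ∀ i, ¬ S.Executable i x) : S.Feasible := by
  refine ⟨h.nondegenerate, h.ordered, h.allowed, ?_⟩
  rintro x h₁ ⟨i, hi'⟩
  rcases lt_or_ge x τ with h₃ | h₃
  · exact h.busy x h₁ h₃ ⟨i, hi'⟩
  · exact absurd hi' (hi x h₃ i)

theorem workDone_concat (S : Schedule I) (p : Piece I) (i : Fin I.n) (x : ℝ) :
    workDone (S ++ [p]) i x = workDone S i x + if p.job = i then p.before x else 0 := by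
  rw [workDone_append, workDone_cons, workDone_nil, add_zero]

/-- While a job is worked on, its critical time moves along with the clock, so constraint II need
only be checked at the start of the new piece. -/
theorem FeasibleUntil.concat (h : S.FeasibleUntil τ) {p : Piece I} (hs : p.startTime = τ)
    (he : τ < p.endTime) (ha : (I.arrival p.job : ℝ) ≤ τ) (hd : p.endTime ≤ I.deadline p.job)
    (hl : S.workDone p.job τ + (p.endTime - τ) ≤ I.len p.job)
    (hc : τ ≤ (I.deadline p.job : ℝ) - I.len p.job + S.workDone p.job τ) :
    FeasibleUntil (S ++ [p]) p.endTime := by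
  have hpe : p.startTime ≤ p.endTime := by linarith
  have hold : ∀ x ≤ τ, ∀ i, workDone (S ++ [p]) i x = workDone S i x := by
    intro x hx i
    rw [workDone_concat, Piece.before_of_le_start hpe (by linarith)]
    simp
  have hex : ∀ x ≤ τ, ∀ i, Executable (S ++ [p]) i x ↔ Executable S i x := by
    intro x hx i
    simp only [Executable, hold x hx i]
  have hnew : ∀ x, τ ≤ x → x < p.endTime → Executable (S ++ [p]) p.job x := by
    intro x h₁ h₂
    have hw : workDone (S ++ [p]) p.job x = workDone S p.job τ + (x - τ) := by
      rw [workDone_concat, h.workDone_eq _ h₁, Piece.before_of_mem (by linarith) h₂.le, hs]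
      simp
    refine ⟨by linarith, by linarith, ?_, ?_⟩ <;> rw [hw] <;> linarith
  refine ⟨⟨?_, ?_⟩, h.nonneg.trans he.le, ?_, ?_, ?_⟩
  · intro q hq
    rcases List.mem_append.1 hq with hq | hq
    · exact h.nondegenerate q hq
    · rw [List.mem_singleton.1 hq, hs]
      exact ⟨h.nonneg, he⟩
  · rw [List.pairwise_append]
    refine ⟨h.ordered, by simp, fun q hq r hr => ?_⟩
    rw [List.mem_singleton.1 hr, hs]
    exact h.end_le q hq
  · intro q hq
    rcases List.mem_append.1 hq with hq | hq
    · exact (h.end_le q hq).trans he.le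
    · rw [List.mem_singleton.1 hq]
  · intro q hq x h₁ h₂
    rcases List.mem_append.1 hq with hq | hq
    · exact (hex x (h₂.le.trans (h.end_le q hq)) _).2 (h.allowed q hq x h₁ h₂)
    · rw [List.mem_singleton.1 hq] at h₁ h₂ ⊢
      exact hnew x (by linarith) h₂
  · rintro x h₁ h₂ ⟨i, hi⟩
    rcases lt_or_ge x τ with h₃ | h₃
    · obtain ⟨q, hq, hq'⟩ := h.busy x h₁ h₃ ⟨i, (hex x h₃.le i).1 hi⟩
      exact ⟨q, List.mem_append_left _ hq, hq'⟩
    · exact ⟨p, by simp, by linarith, h₂⟩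

end Schedule

/-! ### Every feasible schedule gives a valid choice -/

/-- The jobs that can be executed at all, enumerated in the order of their arrival. -/
structure Sorted (I : Instance) (D m : ℕ) (P : Fin m → Fin I.n) (a t : ℕ → ℕ) : Prop where
  inj : Function.Injective P
  mem_range : ∀ i, (∃ j, P j = i) ↔ 0 < I.len i ∧ I.arrival i + I.len i ≤ D
  arrival : ∀ j : Fin m, a j = I.arrival (P j)
  len : ∀ j : Fin m, t j = I.len (P j)
  mono : ∀ i j, i ≤ j → j < m → a i ≤ a j
  deadline : ∀ i, I.deadline i = D

theorem count_le_add (N : ℕ → Bool) {i j : ℕ} (h : i ≤ j) : count N j ≤ count N i + (j - i) := by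
  induction j, h using Nat.le_induction with
  | base => omega
  | succ j hj ih => simp only [count]; split <;> omega

theorem count_add_lt {N : ℕ → Bool} {b f m : ℕ} (hb : count N b = 0) (hbf : b ≤ f) (hfm : f < m)
    (hf : N f = false) : count N m + b < m := by
  have h₁ := count_le_add N hbf
  have h₂ := count_le_add N (show f + 1 ≤ m from hfm)
  simp only [count, hf] at h₂
  simp at h₂
  omega

/-- A job in `N` counts with its processing time minus `δ`. -/
def cap (t : ℕ → ℝ) (δ : ℝ) (N : ℕ → Bool) (i : ℕ) : ℝ := if N i then t i - δ else t i

theorem sum_cap (t : ℕ → ℝ) (δ : ℝ) {N : ℕ → Bool} {b j : ℕ} (hb : count N b = 0) (hbj : b ≤ j) :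
    ∑ l ∈ Finset.Ico b j, cap t δ N l = ∑ l ∈ Finset.Ico b j, t l - count N j * δ := by
  induction j, hbj using Nat.le_induction with
  | base => simp [hb]
  | succ j hj ih =>
    rw [Finset.sum_Ico_succ_top hj, Finset.sum_Ico_succ_top hj, ih]
    simp only [cap, count]
    split <;> push_cast <;> ring

namespace Sorted

variable {I : Instance} {D m : ℕ} {P : Fin m → Fin I.n} {a t : ℕ → ℕ}

theorem len_pos (h : Sorted I D m P a t) {j : ℕ} (hj : j < m) : 0 < t j := by
  have := ((h.mem_range (P ⟨j, hj⟩)).1 ⟨_, rfl⟩).1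
  rwa [← h.len] at this

theorem add_le (h : Sorted I D m P a t) {j : ℕ} (hj : j < m) : a j + t j ≤ D := by
  have := ((h.mem_range (P ⟨j, hj⟩)).1 ⟨_, rfl⟩).2
  rwa [← h.len, ← h.arrival] at this

theorem not_executable (h : Sorted I D m P a t) {S : Schedule I} (hS : S.Neat) {i : Fin I.n}
    (hi : ∀ j, P j ≠ i) (hp : ∀ p ∈ S, p.job ≠ i) (x : ℝ) : ¬ S.Executable i x := by
  rintro ⟨h₁, h₂, h₃, h₄⟩
  have hw : S.workDone i x = 0 := hS.workDone_of_forall fun p hp' hj => absurd hj (hp p hp')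
  rw [hw] at h₃ h₄
  rw [h.deadline] at h₂ h₄
  have h₅ : 0 < I.len i := by exact_mod_cast h₃
  have h₆ : I.arrival i + I.len i ≤ D := by
    have : ((I.arrival i + I.len i : ℕ) : ℝ) ≤ D := by push_cast; linarith
    exact_mod_cast this
  obtain ⟨j, hj⟩ := (h.mem_range i).2 ⟨h₅, h₆⟩
  exact hi j hj

/-- The work done on job `j` of the enumeration. -/
noncomputable def work (_ : Sorted I D m P a t) (S : Schedule I) (j : ℕ) (τ : ℝ) : ℝ :=
  if hj : j < m then S.workDone (P ⟨j, hj⟩) τ else 0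

variable {S : Schedule I}

theorem exists_job (h : Sorted I D m P a t) (hS : S.Feasible) {p : Piece I} (hp : p ∈ S) :
    ∃ j, P j = p.job := by
  obtain ⟨h₁, h₂, h₃, h₄⟩ := hS.allowed p hp _ le_rfl (hS.nondegenerate p hp).2
  have hw : S.workDone p.job p.startTime ≤ p.startTime - I.arrival p.job := by
    have := hS.neat.workDone_sub_le p.job h₁
    rw [hS.workDone_arrival le_rfl] at this
    linarith
  have h0 := hS.neat.workDone_nonneg p.job (hS.nondegenerate p hp).1
  rw [h.deadline] at h₄
  refine (h.mem_range p.job).2 ⟨?_, ?_⟩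
  · exact_mod_cast h0.trans_lt h₃
  · have : ((I.arrival p.job + I.len p.job : ℕ) : ℝ) ≤ D := by push_cast; linarith
    exact_mod_cast this

theorem total_eq (h : Sorted I D m P a t) (hS : S.Feasible) (τ : ℝ) :
    S.total τ = ∑ j ∈ Finset.range m, h.work S j τ := by
  rw [← Schedule.sum_workDone, Finset.sum_range]
  have : ∀ j : Fin m, h.work S j τ = S.workDone (P j) τ := fun j => by simp [work]
  simp only [this]
  refine (Finset.sum_of_injOn P h.inj.injOn (by simp) (fun i _ hi => ?_) (by simp)).symm
  refine hS.neat.workDone_of_forall ?_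
  rintro p hp rfl
  obtain ⟨j, hj⟩ := h.exists_job hS hp
  exact absurd ⟨j, by simp, hj⟩ hi

theorem work_nonneg (h : Sorted I D m P a t) (hS : S.Feasible) (j : ℕ) {x : ℝ} (hx : 0 ≤ x) :
    0 ≤ h.work S j x := by
  unfold work; split
  · exact hS.neat.workDone_nonneg _ hx
  · exact le_rfl

theorem work_mono (h : Sorted I D m P a t) (hS : S.Feasible) (j : ℕ) : Monotone (h.work S j) := by
  intro x y hxy
  unfold work; split
  · exact hS.neat.workDone_mono _ hxy
  · exact le_rfl

theorem work_le (h : Sorted I D m P a t) (hS : S.Feasible) {j : ℕ} (hj : j < m) {x : ℝ}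
    (hx : 0 ≤ x) : h.work S j x ≤ t j := by
  have h₁ := h.len ⟨j, hj⟩
  have h₂ := h.len_pos hj
  simp only at h₁
  rw [h₁] at h₂ ⊢
  simpa [work, hj] using hS.workDone_le h₂ hx

theorem work_arrival (h : Sorted I D m P a t) (hS : S.Feasible) {j : ℕ} {x : ℝ} (hx : x ≤ a j) :
    h.work S j x = 0 := by
  unfold work; split
  · rename_i hj
    have h₁ := h.arrival ⟨j, hj⟩
    simp only at h₁
    rw [h₁] at hx
    exact hS.workDone_arrival hx
  · rfl

/-- If an arrived job is not executable, then it is not worked on any more, and it is either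
completed or overdue. -/
theorem of_not_executable (h : Sorted I D m P a t) (hS : S.Feasible) {j : ℕ} (hj : j < m) {x : ℝ}
    (hx : (a j : ℝ) ≤ x) (hxD : x ≤ D) (hn : ¬ S.Executable (P ⟨j, hj⟩) x) :
    (∀ y, x ≤ y → h.work S j y = h.work S j x) ∧ (∀ p ∈ S, p.job = P ⟨j, hj⟩ → p.endTime ≤ x) ∧
      (h.work S j x = t j ∨ (D : ℝ) - x < t j - h.work S j x) := by
  have h₁ := h.arrival ⟨j, hj⟩
  have h₂ := h.len ⟨j, hj⟩
  simp only at h₁ h₂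
  have h0 : (0 : ℝ) ≤ x := le_trans (by positivity) hx
  have hw := h.work_le hS hj h0
  rw [h₁] at hx
  refine ⟨fun y hy => ?_, ?_, ?_⟩
  · simpa [work, hj] using hS.workDone_eq hy hx hn
  · intro p hp hpj
    rw [← hpj] at hn hx
    exact hS.end_le hp hx hn
  · by_contra hcon
    push Not at hcon
    refine hn ⟨hx, by rw [h.deadline]; exact hxD, ?_, ?_⟩
    · rw [← h₂]
      have := lt_of_le_of_ne hw hcon.1
      simpa [work, hj] using this
    · have := hcon.2
      rw [h.deadline, ← h₂]
      simp only [work, hj, dif_pos] at this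
      linarith

theorem not_executable_of_not_working (hS : S.Feasible) {i : Fin I.n} {x : ℝ} (hx : 0 ≤ x)
    (hw : ¬ S.Working x) : ¬ S.Executable i x := fun he => hw (hS.busy x hx ⟨i, he⟩)

/-- Jobs that arrive before the last start are not worked on after it. -/
theorem end_le_lastStart (h : Sorted I D m P a t) (hS : S.Feasible) {l : ℕ} (hl : l < m)
    (hlb : l < lastStart a t m) {p : Piece I} (hp : p ∈ S) (hpl : p.job = P ⟨l, hl⟩) :
    p.endTime ≤ a (lastStart a t m) := by
  have hjm : lastStart a t m < m := lastStart_lt (by omega)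
  have hfin := finish_lastStart_le (a := a) (t := t) (m := m) (Nat.zero_le _)
  set j₀ := lastStart a t m with hj₀
  have hbD : (a j₀ : ℝ) ≤ D := by exact_mod_cast (Nat.le_add_right _ _).trans (h.add_le hjm)
  obtain ⟨β, hβ0, hβb, hbusy, hβ⟩ := hS.neat.exists_busy_start (x := 0) (b := a j₀)
    (by positivity) fun p hp => (hS.nondegenerate p hp).1
  -- A job that arrived before the current busy interval was present at an idle moment, and so has
  -- not been executable since.
  have hearly : ∀ l (hl : l < m), (a l : ℝ) < β → ∃ σ < β, (a l : ℝ) ≤ σ ∧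
      ¬ S.Executable (P ⟨l, hl⟩) σ := by
    intro l hl hal
    rcases hβ with rfl | ⟨β', hβ', hidle⟩
    · have : (0 : ℝ) ≤ a l := by positivity
      linarith
    · refine ⟨max β' (a l), max_lt hβ' hal, le_max_right _ _,
        not_executable_of_not_working hS (le_trans (by positivity) (le_max_right _ (a l : ℝ)))
        (hidle _ (le_max_left _ _) (max_lt hβ' hal))⟩
  rcases lt_or_ge (a l : ℝ) β with hal | hal
  · obtain ⟨σ, hσβ, hσ, hn⟩ := hearly l hl hal
    exact ((h.of_not_executable hS hl hσ (by linarith) hn).2.1 p hp hpl).trans (by linarith)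
  -- The job arrives inside the busy interval that starts at `β`. Only the jobs `i₁, …, j₀ - 1` can
  -- fill this interval, and their total length is at most its length because `j₀` is a start; so
  -- all of them are completed by `a j₀`.
  · classical
    have hex : ∃ i, β ≤ (a i : ℝ) := ⟨l, hal⟩
    set i₁ := Nat.find hex with hi₁
    have hi₁β : β ≤ (a i₁ : ℝ) := Nat.find_spec hex
    have hi₁l : i₁ ≤ l := Nat.find_min' hex hal
    have htot := hS.neat.total_sub_eq hβb hbusy
    rw [h.total_eq hS, h.total_eq hS, ← Finset.sum_sub_distrib] at htot
    have hzero : ∀ i ∈ Finset.range m, i ∉ Finset.Ico i₁ j₀ →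
        h.work S i (a j₀) - h.work S i β = 0 := by
      intro i hi hi'
      simp only [Finset.mem_range, Finset.mem_Ico, not_and, not_lt] at hi hi'
      rcases Nat.lt_or_ge i i₁ with hii | hii
      · obtain ⟨σ, hσβ, hσ, hn⟩ := hearly i hi (not_le.1 (Nat.find_min hex hii))
        have := (h.of_not_executable hS hi hσ (by linarith) hn).1
        rw [this _ (by linarith), this _ hσβ.le, sub_self]
      · have haj : (a j₀ : ℝ) ≤ a i := by exact_mod_cast h.mono _ _ (hi' hii) hi
        rw [h.work_arrival hS haj, h.work_arrival hS (hβb.trans haj), sub_self]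
    rw [← Finset.sum_subset (fun i hi => by simp at hi ⊢; omega) hzero] at htot
    have hsum : ∑ i ∈ Finset.Ico i₁ j₀, h.work S i (a j₀) = a j₀ - β := by
      rw [← htot]
      refine Finset.sum_congr rfl fun i hi => ?_
      simp only [Finset.mem_Ico] at hi
      have : β ≤ a i := hi₁β.trans (by exact_mod_cast h.mono _ _ hi.1 (by omega))
      rw [h.work_arrival hS this, sub_zero]
    have hle := add_sum_le_finish a t (show i₁ < j₀ by omega)
    have hle' : (a i₁ : ℝ) + ∑ i ∈ Finset.Ico i₁ j₀, (t i : ℝ) ≤ a j₀ := by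
      exact_mod_cast hle.trans hfin
    have hwt : h.work S l (a j₀) = t l := by
      refine le_antisymm (h.work_le hS hl (by positivity)) ?_
      by_contra hlt
      push Not at hlt
      have : ∑ i ∈ Finset.Ico i₁ j₀, h.work S i (a j₀) < ∑ i ∈ Finset.Ico i₁ j₀, (t i : ℝ) :=
        Finset.sum_lt_sum (fun i hi => h.work_le hS (by simp at hi; omega) (by positivity))
          ⟨l, by simp; omega, hlt⟩
      linarith
    have hn : ¬ S.Executable (P ⟨l, hl⟩) (a j₀) := by
      rintro ⟨-, -, h₃, -⟩
      have h₂ := h.len ⟨l, hl⟩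
      simp only at h₂
      rw [← h₂, ← hwt] at h₃
      simp [work, hl] at h₃
    exact (h.of_not_executable hS hl (by exact_mod_cast h.mono _ _ hlb.le hjm) hbD hn).2.1 p hp hpl

theorem makespan_le_deadline (h : Sorted I D m P a t) (hS : S.Feasible) : S.makespan ≤ D := by
  refine Schedule.makespan_le (by positivity) fun p hp => ?_
  by_contra hlt
  push Not at hlt
  have hp' := hS.nondegenerate p hp
  -- The maximum is a moment of the piece that lies after the deadline.
  have := (hS.allowed p hp (max p.startTime ((D + p.endTime) / 2)) (le_max_left _ _)
    (max_lt hp'.2 (by linarith))).2.1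
  rw [h.deadline] at this
  linarith [(le_max_right p.startTime ((D + p.endTime) / 2)).trans this]

/-- At its own arrival an enumerated job is executable, so the bureaucrat cannot have gone home yet.
-/
theorem arrival_lt_makespan (h : Sorted I D m P a t) (hS : S.Feasible) {j : ℕ} (hj : j < m) :
    (a j : ℝ) < S.makespan := by
  by_contra hle
  push Not at hle
  have h₁ := h.arrival ⟨j, hj⟩
  have h₂ := h.len ⟨j, hj⟩
  simp only at h₁ h₂
  have h₃ : (0 : ℝ) < t j := by exact_mod_cast h.len_pos hj
  have h₄ : (a j : ℝ) + t j ≤ D := by exact_mod_cast h.add_le hj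
  refine hS.not_executable_of_makespan_le (i := P ⟨j, hj⟩) hle ⟨by rw [h₁], ?_, ?_, ?_⟩
  · rw [h.deadline]; linarith
  · rw [hS.workDone_arrival (by rw [h₁]), ← h₂]; exact h₃
  · rw [hS.workDone_arrival (by rw [h₁]), h.deadline, ← h₂]; linarith

/-- At the makespan every enumerated job has arrived and is not executable, hence it is complete or
overdue. The unfinished jobs from the last start on form `N`; the capacity inequalities come from
comparing the work that is possible with the time that has to be filled. -/
theorem exists_valid (h : Sorted I D m P a t) (hS : S.Feasible) :
    ∃ N, Valid m (fun i => (a i : ℝ)) (fun i => (t i : ℝ)) D S.makespan N := by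
  classical
  rcases Nat.eq_zero_or_pos m with rfl | hm
  · exact ⟨fun _ => false, by simp, by simpa [finish] using Schedule.makespan_nonneg S, by simp,
      by simp [count]⟩
  have hjm : lastStart a t m < m := lastStart_lt hm
  have hfin := finish_lastStart_le (a := a) (t := t) (m := m) (Nat.zero_le _)
  have hend := fun l hl hlb p hp hpl => h.end_le_lastStart hS (l := l) hl hlb (p := p) hp hpl
  have hfineq := fun j h₁ h₂ => finish_eq_lastStart (a := a) (t := t) (m := m) (j := j)
    (Nat.zero_le _) h₁ h₂
  have hbl := fun j h₁ h₂ => lt_finish_of_lastStart_lt (a := a) (t := t) (m := m) (j := j) h₁ h₂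
  have hcast := lastStart_cast a t m
  set j₀ := lastStart a t m with hj₀
  set M := S.makespan with hM
  have hMD : M ≤ D := h.makespan_le_deadline hS
  have hM0 : 0 ≤ M := Schedule.makespan_nonneg S
  have haM : ∀ j < m, (a j : ℝ) < M := fun j hj => h.arrival_lt_makespan hS hj
  -- work on the jobs before the last start
  have hold : ∀ l < j₀, ∀ y, (a j₀ : ℝ) ≤ y → h.work S l y = h.work S l (a j₀) := by
    intro l hl y hy
    have hlm : l < m := by omega
    simp only [work, hlm, dif_pos]
    exact hS.neat.workDone_eq hy fun p hp hpl => Or.inl (hend l hlm hl p hp hpl)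
  have hlastM : ∀ j (hj : j < m), h.work S j M = t j ∨ (D : ℝ) - M < t j - h.work S j M :=
    fun j hj => (h.of_not_executable hS hj (haM j hj).le hMD
      (hS.not_executable_of_makespan_le le_rfl)).2.2
  -- Unfinished jobs from before the last start are left out on purpose: they are not worked on
  -- afterwards, and keeping them in the count does no harm because all jobs before the start would
  -- fit before it anyway.
  let N : ℕ → Bool := fun j => decide (j₀ ≤ j ∧ h.work S j M < t j)
  have hNc : count N j₀ = 0 := count_eq_zero_of fun i hi => by simp [N]; omega
  have hNlong : ∀ i < m, N i = true → (D : ℝ) - M < t i - h.work S i M := by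
    intro i hi hN
    simp only [N, decide_eq_true_eq] at hN
    exact (hlastM i hi).resolve_left hN.2.ne
  -- amounts of work between the last start and a later time
  have hsumwork : ∀ (x : ℝ) (j : ℕ), (a j₀ : ℝ) ≤ x → j₀ ≤ j → j ≤ m →
      (∀ l < m, j ≤ l → x ≤ a l) → (∀ τ, (a j₀ : ℝ) ≤ τ → τ < x → S.Working τ) →
      ∑ l ∈ Finset.Ico j₀ j, h.work S l x = x - a j₀ := by
    intro x j hx hj hjm' hlate hw
    rw [← hS.neat.total_sub_eq hx hw, h.total_eq hS, h.total_eq hS, ← Finset.sum_sub_distrib]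
    have hzero : ∀ i ∈ Finset.range m, i ∉ Finset.Ico j₀ j →
        h.work S i x - h.work S i (a j₀) = 0 := by
      intro i hi hi'
      simp only [Finset.mem_range, Finset.mem_Ico, not_and, not_lt] at hi hi'
      rcases Nat.lt_or_ge i j₀ with hii | hii
      · rw [hold i hii x hx, sub_self]
      · have hai := hlate i hi (hi' hii)
        rw [h.work_arrival hS hai, h.work_arrival hS (hx.trans hai), sub_self]
    rw [← Finset.sum_subset (fun i hi => by simp at hi ⊢; omega) hzero]
    refine Finset.sum_congr rfl fun i hi => ?_
    simp only [Finset.mem_Ico] at hi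
    rw [h.work_arrival hS (x := a j₀) (by exact_mod_cast h.mono _ _ hi.1 (by omega)), sub_zero]
  have hcap : ∀ l, j₀ ≤ l → l < m →
      h.work S l M ≤ cap (fun i => (t i : ℝ)) (D - M) N l ∧
      (N l = true → h.work S l M < cap (fun i => (t i : ℝ)) (D - M) N l) := by
    intro l hl hlm
    unfold cap
    cases hN : N l with
    | true =>
      have := hNlong l hlm hN
      simp only [if_true]
      exact ⟨by linarith, fun _ => by linarith⟩
    | false => simpa using h.work_le hS hlm hM0
  -- the bound on the capacity
  have claim : ∀ (x : ℝ) (j : ℕ), (a j₀ : ℝ) ≤ x → x ≤ M → j₀ ≤ j → j ≤ m →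
      (∀ l < m, j ≤ l → x ≤ a l) → count N j ≠ 0 →
      x - a j₀ < ∑ l ∈ Finset.Ico j₀ j, cap (fun i => (t i : ℝ)) (D - M) N l := by
    intro x j hx hxM hj hjm' hlate hcnt
    obtain ⟨σ, hσb, hσw, hσ⟩ := hS.neat.exists_idle (a j₀ : ℝ)
    have hσ0 : (0 : ℝ) ≤ σ := le_trans (by positivity) hσb
    rcases le_or_gt x σ with hxσ | hσx
    -- Busy up to `x`: the time is exactly filled by work, and a job of `N` is strictly below its
    -- cap.
    · rw [← hsumwork x j hx hj hjm' hlate fun τ h₁ h₂ => hσw τ h₁ (by linarith)]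
      obtain ⟨l, hl, hNl⟩ : ∃ l < j, N l = true := by
        by_contra hcon
        push Not at hcon
        exact hcnt (count_eq_zero_of fun i hi => by simpa using hcon i hi)
      have hjl : j₀ ≤ l := by simp only [N, decide_eq_true_eq] at hNl; exact hNl.1
      exact Finset.sum_lt_sum (fun i hi => by
          simp only [Finset.mem_Ico] at hi
          exact (h.work_mono hS i hxM).trans (hcap i hi.1 (by omega)).1)
        ⟨l, by simp; omega, (h.work_mono hS l hxM).trans_lt ((hcap l hjl (by omega)).2 hNl)⟩
    · have hσD : σ ≤ D := by linarith
      have hstuck : ∀ l (hl : l < m), (a l : ℝ) ≤ σ → _ := fun l hl hal =>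
        h.of_not_executable hS hl hal hσD (not_executable_of_not_working hS hσ0 hσ)
      -- If every arrived job from `j₀` on were complete at the idle moment `σ`, then either the
      -- next arrival would find no waiting work, so that `j₀` was not the last start, or there
      -- would be no further work and the makespan would be at most `σ < x`.
      obtain ⟨l, hjl, hlm, hal, hwl⟩ : ∃ l, j₀ ≤ l ∧ l < m ∧ (a l : ℝ) ≤ σ ∧
          h.work S l σ ≠ t l := by
        by_contra hcon
        push Not at hcon
        by_cases hex : ∃ l, j₀ < l ∧ l < m ∧ σ < a l
        · set j₁ := Nat.find hex
          obtain ⟨h₁, h₂, h₃⟩ : j₀ < j₁ ∧ j₁ < m ∧ σ < a j₁ := Nat.find_spec hex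
          have hmin : ∀ l, j₀ ≤ l → l < j₁ → (a l : ℝ) ≤ σ := by
            intro l hl hlj
            rcases hl.eq_or_lt with rfl | hl
            · exact hσb
            · have := Nat.find_min hex hlj
              simp only [not_and, not_lt] at this
              exact this hl (by omega)
          have hs := hsumwork σ j₁ hσb h₁.le h₂.le
            (fun l hl hjl => h₃.le.trans (by exact_mod_cast h.mono _ _ hjl hl)) hσw
          have hs' : ∑ l ∈ Finset.Ico j₀ j₁, (t l : ℝ) = σ - a j₀ := by
            rw [← hs]
            refine Finset.sum_congr rfl fun l hl => ?_
            simp only [Finset.mem_Ico] at hl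
            exact (hcon l hl.1 (by omega) (hmin l hl.1 hl.2)).symm
          have hf := hfineq j₁ h₁ h₂.le
          have hf' : ((finish a t j₁ : ℕ) : ℝ) = a j₀ + ∑ l ∈ Finset.Ico j₀ j₁, (t l : ℝ) := by
            exact_mod_cast hf
          have hlt : (a j₁ : ℝ) < (finish a t j₁ : ℕ) := by exact_mod_cast hbl j₁ h₁ h₂
          linarith
        · push Not at hex
          have hall : ∀ l, j₀ ≤ l → l < m → (a l : ℝ) ≤ σ := by
            intro l hl hlm
            rcases hl.eq_or_lt with rfl | hl
            · exact hσb
            · exact hex l hl hlm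
          have hMpos : 0 < M := lt_of_le_of_lt (by positivity) (haM j₀ hjm)
          obtain ⟨p, hp, hpM⟩ := Schedule.exists_end_eq_makespan hMpos
          obtain ⟨l, hl⟩ := h.exists_job hS hp
          have hpσ : p.endTime ≤ σ := by
            rcases Nat.lt_or_ge (l : ℕ) j₀ with hlj | hlj
            · exact (hend l l.2 hlj p hp hl.symm).trans hσb
            · exact (hstuck l l.2 (hall l hlj l.2)).2.1 p hp hl.symm
          linarith
      obtain ⟨hw₁, -, hw₂⟩ := hstuck l hlm hal
      have hw₂ := hw₂.resolve_left hwl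
      have hlj : l < j := by
        by_contra hcon
        push Not at hcon
        linarith [hlate l hlm hcon]
      have hNl : N l = true := by
        simp only [N, decide_eq_true_eq]
        refine ⟨hjl, ?_⟩
        rw [hw₁ M (by linarith)]
        exact lt_of_le_of_ne (h.work_le hS hlm hσ0) hwl
      have hs := hsumwork σ j hσb hj hjm'
        (fun l hl hjl => hσx.le.trans (hlate l hl hjl)) hσw
      -- The job `l` is overdue at `σ`, so it lacks more than `D - σ`; its unused capacity exceeds
      -- `(D - σ) - (D - M) = M - σ`, which covers the time from `σ` to `x`.
      have hd : ∑ i ∈ Finset.Ico j₀ j, (cap (fun i => (t i : ℝ)) (D - M) N i - h.work S i σ) ≥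
          cap (fun i => (t i : ℝ)) (D - M) N l - h.work S l σ :=
        Finset.single_le_sum
          (f := fun i => cap (fun i => (t i : ℝ)) (D - M) N i - h.work S i σ) (fun i hi => by
            simp only [Finset.mem_Ico] at hi
            exact sub_nonneg.2 ((h.work_mono hS i (by linarith)).trans
              (hcap i hi.1 (by omega)).1)) (by simp; omega)
      rw [Finset.sum_sub_distrib, hs] at hd
      have hcl : cap (fun i => (t i : ℝ)) (D - M) N l = t l - (D - M) := by simp [cap, hNl]
      rw [hcl] at hd
      linarith
  refine ⟨N, fun i hi hN => ?_, ?_, fun j hj => ?_, ?_⟩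
  · have := hNlong i hi hN
    have := h.work_nonneg hS i hM0
    linarith
  -- All kept work on jobs `i, …, m - 1` is done between `a i` and `M`. For `i` before the last
  -- start, the jobs up to it are charged to the interval before `a j₀` instead.
  · have hsuf : ∀ i, j₀ ≤ i → i < m →
        (a i : ℝ) + ∑ l ∈ Finset.Ico i m, keep (fun i => (t i : ℝ)) N l ≤ M := by
      intro i hji him
      have hle := hS.neat.total_sub_le (haM i him).le
      rw [h.total_eq hS, h.total_eq hS, ← Finset.sum_sub_distrib] at hle
      have : ∑ l ∈ Finset.Ico i m, keep (fun i => (t i : ℝ)) N l ≤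
          ∑ l ∈ Finset.Ico i m, (h.work S l M - h.work S l (a i)) := by
        refine Finset.sum_le_sum fun l hl => ?_
        simp only [Finset.mem_Ico] at hl
        rw [h.work_arrival hS (x := a i) (by exact_mod_cast h.mono _ _ hl.1 hl.2), sub_zero]
        cases hN : N l with
        | true => simpa [keep, hN] using h.work_nonneg hS l hM0
        | false =>
          have hk : keep (fun i => (t i : ℝ)) N l = t l := by simp [keep, hN]
          simp only [N, decide_eq_false_iff_not, not_and, not_lt] at hN
          rw [hk]
          exact hN (by omega)
      have h' : ∑ l ∈ Finset.Ico i m, (h.work S l M - h.work S l (a i)) ≤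
          ∑ l ∈ Finset.range m, (h.work S l M - h.work S l (a i)) :=
        Finset.sum_le_sum_of_subset_of_nonneg (fun l hl => by simp at hl ⊢; omega)
          fun l _ _ => sub_nonneg.2 (h.work_mono hS l (haM i him).le)
      linarith
    have hall : ∀ i < m,
        (a i : ℝ) + ∑ l ∈ Finset.Ico i m, keep (fun i => (t i : ℝ)) N l ≤ M := by
      intro i him
      rcases Nat.lt_or_ge i j₀ with hij | hij
      · rw [← Finset.sum_Ico_consecutive _ hij.le hjm.le]
        have h₁ : ∑ l ∈ Finset.Ico i j₀, keep (fun i => (t i : ℝ)) N l =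
            ∑ l ∈ Finset.Ico i j₀, (t l : ℝ) := by
          refine Finset.sum_congr rfl fun l hl => ?_
          simp only [Finset.mem_Ico] at hl
          simp [keep, count_eq_zero hNc hl.2]
        have h₂ : (a i : ℝ) + ∑ l ∈ Finset.Ico i j₀, (t l : ℝ) ≤ a j₀ := by
          exact_mod_cast (add_sum_le_finish a t hij).trans hfin
        rw [h₁]
        linarith [hsuf j₀ le_rfl hjm]
      · exact hsuf i hij him
    refine finish_le ?_ hall
    have := hall 0 hm
    rw [← Finset.range_eq_Ico] at this
    have : (0 : ℝ) ≤ a 0 := by positivity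
    linarith
  · by_cases hc : count N j = 0
    · exact Or.inl hc
    right
    have hjj : j₀ < j := by
      by_contra hcon
      push Not at hcon
      have := count_mono N hcon
      omega
    have := claim (a j) j (by exact_mod_cast h.mono _ _ hjj.le hj) (haM j hj).le hjj.le hj.le
      (fun l hl hjl => by exact_mod_cast h.mono _ _ hjl hl) hc
    rw [sum_cap _ _ hNc hjj.le] at this
    have hf : ((finish a t j : ℕ) : ℝ) = a j₀ + ∑ l ∈ Finset.Ico j₀ j, (t l : ℝ) := by
      exact_mod_cast hfineq j hjj hj.le
    rw [← finish_cast]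
    linarith
  · by_cases hc : count N m = 0
    · exact Or.inl hc
    right
    rw [hcast, ← finish_cast]
    constructor
    -- The job of the last piece is the required kept one: it was executable when the piece began
    -- and worked on until `M`, so it is not overdue at `M` and must be complete.
    · have hMpos : 0 < M := lt_of_le_of_lt (by positivity) (haM j₀ hjm)
      obtain ⟨p, hp, hpM⟩ := Schedule.exists_end_eq_makespan hMpos
      obtain ⟨⟨l, hl⟩, hpl⟩ := h.exists_job hS hp
      have hjl : j₀ ≤ l := by
        by_contra hcon
        push Not at hcon
        have := hend l hl hcon p hp hpl.symm
        linarith [haM j₀ hjm]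
      refine count_add_lt hNc hjl hl ?_
      have hp' := hS.nondegenerate p hp
      obtain ⟨-, -, -, h₄⟩ := hS.allowed p hp _ le_rfl hp'.2
      have h₅ := hS.neat.add_le_workDone hp hp'.2.le
      rw [Piece.before_of_le_start hp'.2.le le_rfl, Piece.before_of_end_le hp'.2.le le_rfl,
        hpM] at h₅
      have h₂ := h.len ⟨l, hl⟩
      simp only at h₂
      rw [h.deadline, ← hpl, ← h₂] at h₄
      rw [← hpl] at h₅
      have hwl : h.work S l M = t l := by
        refine (hlastM l hl).resolve_right ?_
        simp only [work, hl, dif_pos]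
        have : p.endTime = M := hpM
        linarith
      simp [N, hwl]
    · have := claim M m (haM j₀ hjm).le le_rfl hjm.le le_rfl (fun l hl hml => by omega) hc
      rw [sum_cap _ _ hNc hjm.le] at this
      have hf : ((finish a t m : ℕ) : ℝ) = a j₀ + ∑ l ∈ Finset.Ico j₀ m, (t l : ℝ) := by
        exact_mod_cast hfineq m hjm le_rfl
      linarith

end Sorted

/-! ### Amounts of work for the jobs that are not completed -/

/-- Processing times of the jobs in `N`. -/
def dropped (t : ℕ → ℕ) (N : ℕ → Bool) (i : ℕ) : ℕ := if N i then t i else 0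

/-- What is left of a budget `b` of work when the first `j` jobs in `N` have got at most
`t i - (δ + 1)` each. -/
def budget (t : ℕ → ℕ) (δ b : ℕ) (N : ℕ → Bool) : ℕ → ℕ
  | 0 => b
  | j + 1 => if N j then budget t δ b N j - min (budget t δ b N j) (t j - (δ + 1))
    else budget t δ b N j

/-- The amount of work that is spent on a job. -/
def allot (t : ℕ → ℕ) (δ b : ℕ) (N : ℕ → Bool) (j : ℕ) : ℕ :=
  if N j then min (budget t δ b N j) (t j - (δ + 1)) else t j

/-- Amounts of work that can be scheduled by giving priority to the jobs in `N`, and to later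
arrivals among them. -/
structure Plan (m : ℕ) (a t : ℕ → ℕ) (D C : ℕ) (N : ℕ → Bool) (y : ℕ → ℕ) : Prop where
  horizon : a m = C
  mono : ∀ j < m, a j ≤ a (j + 1)
  window : ∀ i < m, a i + t i ≤ D
  le_deadline : C ≤ D
  len_pos : ∀ i < m, 0 < t i
  le_len : ∀ i < m, y i ≤ t i
  kept : ∀ i < m, N i = false → y i = t i
  cut : ∀ i < m, N i = true → y i + (D - C) < t i
  partial_last : ∀ i < m, N i = true → y i + (D - C) + 1 = t i ∨
    ∀ l < m, i < l → N l = true → y l = 0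
  finish_le : finish a y m ≤ C
  finish_eq : count N m ≠ 0 → finish a y m = C
  not_idle : ∀ j < m, count N j ≠ 0 → a j ≤ finish a y j
  waiting : ∀ j < m, count N m ≠ 0 → (∀ i, j ≤ i → i < m → N i = true) → a j < finish a y j

theorem add_le_of_dvd {g x y : ℕ} (hx : g ∣ x) (hy : g ∣ y) (h : x < y) : x + g ≤ y := by
  have := Nat.le_of_dvd (by omega) (Nat.dvd_sub hy hx)
  omega

theorem dvd_finish {g : ℕ} {a t : ℕ → ℕ} {m : ℕ} (h : ∀ j < m, g ∣ a j ∧ g ∣ t j) :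
    ∀ j ≤ m, g ∣ finish a t j := by
  intro j
  induction j with
  | zero => simp [finish]
  | succ j ih =>
    intro hj
    refine Dvd.dvd.add ?_ (h j hj).2
    rcases max_choice (finish a t j) (a j) with h' | h' <;> rw [h']
    · exact ih (by omega)
    · exact (h j hj).1

section Budget

variable (t : ℕ → ℕ) (δ b : ℕ) (N : ℕ → Bool)

theorem budget_antitone : Antitone (budget t δ b N) :=
  antitone_nat_of_succ_le fun j => by simp only [budget]; split <;> omega

theorem allot_of_budget_pos {j : ℕ} (h : 0 < budget t δ b N j) {i : ℕ} (hi : i < j)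
    (hN : N i = true) : allot t δ b N i = t i - (δ + 1) := by
  have := budget_antitone t δ b N (show i + 1 ≤ j from hi)
  simp only [budget, hN, if_true, allot] at this ⊢
  omega

theorem allot_of_budget_zero {j : ℕ} (h : budget t δ b N j = 0) {i : ℕ} (hi : j ≤ i)
    (hN : N i = true) : allot t δ b N i = 0 := by
  have := budget_antitone t δ b N hi
  simp only [hN, if_true, allot]
  omega

theorem budget_add_sum (j : ℕ) :
    budget t δ b N j + ∑ i ∈ Finset.range j, dropped (allot t δ b N) N i = b := by
  induction j with
  | zero => simp [budget]
  | succ j ih =>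
    rw [Finset.sum_range_succ]
    simp only [budget, dropped, allot] at ih ⊢
    split <;> omega

theorem allot_le (j : ℕ) : allot t δ b N j ≤ t j := by
  simp only [allot]; split <;> omega

end Budget

/-- Divisibility by `g` widens each strict inequality to a gap of `g`, more than the number of jobs,
so the extra unit in the cut `δ + 1` of each job of `N` is affordable. Handing out the budget in
order of arrival puts full amounts first, then at most one partial amount, then zeros; every
inequality is then proved separately for a position where the budget is still positive and one where
it is used up. -/
theorem plan_of_valid {m g : ℕ} {a t : ℕ → ℕ} {D C : ℕ} {N : ℕ → Bool} (hg : m < g)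
    (hdvd : ∀ j < m, g ∣ a j ∧ g ∣ t j) (hD : g ∣ D) (hC : g ∣ C) (hCD : C ≤ D)
    (hmono : ∀ i j, i ≤ j → j < m → a i ≤ a j) (hwin : ∀ i < m, a i + t i ≤ D)
    (hpos : ∀ i < m, 0 < t i) (ham : a m = C) (hv : Valid m a t D C N) :
    Plan m a t D C N
      (allot t (D - C) ((∑ i ∈ Finset.range m, dropped t N i) + C - finish a t m) N) := by
  obtain ⟨δ, rfl⟩ := Nat.exists_eq_add_of_le hCD
  rw [Nat.add_sub_cancel_left]
  have hδ : g ∣ δ := (Nat.dvd_add_right hC).1 hD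
  have hfg := dvd_finish hdvd
  have hgm : ∀ q : ℕ, g ∣ q * δ := fun q => hδ.mul_left q
  -- the conditions with their gaps
  have hlong : ∀ i < m, N i = true → δ + g ≤ t i := fun i hi hN => by
    have := hv.long i hi hN
    exact add_le_of_dvd hδ (hdvd i hi).2 (by omega)
  have hbusy : ∀ j < m, count N j ≠ 0 → a j + count N j * δ + g ≤ finish a t j := by
    intro j hj h0
    have := (hv.busy j hj).resolve_left h0
    simp only [Nat.cast_id, mul_add] at this
    exact add_le_of_dvd ((hdvd j hj).1.add (hgm _)) (hfg j hj.le) (by omega)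
  have hlast : count N m ≠ 0 → count N m + lastStart a t m < m ∧
      C + count N m * δ + g ≤ finish a t m := by
    intro h0
    have := hv.last.resolve_left h0
    simp only [Nat.cast_id, mul_add] at this
    exact ⟨this.1, add_le_of_dvd (hC.add (hgm _)) (hfg m le_rfl) (by omega)⟩
  have hq : ∀ j ≤ m, count N j < g := fun j hj => by have := count_le N j; omega
  set SN := ∑ i ∈ Finset.range m, dropped t N i with hSN
  have hRf : finish a t m ≤ SN + C := by
    have := finish_le_finish_add a t (keep t N) (dropped t N) m
      (fun i _ => by simp only [keep, dropped]; split <;> simp) (fun i _ => Nat.zero_le _)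
    have := hv.fits
    omega
  -- With this budget the cuts add up to `finish a t m - C`, just what is needed to bring the end of
  -- work down to `C`.
  set b := SN + C - finish a t m with hb
  set y := allot t δ b N with hy
  have hyK : ∀ i, N i = false → y i = t i := fun i hN => by simp [hy, allot, hN]
  have hyt : ∀ i, y i ≤ t i := allot_le t δ b N
  -- the cuts
  have hcut_le : ∀ j, finish a t j ≤ finish a y j + ∑ i ∈ Finset.range j, (t i - y i) := fun j =>
    finish_le_finish_add a t y (fun i => t i - y i) j (fun i _ => by have := hyt i; omega)
      fun i _ => Nat.zero_le _
  have hcut_full : ∀ j ≤ m, (∀ i < j, N i = true → y i = t i - (δ + 1)) →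
      ∑ i ∈ Finset.range j, (t i - y i) = count N j * δ + count N j := by
    intro j hj hfull
    induction j with
    | zero => simp [count]
    | succ j ih =>
      rw [Finset.sum_range_succ, ih (by omega) fun i hi => hfull i (by omega)]
      cases hN : N j with
      | false => simp [count, hN, hyK]
      | true =>
        have := hlong j hj hN
        rw [hfull j (by omega) hN]
        simp only [count, hN, if_true, add_mul, one_mul]
        omega
  have hdrop : ∀ s : Finset ℕ, ∑ i ∈ s, dropped t N i =
      ∑ i ∈ s, dropped y N i + ∑ i ∈ s, (t i - y i) := by
    intro s
    rw [← Finset.sum_add_distrib]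
    refine Finset.sum_congr rfl fun i _ => ?_
    have := hyt i
    cases hN : N i with
    | false => simp [dropped, hN, hyK]
    | true => simp [dropped, hN]; omega
  have hbs := budget_add_sum t δ b N
  -- If budget were left over, all jobs of `N` would be cut by exactly `δ + 1`, and by the gap these
  -- cuts together would be too small to have cost less than the budget.
  have hexh : count N m ≠ 0 → budget t δ b N m = 0 := by
    intro h0
    by_contra hpos
    have hfull := hcut_full m le_rfl fun i hi hN =>
      allot_of_budget_pos t δ b N (Nat.pos_of_ne_zero hpos) hi hN
    have h₁ := hdrop (Finset.range m)
    have h₂ := hbs m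
    have h₃ := (hlast h0).2
    have h₄ := hq m le_rfl
    rw [← hSN] at h₁
    simp only [← hy] at h₂
    omega
  have htotal : count N m ≠ 0 → ∑ i ∈ Finset.range m, (t i - y i) + C = finish a t m := by
    intro h0
    have h₁ := hdrop (Finset.range m)
    have h₂ := hbs m
    have h₃ := (hlast h0).2
    rw [hexh h0, ← hy] at h₂
    rw [← hSN] at h₁
    omega
  have hcount : ∀ {i j}, i ≤ j → count N i ≠ 0 → count N j ≠ 0 := fun hij h => by
    have := count_mono N hij
    omega
  have hsplit : ∀ (f : ℕ → ℕ) (j : ℕ), j ≤ m → ∑ i ∈ Finset.range m, f i =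
      ∑ i ∈ Finset.range j, f i + ∑ i ∈ Finset.Ico j m, f i := fun f j hj =>
    (Finset.sum_range_add_sum_Ico f hj).symm
  have hRfj : ∀ j ≤ m, count N j ≠ 0 →
      finish a t m = finish a t j + ∑ i ∈ Finset.Ico j m, t i := fun j hj h0 =>
    finish_eq_add_sum hj fun l hl hlm => by have := hbusy l hlm (hcount hl h0); omega
  have hkt : ∀ j, ∑ i ∈ Finset.Ico j m, t i =
      ∑ i ∈ Finset.Ico j m, keep t N i + ∑ i ∈ Finset.Ico j m, dropped t N i := by
    intro j
    rw [← Finset.sum_add_distrib]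
    exact Finset.sum_congr rfl fun i _ => by simp only [keep, dropped]; split <;> simp
  have hzero : ∀ j, budget t δ b N j = 0 → ∀ i, j ≤ i → y i = keep t N i := by
    intro j hj i hi
    cases hN : N i with
    | false => simp [keep, hN, hyK]
    | true => simpa [keep, hN] using allot_of_budget_zero t δ b N hj hi hN
  have hzero' : ∀ j, budget t δ b N j = 0 →
      ∑ i ∈ Finset.Ico j m, (t i - y i) = ∑ i ∈ Finset.Ico j m, dropped t N i := by
    intro j hj
    refine Finset.sum_congr rfl fun i hi => ?_
    rw [hzero j hj i (Finset.mem_Ico.1 hi).1]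
    simp only [keep, dropped]; split <;> simp
  have hfit : ∀ i < m, a i + ∑ l ∈ Finset.Ico i m, keep t N l ≤ C := fun i hi =>
    (add_sum_le_finish a (keep t N) hi).trans hv.fits
  -- If the budget is used up at `i`, only kept jobs remain. Otherwise the earlier cuts are exactly
  -- known, so the later ones are too, and the busy condition at `i` shows that they are large
  -- enough.
  have hbound : ∀ i < m, a i + ∑ l ∈ Finset.Ico i m, y l ≤ C := by
    intro i hi
    by_cases h0 : count N m = 0
    · rw [Finset.sum_congr rfl (g := keep t N) fun l hl => ?_]
      · exact hfit i hi
      · have := count_eq_zero h0 (Finset.mem_Ico.1 hl).2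
        simp [keep, this, hyK]
    rcases Nat.eq_zero_or_pos (budget t δ b N i) with hz | hz
    · rw [Finset.sum_congr rfl (g := keep t N) fun l hl => hzero i hz l (Finset.mem_Ico.1 hl).1]
      exact hfit i hi
    · have h₁ := hcut_full i hi.le fun l hl hN => allot_of_budget_pos t δ b N hz hl hN
      have h₂ := hsplit (fun i => t i - y i) i hi.le
      have h₃ := htotal h0
      have h₄ : ∑ l ∈ Finset.Ico i m, t l =
          ∑ l ∈ Finset.Ico i m, y l + ∑ l ∈ Finset.Ico i m, (t l - y l) := by
        rw [← Finset.sum_add_distrib]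
        exact Finset.sum_congr rfl fun l _ => by have := hyt l; omega
      have h₅ := hq i hi.le
      by_cases hi0 : count N i = 0
      · have := add_sum_le_finish a t hi
        rw [hi0] at h₁
        omega
      · have := hRfj i hi.le hi0
        have := hbusy i hi hi0
        omega
  -- With budget left, the earlier cuts are `δ + 1` each and the busy condition applies. With none
  -- left, the first `j` jobs still last until `C` minus the kept work to come, which is at least `a
  -- j`; it is even `C` if all jobs to come are in `N`, and these are longer than `δ`, so they
  -- arrive before `C`.
  have hlow : ∀ j < m, count N j ≠ 0 → a j ≤ finish a y j ∧
      ((∀ i, j ≤ i → i < m → N i = true) → a j < finish a y j) := by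
    intro j hj h0
    have h₁ := hcut_le j
    rcases Nat.eq_zero_or_pos (budget t δ b N j) with hz | hz
    · have h₂ := hsplit (fun i => t i - y i) j hj.le
      have h₃ := htotal (hcount hj.le h0)
      have h₄ := hzero' j hz
      have h₅ := hRfj j hj.le h0
      have h₆ := hkt j
      have h₇ := hfit j hj
      refine ⟨by omega, fun hall => ?_⟩
      have h₈ : ∑ i ∈ Finset.Ico j m, keep t N i = 0 := Finset.sum_eq_zero fun i hi => by
        simp [keep, hall i (Finset.mem_Ico.1 hi).1 (Finset.mem_Ico.1 hi).2]
      have h₉ := hlong j hj (hall j le_rfl hj)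
      have := hwin j hj
      omega
    · have h₂ := hcut_full j hj.le fun l hl hN => allot_of_budget_pos t δ b N hz hl hN
      have h₃ := hbusy j hj h0
      have h₄ := hq j hj.le
      exact ⟨by omega, fun _ => by omega⟩
  refine ⟨ham, fun j hj => ?_, hwin, by omega, hpos, fun i _ => hyt i, fun i _ => hyK i,
    fun i hi hN => ?_, fun i hi hN => ?_, ?_, fun h0 => ?_, fun j hj h0 => (hlow j hj h0).1,
    fun j hj h0 hall => ?_⟩
  · rcases Nat.lt_or_ge (j + 1) m with h | h
    · exact hmono _ _ (by omega) h
    · rw [show j + 1 = m by omega, ham]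
      exact (Nat.le_add_right _ _).trans (hbound j hj)
  · have := hlong i hi hN
    simp only [hy, allot, hN, if_true]
    omega
  · have h₁ := hlong i hi hN
    rcases Nat.lt_or_ge (budget t δ b N i) (t i - (δ + 1)) with h | h
    · right
      intro l _ hil hNl
      refine allot_of_budget_zero t δ b N (j := i + 1) ?_ hil hNl
      simp only [budget, hN, if_true]
      omega
    · left
      simp only [hy, allot, hN, if_true]
      omega
  · refine finish_le ?_ hbound
    rcases Nat.eq_zero_or_pos m with rfl | hm
    · simp
    · have := hbound 0 hm
      rw [← Finset.range_eq_Ico] at this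
      omega
  · refine le_antisymm ?_ ?_
    · refine finish_le ?_ hbound
      rcases Nat.eq_zero_or_pos m with rfl | hm
      · simp
      · have := hbound 0 hm
        rw [← Finset.range_eq_Ico] at this
        omega
    · have := hcut_le m
      have := htotal h0
      omega
  -- If `N` consists of exactly the jobs from `j` on, the condition that some job from the last
  -- start on is kept means that the last start lies before `j`; hence `j` finds uncut work waiting.
  · by_cases hj0 : count N j = 0
    · have h₁ := (hlast h0).1
      have h₂ := count_add_of_forall hj.le hall
      rw [finish_congr (w' := t) fun i hi => hyK i (count_eq_zero hj0 hi)]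
      exact lt_finish_of_lastStart_lt (by omega : lastStart a t m < j) hj
    · exact (hlow j hj hj0).2 hall

/-! ### Priority scheduling -/

section Simulation

variable {m : ℕ} {a t : ℕ → ℕ} {D C : ℕ} {N : ℕ → Bool} {y : ℕ → ℕ}

/-- The state of affairs at time `τ`, between the arrivals of the jobs `j` and `j + 1`, if an
amount `rem i` of the work planned for job `i` is still to be done. -/
structure Snapshot (a t : ℕ → ℕ) (m D C : ℕ) (N : ℕ → Bool) (y : ℕ → ℕ) (j τ : ℕ)
    (rem : ℕ → ℕ) : Prop where
  lt : j < m
  arrival_le : a j ≤ τ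
  le_next : τ ≤ a (j + 1)
  sum_eq : τ + ∑ i ∈ Finset.range (j + 1), rem i = finish a y (j + 1)
  future : ∀ i, j < i → i < m → rem i = y i
  rem_le : ∀ i < m, rem i ≤ y i
  partial_first : ∀ i ≤ j, N i = true → y i + (D - C) + 1 ≠ t i →
    rem i = 0 ∨ τ + rem i ≤ a i + y i

/-- Some job that is to be completed has not been completed yet. -/
def Pending (m : ℕ) (N : ℕ → Bool) (rem : ℕ → ℕ) : Prop :=
  count N m ≠ 0 → ∃ i < m, N i = false ∧ 0 < rem i

theorem Snapshot.add_sum_le (hp : Plan m a t D C N y) {j τ : ℕ} {rem : ℕ → ℕ}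
    (h : Snapshot a t m D C N y j τ rem) : τ + ∑ i ∈ Finset.range m, rem i ≤ C := by
  have h₁ := finish_add_sum_le a y (show j + 1 ≤ m from h.lt)
  have h₂ : ∑ i ∈ Finset.Ico (j + 1) m, rem i = ∑ i ∈ Finset.Ico (j + 1) m, y i :=
    Finset.sum_congr rfl fun i hi => by
      simp only [Finset.mem_Ico] at hi
      exact h.future i (by omega) hi.2
  rw [← Finset.sum_range_add_sum_Ico rem (show j + 1 ≤ m from h.lt)]
  have := h.sum_eq
  have := hp.finish_le
  omega

/-- All remaining work fits before `C`. A kept job then meets its deadline. A job cut by `δ + 1` has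
to be left by `C - 1`, for which a pending unit of kept work makes room. A job with a partial amount
has been served without delay since its arrival, so its slack is still that of its window. -/
theorem Snapshot.executable (hp : Plan m a t D C N y) {j τ : ℕ} {rem : ℕ → ℕ}
    (h : Snapshot a t m D C N y j τ rem) {i : ℕ} (hi : i ≤ j) (hrem : 0 < rem i)
    (hpend : N i = true → Pending m N rem) :
    τ + t i + rem i ≤ D + y i ∧ τ + rem i ≤ C := by
  have him : i < m := hi.trans_lt h.lt
  have hsum := h.add_sum_le hp
  have hle : rem i ≤ ∑ i ∈ Finset.range m, rem i :=
    Finset.single_le_sum (f := rem) (fun _ _ => Nat.zero_le _) (by simpa using him)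
  have hCD := hp.le_deadline
  refine ⟨?_, by omega⟩
  cases hN : N i with
  | false => have := hp.kept i him hN; omega
  | true =>
    by_cases hc : y i + (D - C) + 1 = t i
    · obtain ⟨l, hl, hNl, hrl⟩ := hpend hN (by have := count_pos him hN; omega)
      have hil : i ≠ l := by rintro rfl; simp [hN] at hNl
      have : rem i + rem l ≤ ∑ i ∈ Finset.range m, rem i := by
        rw [← Finset.sum_pair hil]
        exact Finset.sum_le_sum_of_subset (by
          intro x hx; simp at hx ⊢; rcases hx with rfl | rfl <;> assumption)
      omega
    · have := (h.partial_first i hi hN hc).resolve_left (by omega)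
      have := hp.window i him
      omega

/-- Time passes only for the job that is served; a partial job that had to wait would lose its
slack, so no other one may have work left. -/
theorem Snapshot.step {j τ d : ℕ} {rem : ℕ → ℕ}
    (h : Snapshot a t m D C N y j τ rem) {i : ℕ} (hi : i ≤ j) (hd : d ≤ rem i)
    (hd' : τ + d ≤ a (j + 1))
    (hother : ∀ l ≤ j, l ≠ i → N l = true → y l + (D - C) + 1 ≠ t l → rem l = 0) :
    Snapshot a t m D C N y j (τ + d) (Function.update rem i (rem i - d)) := by
  refine ⟨h.lt, h.arrival_le.trans (by omega), hd', ?_, fun l hl hlm => ?_, fun l hl => ?_,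
    fun l hl hN hc => ?_⟩
  · rw [← h.sum_eq, Finset.sum_update_of_mem (by simp; omega),
      ← Finset.add_sum_erase (Finset.range (j + 1)) rem (show i ∈ _ by simp; omega),
      Finset.sdiff_singleton_eq_erase]
    omega
  · rw [Function.update_of_ne (by omega)]
    exact h.future l hl hlm
  · by_cases hli : l = i
    · subst hli
      have := h.rem_le l hl
      simp; omega
    · rw [Function.update_of_ne hli]
      exact h.rem_le l hl
  · by_cases hli : l = i
    · subst hli
      rcases h.partial_first l hl hN hc with h' | h'
      · left; simp [h']
      · simp; omega
    · rw [Function.update_of_ne hli]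
      exact Or.inl (hother l hl hli hN hc)

/-- The invariant of the first pass: the jobs in `N` from index `k` on have been considered. -/
structure FirstPass (a t : ℕ → ℕ) (m D C : ℕ) (N : ℕ → Bool) (y : ℕ → ℕ) (j k τ : ℕ)
    (rem : ℕ → ℕ) : Prop extends Snapshot a t m D C N y j τ rem where
  pending : Pending m N rem
  considered : ∀ i ≤ j, k ≤ i → N i = true → rem i = 0 ∨ τ = a (j + 1)

/-- The invariant of the second pass: the jobs outside of `N` from index `k` on have been
considered. -/
structure SecondPass (a t : ℕ → ℕ) (m D C : ℕ) (N : ℕ → Bool) (y : ℕ → ℕ) (j k τ : ℕ)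
    (rem : ℕ → ℕ) : Prop extends Snapshot a t m D C N y j τ rem where
  pending : Pending m N rem ∨ ∀ i ≤ j, N i = true → rem i = 0
  first : ∀ i ≤ j, N i = true → rem i = 0 ∨ τ = a (j + 1)
  considered : ∀ i ≤ j, k ≤ i → N i = false → rem i = 0 ∨ τ = a (j + 1)

theorem FirstPass.skip {j k τ : ℕ} {rem : ℕ → ℕ} (h : FirstPass a t m D C N y j (k + 1) τ rem)
    (hk : N k = true → min (rem k) (a (j + 1) - τ) = 0) :
    FirstPass a t m D C N y j k τ rem := by
  refine ⟨h.toSnapshot, h.pending, fun i hi hki hN => ?_⟩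
  rcases hki.eq_or_lt with rfl | hki
  · have := hk hN
    have := h.le_next
    omega
  · exact h.considered i hi hki hN

theorem SecondPass.skip {j k τ : ℕ} {rem : ℕ → ℕ}
    (h : SecondPass a t m D C N y j (k + 1) τ rem)
    (hk : N k = false → min (rem k) (a (j + 1) - τ) = 0) :
    SecondPass a t m D C N y j k τ rem := by
  refine ⟨h.toSnapshot, h.pending, h.first, fun i hi hki hN => ?_⟩
  rcases hki.eq_or_lt with rfl | hki
  · have := hk hN
    have := h.le_next
    omega
  · exact h.considered i hi hki hN

theorem FirstPass.step (hp : Plan m a t D C N y) {j k τ : ℕ} {rem : ℕ → ℕ}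
    (h : FirstPass a t m D C N y j (k + 1) τ rem) (hkj : k ≤ j) (hN : N k = true)
    (hd : min (rem k) (a (j + 1) - τ) ≠ 0) :
    FirstPass a t m D C N y j k (τ + min (rem k) (a (j + 1) - τ))
      (Function.update rem k (rem k - min (rem k) (a (j + 1) - τ))) := by
  set d := min (rem k) (a (j + 1) - τ) with hdd
  have hle := h.le_next
  have hkm : k < m := hkj.trans_lt h.lt
  have hdone : ∀ l ≤ j, k + 1 ≤ l → N l = true → rem l = 0 := fun l hl hkl hNl =>
    (h.considered l hl hkl hNl).resolve_right (by omega)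
  refine ⟨h.toSnapshot.step hkj (by omega) (by omega) fun l hl hlk hNl hc => ?_, fun h0 => ?_,
    fun i hi hki hNi => ?_⟩
  · rcases Nat.lt_or_ge k l with hkl | hkl
    · exact hdone l hl hkl hNl
    -- An earlier partial job would imply that job `k` gets no work at all, but `k` is being served.
    · have hlm : l < m := by have := h.lt; omega
      have := ((hp.partial_last l hlm hNl).resolve_left hc) k hkm (by omega) hN
      have := h.rem_le k hkm
      omega
  · obtain ⟨i, hi, hNi, hr⟩ := h.pending h0
    have : i ≠ k := by rintro rfl; simp [hN] at hNi
    exact ⟨i, hi, hNi, by rwa [Function.update_of_ne this]⟩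
  · rcases hki.eq_or_lt with rfl | hki
    · simp only [Function.update_self]; omega
    · rw [Function.update_of_ne (by omega)]
      exact Or.inl (hdone i hi hki hNi)

theorem SecondPass.step {j k τ : ℕ} {rem : ℕ → ℕ}
    (h : SecondPass a t m D C N y j (k + 1) τ rem) (hkj : k ≤ j) (hN : N k = false)
    (hd : min (rem k) (a (j + 1) - τ) ≠ 0) :
    SecondPass a t m D C N y j k (τ + min (rem k) (a (j + 1) - τ))
      (Function.update rem k (rem k - min (rem k) (a (j + 1) - τ))) := by
  set d := min (rem k) (a (j + 1) - τ) with hdd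
  have hle := h.le_next
  have hkm : k < m := hkj.trans_lt h.lt
  have hdone : ∀ l ≤ j, N l = true → rem l = 0 := fun l hl hNl =>
    (h.first l hl hNl).resolve_right (by omega)
  have hne : ∀ l, N l = true → l ≠ k := by rintro l hNl rfl; simp [hN] at hNl
  have hdone' : ∀ l ≤ j, N l = true → Function.update rem k (rem k - d) l = 0 := fun l hl hNl => by
    rw [Function.update_of_ne (hne l hNl)]; exact hdone l hl hNl
  refine ⟨h.toSnapshot.step hkj (by omega) (by omega) fun l hl _ hNl _ => hdone l hl hNl,
    Or.inr hdone', fun l hl hNl => Or.inl (hdone' l hl hNl), fun i hi hki hNi => ?_⟩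
  rcases hki.eq_or_lt with rfl | hki
  · simp only [Function.update_self]; omega
  · rw [Function.update_of_ne (by omega)]
    exact (h.considered i hi hki hNi).imp_right fun h' => by omega

theorem FirstPass.toSecondPass {j τ : ℕ} {rem : ℕ → ℕ} (h : FirstPass a t m D C N y j 0 τ rem) :
    SecondPass a t m D C N y j (j + 1) τ rem :=
  ⟨h.toSnapshot, Or.inl h.pending, fun i hi hN => h.considered i hi (Nat.zero_le _) hN,
    fun i hi hki => by omega⟩

theorem SecondPass.done {j τ : ℕ} {rem : ℕ → ℕ} (h : SecondPass a t m D C N y j 0 τ rem) :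
    τ = a (j + 1) ∨ ∀ i ≤ j, rem i = 0 := by
  by_cases hτ : τ = a (j + 1)
  · exact Or.inl hτ
  · right
    intro i hi
    cases hN : N i with
    | true => exact (h.first i hi hN).resolve_right hτ
    | false => exact (h.considered i hi (Nat.zero_le _) hN).resolve_right hτ

theorem firstPass_zero (hp : Plan m a t D C N y) (hm : 0 < m) :
    FirstPass a t m D C N y 0 1 (a 0) y := by
  refine ⟨⟨hm, le_rfl, hp.mono 0 hm, by simp [finish], fun _ _ _ => rfl, fun _ _ => le_rfl,
    fun i hi hN hc => ?_⟩, fun h0 => ?_, fun i hi hki => by omega⟩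
  · obtain rfl : i = 0 := by omega
    exact Or.inr le_rfl
  · by_contra hcon
    push Not at hcon
    -- If no kept job were pending initially, all jobs would be in `N`, and job `0` would have to
    -- find work waiting at its arrival.
    have := hp.waiting 0 hm h0 fun i _ hi => by
      by_contra hN
      have hN : N i = false := by simpa using hN
      have h₁ := hcon i hi hN
      have h₂ := hp.kept i hi hN
      have h₃ := hp.len_pos i hi
      omega
    simp [finish] at this

/-- Idling before the next arrival means that all earlier work is done and, by `Plan.not_idle`, that
no earlier job is in `N`. Then all earlier jobs are complete, so the idle time is legitimate. -/
theorem SecondPass.next (hp : Plan m a t D C N y) {j τ : ℕ} {rem : ℕ → ℕ}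
    (h : SecondPass a t m D C N y j 0 τ rem) (hj : j + 1 < m) :
    FirstPass a t m D C N y (j + 1) (j + 1 + 1) (a (j + 1)) rem ∧
      (τ = a (j + 1) ∨ (τ ≤ a (j + 1) ∧ ∀ i ≤ j, N i = false ∧ rem i = 0)) := by
  have hle := h.le_next
  have hsum := h.sum_eq
  have hfut := h.future (j + 1) (by omega) hj
  have hidle : τ = a (j + 1) ∨ (τ ≤ a (j + 1) ∧ (∀ i ≤ j, N i = false ∧ rem i = 0) ∧
      finish a y (j + 1) ≤ a (j + 1) ∧ ∑ i ∈ Finset.range (j + 1), rem i = 0) := by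
    rcases h.done with h' | h'
    · exact Or.inl h'
    · rcases hle.eq_or_lt with h'' | h''
      · exact Or.inl h''
      right
      have h0 : ∑ i ∈ Finset.range (j + 1), rem i = 0 :=
        Finset.sum_eq_zero fun i hi => h' i (by simp at hi; omega)
      have hc : count N (j + 1) = 0 := by
        by_contra hc
        have := hp.not_idle (j + 1) hj hc
        omega
      exact ⟨hle, fun i hi => ⟨count_eq_zero hc (by omega), h' i hi⟩, by omega, h0⟩
  refine ⟨⟨⟨hj, le_rfl, hp.mono _ hj, ?_, fun i hi him => h.future i (by omega) him, h.rem_le,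
    fun i hi hN hc => ?_⟩, fun h0 => ?_, fun i hi hki => by omega⟩,
    hidle.imp_right fun h' => ⟨h'.1, h'.2.1⟩⟩
  · rw [Finset.sum_range_succ, hfut]
    conv_rhs => rw [finish]
    rcases hidle with h' | ⟨-, -, h₁, h₂⟩
    · rw [max_eq_left (by omega)]; omega
    · rw [max_eq_right h₁, h₂]; omega
  · rcases Nat.lt_or_ge j i with hji | hji
    · obtain rfl : i = j + 1 := by omega
      exact Or.inr (by omega)
    · rcases hidle with h' | ⟨-, h', -⟩
      · rw [← h']; exact h.partial_first i hji hN hc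
      · exact Or.inl (h' i hji).2
  · rcases h.pending with h' | h'
    · exact h' h0
    by_contra hcon
    push Not at hcon
    -- Without pending kept work, all jobs to come are in `N`; then the plan promises waiting work
    -- at this arrival, but nothing is left to be done.
    have hw := hp.waiting (j + 1) hj h0 fun i hji hi => by
      by_contra hN
      have hN : N i = false := by simpa using hN
      have h₁ := hcon i hi hN
      have h₂ := hp.kept i hi hN
      have h₃ := hp.len_pos i hi
      have h₄ := h.future i (by omega) hi
      omega
    have h0 : ∑ i ∈ Finset.range (j + 1), rem i = 0 := Finset.sum_eq_zero fun i hi => by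
      simp only [Finset.mem_range] at hi
      cases hN : N i with
      | true => exact h' i (by omega) hN
      | false => have := hcon i (by omega) hN; omega
    omega

/-- The convention `a m = C` makes the horizon the end of the last interval. When `N` is nonempty
the work must end exactly at `C`, since only then are the jobs of `N` known to be overdue. -/
theorem SecondPass.final (hp : Plan m a t D C N y) {j τ : ℕ} {rem : ℕ → ℕ}
    (h : SecondPass a t m D C N y j 0 τ rem) (hj : j + 1 = m) :
    τ ≤ C ∧ (∀ i < m, rem i = 0) ∧ (count N m ≠ 0 → τ = C) := by
  have hle := h.le_next
  have hsum := h.sum_eq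
  rw [hj] at hsum
  rw [hj, hp.horizon] at hle
  have hfin := hp.finish_le
  have h0 : ∀ i < m, rem i = 0 := by
    rcases h.done with h' | h'
    · rw [hj, hp.horizon] at h'
      intro i hi
      have : rem i ≤ ∑ i ∈ Finset.range m, rem i :=
        Finset.single_le_sum (f := rem) (fun _ _ => Nat.zero_le _) (by simpa using hi)
      omega
    · exact fun i hi => h' i (by omega)
  refine ⟨hle, h0, fun hc => ?_⟩
  rw [Finset.sum_eq_zero fun i hi => h0 i (by simpa using hi)] at hsum
  have := hp.finish_eq hc
  omega

end Simulation

/-! ### Schedules with rational end points -/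

/-- Arrival times, processing times and the deadline in units of `1 / F`. -/
structure Scaled (F m : ℕ) (a₀ t₀ : ℕ → ℕ) (D₀ : ℕ) (a t : ℕ → ℕ) (D : ℕ) : Prop where
  pos : 0 < F
  arrival : ∀ j < m, a j = a₀ j * F
  len : ∀ j < m, t j = t₀ j * F
  deadline : D = D₀ * F

/-- The pieces `L`, in units of `1 / F`, are a schedule until time `τ` that is feasible so far, and
an amount `rem j` of the work `y j` planned for job `j` is still to be done. -/
structure Trace {I : Instance} {m : ℕ} (P : Fin m → Fin I.n) (F : ℕ) (y rem : ℕ → ℕ)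
    (L : List (PieceCode I)) (τ : ℕ) : Prop where
  feasible : (toSchedule L).FeasibleUntil (τ / F)
  work : ∀ j (hj : j < m),
    (toSchedule L).workDone (P ⟨j, hj⟩) (τ / F) = ((y j : ℝ) - rem j) / F
  jobs : ∀ p ∈ toSchedule L, ∃ j, P j = p.job

section Trace

variable {I : Instance} {D₀ m : ℕ} {P : Fin m → Fin I.n} {a₀ t₀ : ℕ → ℕ} {F : ℕ} {a t : ℕ → ℕ}
  {D : ℕ} {y rem : ℕ → ℕ} {L : List (PieceCode I)} {τ : ℕ}

theorem trace_nil : Trace P F y y [] 0 :=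
  ⟨by simpa [toSchedule] using Schedule.feasibleUntil_nil,
    fun j hj => by simp [toSchedule, Schedule.workDone_nil], by simp [toSchedule]⟩

theorem Scaled.arrival_eq (hs : Scaled F m a₀ t₀ D₀ a t D) (h : Sorted I D₀ m P a₀ t₀) {j : ℕ}
    (hj : j < m) : (I.arrival (P ⟨j, hj⟩) : ℝ) = a j / F ∧ (I.len (P ⟨j, hj⟩) : ℝ) = t j / F := by
  have hF : (F : ℝ) ≠ 0 := by exact_mod_cast hs.pos.ne'
  have h₁ := h.arrival ⟨j, hj⟩
  have h₂ := h.len ⟨j, hj⟩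
  simp only at h₁ h₂
  rw [← h₁, ← h₂, hs.arrival j hj, hs.len j hj]
  push_cast
  constructor <;> field_simp

theorem Scaled.deadline_eq (hs : Scaled F m a₀ t₀ D₀ a t D) (h : Sorted I D₀ m P a₀ t₀)
    (i : Fin I.n) : (I.deadline i : ℝ) = D / F := by
  have hF : (F : ℝ) ≠ 0 := by exact_mod_cast hs.pos.ne'
  rw [h.deadline, hs.deadline]
  push_cast
  field_simp

theorem Trace.not_executable (hs : Scaled F m a₀ t₀ D₀ a t D) (h : Sorted I D₀ m P a₀ t₀)
    (hT : Trace P F y rem L τ) {x : ℝ} (hx : (τ : ℝ) / F ≤ x)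
    (hj : ∀ j < m, rem j = 0 ∧ (y j = t j ∨ D + y j < τ + t j) ∨ x < a j / F) (i : Fin I.n) :
    ¬ (toSchedule L).Executable i x := by
  have hF : (0 : ℝ) < F := by exact_mod_cast hs.pos
  by_cases hi : ∃ j, P j = i
  · obtain ⟨⟨j, hjm⟩, rfl⟩ := hi
    rintro ⟨h₁, h₂, h₃, h₄⟩
    rw [(hs.arrival_eq h hjm).1] at h₁
    rw [(hs.arrival_eq h hjm).2, hT.feasible.workDone_eq _ hx, hT.work j hjm] at h₃ h₄
    rw [hs.deadline_eq h] at h₄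
    rcases hj j hjm with ⟨h₅, h₆⟩ | h₅
    · rw [h₅, Nat.cast_zero, sub_zero] at h₃ h₄
      rcases h₆ with h₆ | h₆
      · rw [h₆] at h₃
        exact lt_irrefl _ h₃
      · have h₇ : (D : ℝ) + y j < τ + t j := by exact_mod_cast h₆
        have h₈ : ((D : ℝ) + y j) / F < (τ + t j) / F := by gcongr
        rw [add_div, add_div] at h₈
        linarith
    · linarith
  · exact h.not_executable hT.feasible.toNeat (fun j hj => hi ⟨j, hj⟩)
      (fun p hp hpi => hi (hpi ▸ hT.jobs p hp)) x

theorem Trace.idle (hs : Scaled F m a₀ t₀ D₀ a t D) (h : Sorted I D₀ m P a₀ t₀)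
    (hT : Trace P F y rem L τ) {σ : ℕ} (hσ : τ ≤ σ)
    (hj : ∀ j < m, rem j = 0 ∧ y j = t j ∨ σ ≤ a j) : Trace P F y rem L σ := by
  have hF : (0 : ℝ) < F := by exact_mod_cast hs.pos
  have hτσ : (τ : ℝ) / F ≤ σ / F := by gcongr
  refine ⟨hT.feasible.idle hτσ fun x h₁ h₂ => hT.not_executable hs h h₁ fun j hjm => ?_,
    fun j hjm => ?_, hT.jobs⟩
  · refine (hj j hjm).imp (fun h' => ⟨h'.1, Or.inl h'.2⟩) fun h' => h₂.trans_le ?_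
    gcongr
  · rw [hT.feasible.workDone_eq _ hτσ, hT.work j hjm]

theorem Trace.final (hs : Scaled F m a₀ t₀ D₀ a t D) (h : Sorted I D₀ m P a₀ t₀)
    (hT : Trace P F y rem L τ) (hj : ∀ j < m, rem j = 0 ∧ (y j = t j ∨ D + y j < τ + t j)) :
    (toSchedule L).Feasible ∧ (toSchedule L).makespan ≤ τ / F :=
  ⟨hT.feasible.feasible fun _ hx => hT.not_executable hs h hx fun j hjm => Or.inl (hj j hjm),
    Schedule.makespan_le (by positivity) hT.feasible.end_le⟩

theorem Trace.step (hs : Scaled F m a₀ t₀ D₀ a t D) (h : Sorted I D₀ m P a₀ t₀)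
    (hT : Trace P F y rem L τ) {i d : ℕ} (hi : i < m) (ha : a i ≤ τ) (hd0 : 0 < d)
    (hd : d ≤ rem i) (hdD : τ + d ≤ D) (hyt : y i ≤ t i) (hex : τ + t i + rem i ≤ D + y i) :
    Trace P F y (Function.update rem i (rem i - d))
      (L ++ [⟨P ⟨i, hi⟩, τ, τ + d, F⟩]) (τ + d) := by
  have hF : (0 : ℝ) < F := by exact_mod_cast hs.pos
  have hL : toSchedule (L ++ [⟨P ⟨i, hi⟩, τ, τ + d, F⟩]) =
      toSchedule L ++ [PieceCode.toPiece ⟨P ⟨i, hi⟩, τ, τ + d, F⟩] := by simp [toSchedule]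
  have hw := hT.work i hi
  have hdR : (d : ℝ) ≤ rem i := by exact_mod_cast hd
  have hytR : (y i : ℝ) ≤ t i := by exact_mod_cast hyt
  have hexR : (τ : ℝ) + t i + rem i ≤ D + y i := by exact_mod_cast hex
  have hd0R : (0 : ℝ) < d := by exact_mod_cast hd0
  have hlt : (τ : ℝ) / F < ((τ + d : ℕ) : ℝ) / F := by push_cast; gcongr; linarith
  refine ⟨?_, fun j hj => ?_, fun p hp => ?_⟩
  · rw [hL]
    refine hT.feasible.concat (p := PieceCode.toPiece ⟨P ⟨i, hi⟩, τ, τ + d, F⟩) rfl hlt ?_ ?_ ?_ ?_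
    · simp only [PieceCode.toPiece]
      rw [(hs.arrival_eq h hi).1]
      gcongr
    · rw [hs.deadline_eq h]
      simp only [PieceCode.toPiece]
      gcongr
    · simp only [PieceCode.toPiece]
      rw [(hs.arrival_eq h hi).2, hw, ← sub_div, ← add_div]
      gcongr
      push_cast
      linarith
    · simp only [PieceCode.toPiece]
      rw [(hs.arrival_eq h hi).2, hs.deadline_eq h, hw, ← sub_div, ← add_div]
      gcongr
      linarith
  · rw [hL, Schedule.workDone_concat, hT.feasible.workDone_eq _ hlt.le, hT.work j hj]
    by_cases hji : j = i
    · subst hji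
      rw [if_pos (by rfl), Piece.before_of_end_le hlt.le (by rfl)]
      simp only [PieceCode.toPiece, Function.update_self, Nat.cast_sub hd]
      push_cast
      field_simp
      ring
    · rw [if_neg, Function.update_of_ne hji, add_zero]
      intro hP
      have := h.inj hP
      simp only [Fin.mk.injEq] at this
      exact hji this.symm
  · rw [hL] at hp
    rcases List.mem_append.1 hp with hp | hp
    · exact hT.jobs p hp
    · rw [List.mem_singleton.1 hp]
      exact ⟨_, rfl⟩

end Trace

/-! ### Multiplication -/

/-- Register 10 := register 8 * register 9. -/
def mulProgram : Program :=
  10 ::= 0 ;;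
  .loop (.reg 9)
    (.ite (.reg 9 - (.half (.reg 9) + .half (.reg 9))) (10 ::= .reg 10 + .reg 8) .skip ;;
    8 ::= .reg 8 + .reg 8 ;;
    9 ::= .half (.reg 9))

/-- Binary multiplication by doubling and halving: `reg 10 + reg 8 * reg 9` is invariant, and the
number of rounds is the bit length of the second factor. The test `x - (x / 2 + x / 2)` extracts the
last bit. -/
theorem terminates_mul {B : ℕ} {Q : State → Prop} {s : State} (hB : (s.reg 9).size ≤ B)
    (hQ : ∀ s', Frame mulProgram s s' → s'.reg 10 = s.reg 8 * s.reg 9 → Q s') :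
    Terminates B mulProgram Q s := by
  refine Terminates.mono (R := fun s' => s'.reg 10 = s.reg 8 * s.reg 9) ?_ hQ
  refine .seq (.assign ?_)
  refine .loop (fun k s' => s'.reg 9 < 2 ^ k ∧
    s'.reg 10 + s'.reg 8 * s'.reg 9 = s.reg 8 * s.reg 9) hB ?_ ?_ ?_
  · simpa using Nat.lt_size_self _
  · rintro k s' - ⟨h₁, h₂⟩ h₃
    simp only [Expr.eval_reg] at h₃
    obtain ⟨k, rfl⟩ : ∃ l, k = l + 1 := by
      cases k with
      | zero => simp at h₁; omega
      | succ l => exact ⟨l, rfl⟩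
    rw [pow_succ] at h₁
    obtain ⟨z, hz⟩ : ∃ z, z = s'.reg 9 / 2 := ⟨_, rfl⟩
    refine ⟨k, rfl, .seq (.ite (fun h => .assign (.seq (.assign (.assign ?_))))
      (fun h => .skip (.seq (.assign (.assign ?_)))))⟩
    · simp [← hz] at h ⊢
      refine ⟨by omega, ?_⟩
      rw [← h₂, show s'.reg 9 = 2 * z + 1 by omega]
      ring
    · simp [← hz] at h ⊢
      refine ⟨by omega, ?_⟩
      rw [← h₂, show s'.reg 9 = 2 * z by omega]
      ring
  · rintro k s' - ⟨h₁, h₂⟩ h₃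
    simp only [Expr.eval_reg] at h₃
    simpa [h₃] using h₂

/-! ### The program for the dynamic program

Register 3 contains the deadline, register 4 the time `C`, register 6 the number of jobs; arrays 4
and 5 contain the arrival and processing times, arrays 9 and 10 mark the jobs that are forced into
`N` or out of it. The table is in array 7, the multiples of `D - C` are in array 11. The answer is
put into register 23. -/

/-- Maxima are written as `x + (y - x)` with truncated subtraction, and elsewhere minima as `x - (x
- y)`. The result goes to array 8, so that the next half-step can still read entry `q - 1` while
array 7 is overwritten. -/
def releaseProgram : Program :=
  .forLoop 17 (.reg 6 + 1)
    (.ite (.reg 17)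
      (.ite (.reg 18 - (.reg 20 + .get 11 (.reg 17)))
        (.store 8 (.reg 17) (.get 7 (.reg 17) + (.reg 20 - .get 7 (.reg 17))))
        (.store 8 (.reg 17) (.reg 4 + 1)))
      (.store 8 (.reg 17) (.get 7 (.reg 17) + (.reg 20 - .get 7 (.reg 17)))))

def extendProgram : Program :=
  .forLoop 17 (.reg 6 + 1)
    (22 ::= .reg 4 + 1 ;;
    .ite (.get 9 (.reg 16)) .skip
      (22 ::= .reg 22 - (.reg 22 - (.get 8 (.reg 17) + .reg 21))) ;;
    .ite (.reg 17)
      (.ite (.reg 4 + .reg 21 - .reg 3)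
        (.ite (.get 10 (.reg 16)) .skip
          (22 ::= .reg 22 - (.reg 22 - .get 8 (.reg 17 - 1)))) .skip) .skip ;;
    .store 7 (.reg 17) (.reg 22))

def initProgram : Program :=
  24 ::= .reg 3 - .reg 4 ;;
  25 ::= 0 ;;
  .forLoop 17 (.reg 6 + 1)
    (.store 11 (.reg 17) (.reg 25) ;;
    25 ::= .reg 25 + .reg 24 ;;
    .ite (.reg 17) (.store 7 (.reg 17) (.reg 4 + 1)) (.store 7 (.reg 17) 0))

/-- Register 18 carries `finish` of the uncut jobs. Register 19 counts the jobs since the last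
start, and is reset whenever an arrival finds no waiting work. -/
def tableProgram : Program :=
  18 ::= 0 ;;
  19 ::= 0 ;;
  .forLoop 16 (.reg 6)
    (20 ::= .get 4 (.reg 16) ;;
    21 ::= .get 5 (.reg 16) ;;
    .ite (.reg 18 - .reg 20) .skip (19 ::= 0) ;;
    releaseProgram ;;
    extendProgram ;;
    18 ::= .reg 18 + (.reg 20 - .reg 18) + .reg 21 ;;
    19 ::= .reg 19 + 1)

def answerProgram : Program :=
  23 ::= 0 ;;
  .forLoop 17 (.reg 6 + 1)
    (.ite (.get 7 (.reg 17) - .reg 4) .skip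
      (.ite (.reg 17)
        (.ite (.reg 19 - .reg 17)
          (.ite (.reg 18 - (.reg 4 + .get 11 (.reg 17))) (23 ::= 1) .skip) .skip)
        (23 ::= 1)))

def decideProgram : Program :=
  initProgram ;; tableProgram ;; answerProgram

/-! ### Correctness of the program for the dynamic program -/

theorem terminates_release {B : ℕ} {s : State} {a t V : ℕ → ℕ} {D C j : ℕ} (hB : s.reg 6 + 1 ≤ B)
    (hC : s.reg 4 = C) (hR : s.reg 18 = finish a t j) (ha : s.reg 20 = a j)
    (hV : ∀ q < s.reg 6 + 1, s.arr 7 q = V q)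
    (hδ : ∀ q < s.reg 6 + 1, s.arr 11 q = q * (D - C)) :
    Terminates B releaseProgram
      (fun s' => ∀ q < s.reg 6 + 1, s'.arr 8 q = release a t D C j V q) s := by
  refine .forLoop (s.reg 6 + 1) hB (by decide)
    (fun s' hf => by simp [hf.reg 6 (by decide)])
    (fun i s' => ∀ q < i, s'.arr 8 q = release a t D C j V q) (by simp) ?_ (fun s' _ h => h)
  intro i hi s' hf hir hI
  have h4 := hf.reg 4 (by decide)
  have h18 := hf.reg 18 (by decide)
  have h20 := hf.reg 20 (by decide)
  have h7 := hf.arr 7 (by decide)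
  have h11 := hf.arr 11 (by decide)
  have key : ∀ v, v = release a t D C j V i → ∀ q < i + 1,
      ((s'.setArr 8 i v).setReg 17 (i + 1)).arr 8 q = release a t D C j V q := by
    intro v hv q hq
    by_cases hqi : q = i
    · simp [hqi, hv]
    · simp [hqi]; exact hI q (by omega)
  refine .ite (fun h₁ => .ite (fun h₂ => .store ?_) (fun h₂ => .store ?_)) (fun h₁ => .store ?_)
  all_goals
    simp only [Expr.eval_reg, Expr.eval_sub, Expr.eval_add, Expr.eval_get, Expr.eval_one, hir, h4,
      h18, h20, h7, h11, hC, hR, ha, hV i hi, hδ i hi] at *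
    refine key _ ?_
    simp only [release]
  · rw [if_pos (Or.inr (by omega))]; omega
  · rw [if_neg (by omega)]
  · rw [if_pos (Or.inl h₁)]; omega

theorem terminates_extend {B : ℕ} {s : State} {t V XN XK : ℕ → ℕ} {D C j : ℕ}
    (hB : s.reg 6 + 1 ≤ B) (hC : s.reg 4 = C) (hD : s.reg 3 = D) (ht : s.reg 21 = t j)
    (hj : s.reg 16 = j) (hN : s.arr 9 = XN) (hK : s.arr 10 = XK)
    (hV : ∀ q < s.reg 6 + 1, s.arr 8 q = V q) :
    Terminates B extendProgram
      (fun s' => ∀ q < s.reg 6 + 1, s'.arr 7 q = extend t D C XN XK j V q) s := by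
  refine .forLoop (s.reg 6 + 1) hB (by decide)
    (fun s' hf => by simp [hf.reg 6 (by decide)])
    (fun i s' => ∀ q < i, s'.arr 7 q = extend t D C XN XK j V q) (by simp) ?_ (fun s' _ h => h)
  intro i hi s' hf hir hI
  have h4 := hf.reg 4 (by decide)
  have h3 := hf.reg 3 (by decide)
  have h21 := hf.reg 21 (by decide)
  have h16 := hf.reg 16 (by decide)
  have h8 := hf.arr 8 (by decide)
  have h9 := hf.arr 9 (by decide)
  have h10 := hf.arr 10 (by decide)
  have hVi := hV i hi
  have hVi' : s.arr 8 (i - 1) = V (i - 1) := hV _ (by omega)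
  have key : ∀ s'' : State, s''.arr 7 = s'.arr 7 → ∀ v, v = extend t D C XN XK j V i →
      ∀ q < i + 1, ((s''.setArr 7 i v).setReg 17 (i + 1)).arr 7 q = extend t D C XN XK j V q := by
    intro s'' hs v hv q hq
    by_cases hqi : q = i
    · simp [hqi, hv]
    · simp [hqi, hs]; exact hI q (by omega)
  refine .seq (.assign ?_)
  refine .seq_of (R := fun s'' => s''.arr = s'.arr ∧ s''.reg 22 =
    if XN j = 0 then min (C + 1) (V i + t j) else C + 1)
    (.ite (fun h => .skip ?_) (fun h => .assign ?_)) ?_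
  · simp [h4, h9, h16, hj, hN, hC] at h ⊢
    simp [h]
  · simp [h8, h9, h16, hj, hN, hir, hVi, h21, ht, h4, hC] at h ⊢
    simp only [h, if_true]
    omega
  rintro s₁ hf₁ ⟨hs₁, h22⟩
  have g3 : s₁.reg 3 = D := by rw [hf₁.reg 3 (by decide)]; simp [h3, hD]
  have g4 : s₁.reg 4 = C := by rw [hf₁.reg 4 (by decide)]; simp [h4, hC]
  have g16 : s₁.reg 16 = j := by rw [hf₁.reg 16 (by decide)]; simp [h16, hj]
  have g17 : s₁.reg 17 = i := by rw [hf₁.reg 17 (by decide)]; simp [hir]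
  have g21 : s₁.reg 21 = t j := by rw [hf₁.reg 21 (by decide)]; simp [h21, ht]
  refine .seq_of (R := fun s'' => s''.arr = s'.arr ∧ s''.reg 22 = extend t D C XN XK j V i)
    (.ite (fun h₁ => .ite (fun h₂ => .ite (fun h₃ => .skip ?_) (fun h₃ => .assign ?_))
      (fun h₂ => .skip ?_)) (fun h₁ => .skip ?_)) ?_
  case refine_5 =>
    rintro s₂ hf₂ ⟨hs₂, g22⟩
    have g17' : s₂.reg 17 = i := by rw [hf₂.reg 17 (by decide), g17]
    refine .store ?_
    simp only [Expr.eval_reg, g17', g22]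
    exact key s₂ (by rw [hs₂]) _ rfl
  all_goals
    simp only [Expr.eval_reg, Expr.eval_sub, Expr.eval_add, Expr.eval_get, Expr.eval_one, g3, g4,
      g16, g17, g21, hs₁, h8, h9, h10, hVi', h22, hK, State.setReg_arr, State.setReg_reg] at *
    refine ⟨trivial, ?_⟩
    simp only [extend, if_true]
  · rw [if_neg (c := _ ∧ _) (by tauto)]
    split <;> omega
  · rw [if_pos (c := _ ∧ _) ⟨h₁, by omega, h₃⟩]
    split <;> omega
  · rw [if_neg (c := _ ∧ _) (by omega)]
    split <;> omega
  · rw [if_neg (c := _ ∧ _) (by tauto)]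
    split <;> omega

theorem lastStart_le {α : Type*} [Semiring α] [LinearOrder α] (a t : ℕ → α) (j : ℕ) :
    lastStart a t j ≤ j := by
  rcases Nat.eq_zero_or_pos j with rfl | hj
  · rfl
  · exact (lastStart_lt hj).le

theorem terminates_init {B : ℕ} {s : State} (hB : s.reg 6 + 1 ≤ B) :
    Terminates B initProgram (fun s' => (∀ q < s.reg 6 + 1, s'.arr 11 q = q * (s.reg 3 - s.reg 4)) ∧
      ∀ q < s.reg 6 + 1, s'.arr 7 q = if q = 0 then 0 else s.reg 4 + 1) s := by
  refine .seq (.assign (.seq (.assign ?_)))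
  refine .forLoop (s.reg 6 + 1) hB (by decide)
    (fun s' hf => by simp [hf.reg 6 (by decide)])
    (fun i s' => s'.reg 25 = i * (s.reg 3 - s.reg 4) ∧
      (∀ q < i, s'.arr 11 q = q * (s.reg 3 - s.reg 4)) ∧
      ∀ q < i, s'.arr 7 q = if q = 0 then 0 else s.reg 4 + 1) (by simp) ?_ (fun s' _ h => h.2)
  rintro i hi s' hf hir ⟨h25, h₁, h₂⟩
  have h24 : s'.reg 24 = s.reg 3 - s.reg 4 := by rw [hf.reg 24 (by decide)]; simp
  have h4 : s'.reg 4 = s.reg 4 := by rw [hf.reg 4 (by decide)]; simp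
  refine .seq (.store (.seq (.assign (.ite (fun h => .store ?_) (fun h => .store ?_)))))
  all_goals
    simp only [Expr.eval_reg, State.setReg_reg, State.setArr_reg, State.setArr_arr, hir, h25,
      State.setReg_arr, Expr.eval_add, Expr.eval_one, Expr.eval_zero, h24, h4] at h ⊢
    simp only [reduceIte, Nat.reduceEqDiff, true_and, false_and] at h ⊢
    refine ⟨by ring, fun q hq => ?_, fun q hq => ?_⟩
    · split
      · simp [*]
      · exact h₁ q (by omega)
    · split
      · simp [*]
      · exact h₂ q (by omega)

theorem terminates_table {B : ℕ} {s : State} {XN XK : ℕ → ℕ} (hB : s.reg 6 + 1 ≤ B)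
    (hN : s.arr 9 = XN) (hK : s.arr 10 = XK)
    (hδ : ∀ q < s.reg 6 + 1, s.arr 11 q = q * (s.reg 3 - s.reg 4))
    (h₀ : ∀ q < s.reg 6 + 1, s.arr 7 q = if q = 0 then 0 else s.reg 4 + 1) :
    Terminates B tableProgram (fun s' =>
      s'.reg 18 = finish (s.arr 4) (s.arr 5) (s.reg 6) ∧
      s'.reg 19 = s.reg 6 - lastStart (s.arr 4) (s.arr 5) (s.reg 6) ∧
      ∀ q < s.reg 6 + 1,
        s'.arr 7 q = table (s.arr 4) (s.arr 5) (s.reg 3) (s.reg 4) XN XK (s.reg 6) q) s := by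
  refine .seq (.assign (.seq (.assign ?_)))
  refine .forLoop (s.reg 6) (by omega) (by decide)
    (fun s' hf => by simp [hf.reg 6 (by decide)])
    (fun j s' => s'.reg 18 = finish (s.arr 4) (s.arr 5) j ∧
      s'.reg 19 = j - lastStart (s.arr 4) (s.arr 5) j ∧
      ∀ q < s.reg 6 + 1,
        s'.arr 7 q = table (s.arr 4) (s.arr 5) (s.reg 3) (s.reg 4) XN XK j q)
    (by simpa [finish, lastStart, table] using h₀) ?_ (fun s' _ h => h)
  rintro j hj s' hf hjr ⟨h18, h19, h7⟩
  have h3 : s'.reg 3 = s.reg 3 := by rw [hf.reg 3 (by decide)]; simp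
  have h4 : s'.reg 4 = s.reg 4 := by rw [hf.reg 4 (by decide)]; simp
  have h6 : s'.reg 6 = s.reg 6 := by rw [hf.reg 6 (by decide)]; simp
  have a4 : s'.arr 4 = s.arr 4 := by rw [hf.arr 4 (by decide)]; simp
  have a5 : s'.arr 5 = s.arr 5 := by rw [hf.arr 5 (by decide)]; simp
  have a9 : s'.arr 9 = XN := by rw [hf.arr 9 (by decide)]; simpa using hN
  have a10 : s'.arr 10 = XK := by rw [hf.arr 10 (by decide)]; simpa using hK
  have a11 : s'.arr 11 = s.arr 11 := by rw [hf.arr 11 (by decide)]; simp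
  refine .seq (.assign (.seq (.assign ?_)))
  simp only [Expr.eval_get, Expr.eval_reg, hjr, a4, State.setReg_arr, a5, State.setReg_reg,
    Nat.reduceEqDiff, reduceIte]
  set s₁ := (s'.setReg 20 (s.arr 4 j)).setReg 21 (s.arr 5 j) with hs₁
  refine .seq_of (R := fun s'' => s''.arr = s'.arr ∧
    s''.reg 19 + lastStart (s.arr 4) (s.arr 5) (j + 1) = j) (.ite (fun h => .skip ?_)
      (fun h => .assign ?_)) ?_
  · simp [hs₁, h18] at h
    have := lastStart_le (s.arr 4) (s.arr 5) j
    rw [lastStart, if_neg (by omega)]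
    exact ⟨rfl, by simp [hs₁, h19]; omega⟩
  · simp [hs₁, h18] at h
    rw [lastStart, if_pos (by omega)]
    exact ⟨rfl, by simp⟩
  rintro s₂ hf₂ ⟨hs₂, g19⟩
  have e3 : s₂.reg 3 = s.reg 3 := by rw [hf₂.reg 3 (by decide)]; simp [hs₁, h3]
  have e4 : s₂.reg 4 = s.reg 4 := by rw [hf₂.reg 4 (by decide)]; simp [hs₁, h4]
  have e6 : s₂.reg 6 = s.reg 6 := by rw [hf₂.reg 6 (by decide)]; simp [hs₁, h6]
  have e16 : s₂.reg 16 = j := by rw [hf₂.reg 16 (by decide)]; simp [hs₁, hjr]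
  have e18 : s₂.reg 18 = finish (s.arr 4) (s.arr 5) j := by
    rw [hf₂.reg 18 (by decide)]; simp [hs₁, h18]
  have e20 : s₂.reg 20 = s.arr 4 j := by rw [hf₂.reg 20 (by decide)]; simp [hs₁]
  have e21 : s₂.reg 21 = s.arr 5 j := by rw [hf₂.reg 21 (by decide)]; simp [hs₁]
  refine .seq_of (terminates_release (D := s.reg 3) (by omega) e4 e18 e20
    (by rw [e6, hs₂]; exact h7) (by rw [e6, hs₂, a11]; exact hδ)) ?_
  intro s₃ hf₃ h8
  have f16 : s₃.reg 16 = j := by rw [hf₃.reg 16 (by decide), e16]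
  have f3 : s₃.reg 3 = s.reg 3 := by rw [hf₃.reg 3 (by decide), e3]
  have f4 : s₃.reg 4 = s.reg 4 := by rw [hf₃.reg 4 (by decide), e4]
  have f6 : s₃.reg 6 = s.reg 6 := by rw [hf₃.reg 6 (by decide), e6]
  have f21 : s₃.reg 21 = s.arr 5 j := by rw [hf₃.reg 21 (by decide), e21]
  have f9 : s₃.arr 9 = XN := by rw [hf₃.arr 9 (by decide), hs₂, a9]
  have f10 : s₃.arr 10 = XK := by rw [hf₃.arr 10 (by decide), hs₂, a10]
  refine .seq_of (terminates_extend (t := s.arr 5) (by omega) f4 f3 f21 f16 f9 f10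
    (by rw [f6, ← e6]; exact h8)) ?_
  intro s₄ hf₄ g7
  have k18 : s₄.reg 18 = finish (s.arr 4) (s.arr 5) j := by
    rw [hf₄.reg 18 (by decide), hf₃.reg 18 (by decide), e18]
  have k19 : s₄.reg 19 = s₂.reg 19 := by
    rw [hf₄.reg 19 (by decide), hf₃.reg 19 (by decide)]
  have k20 : s₄.reg 20 = s.arr 4 j := by
    rw [hf₄.reg 20 (by decide), hf₃.reg 20 (by decide), e20]
  have k21 : s₄.reg 21 = s.arr 5 j := by rw [hf₄.reg 21 (by decide), f21]
  refine .seq (.assign (.assign ?_))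
  simp only [State.setReg_reg, State.setReg_arr, Expr.eval_add, Expr.eval_sub, Expr.eval_reg,
    Expr.eval_one, k18, k19, k20, k21, Nat.reduceEqDiff, reduceIte, finish]
  refine ⟨by omega, by omega, ?_⟩
  rw [f6] at g7
  exact g7

theorem terminates_answer {B : ℕ} {s : State} {p : ℕ → Prop} (hB : s.reg 6 + 1 ≤ B)
    (hp : ∀ q < s.reg 6 + 1, p q ↔ s.arr 7 q ≤ s.reg 4 ∧
      (q = 0 ∨ (q < s.reg 19 ∧ s.reg 4 + s.arr 11 q < s.reg 18))) :
    Terminates B answerProgram (fun s' => s'.reg 23 ≠ 0 ↔ ∃ q < s.reg 6 + 1, p q) s := by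
  refine .seq (.assign ?_)
  refine .forLoop (s.reg 6 + 1) hB (by decide)
    (fun s' hf => by simp [hf.reg 6 (by decide)])
    (fun i s' => s'.reg 23 ≠ 0 ↔ ∃ q < i, p q) (by simp) ?_ (fun s' _ h => h)
  intro i hi s' hf hir hI
  have h4 : s'.reg 4 = s.reg 4 := by rw [hf.reg 4 (by decide)]; simp
  have h18 : s'.reg 18 = s.reg 18 := by rw [hf.reg 18 (by decide)]; simp
  have h19 : s'.reg 19 = s.reg 19 := by rw [hf.reg 19 (by decide)]; simp
  have a7 : s'.arr 7 = s.arr 7 := by rw [hf.arr 7 (by decide)]; simp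
  have a11 : s'.arr 11 = s.arr 11 := by rw [hf.arr 11 (by decide)]; simp
  have hpi := hp i hi
  have hno : ¬ p i → (s'.reg 23 ≠ 0 ↔ ∃ q < i + 1, p q) := by
    intro hn
    rw [hI]
    constructor
    · rintro ⟨q, hq, h⟩; exact ⟨q, by omega, h⟩
    · rintro ⟨q, hq, h⟩
      rcases Nat.lt_succ_iff_lt_or_eq.1 hq with hq | rfl
      · exact ⟨q, hq, h⟩
      · exact absurd h hn
  refine .ite (fun h₁ => .skip ?_) (fun h₁ => .ite (fun h₂ => .ite (fun h₃ => .ite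
    (fun h₄ => .assign ?_) (fun h₄ => .skip ?_)) (fun h₃ => .skip ?_)) (fun h₂ => .assign ?_))
  all_goals
    simp only [Expr.eval_reg, Expr.eval_sub, Expr.eval_add, Expr.eval_get, Expr.eval_one, hir, h4,
      h18, h19, a7, a11, State.setReg_reg, Nat.reduceEqDiff, reduceIte] at *
  · exact hno fun h => by rw [hpi] at h; omega
  · exact ⟨fun _ => ⟨i, by omega, hpi.2 ⟨by omega, Or.inr ⟨by omega, by omega⟩⟩⟩, by simp⟩
  · exact hno fun h => by rw [hpi] at h; omega
  · exact hno fun h => by rw [hpi] at h; omega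
  · exact ⟨fun _ => ⟨i, by omega, hpi.2 ⟨by omega, Or.inl h₂⟩⟩, by simp⟩

theorem terminates_decide {B : ℕ} {s : State} (hB : s.reg 6 + 1 ≤ B) (hCD : s.reg 4 ≤ s.reg 3) :
    Terminates B decideProgram (fun s' => s'.reg 23 ≠ 0 ↔
      ∃ N, Valid (s.reg 6) (s.arr 4) (s.arr 5) (s.reg 3) (s.reg 4) N ∧
        Consistent (s.arr 9) (s.arr 10) (s.reg 6) N) s := by
  refine .seq_of (terminates_init hB) ?_
  rintro s₁ hf₁ ⟨h11, h7⟩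
  have e3 := hf₁.reg 3 (by decide)
  have e4 := hf₁.reg 4 (by decide)
  have e6 := hf₁.reg 6 (by decide)
  have d4 := hf₁.arr 4 (by decide)
  have d5 := hf₁.arr 5 (by decide)
  have d9 := hf₁.arr 9 (by decide)
  have d10 := hf₁.arr 10 (by decide)
  rw [← e3, ← e4, ← e6] at h11
  rw [← e4, ← e6] at h7
  refine .seq_of (terminates_table (by omega) rfl rfl h11 h7) ?_
  rintro s₂ hf₂ ⟨h18, h19, h7'⟩
  have f3 := hf₂.reg 3 (by decide)
  have f4 := hf₂.reg 4 (by decide)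
  have f6 := hf₂.reg 6 (by decide)
  have f11 := hf₂.arr 11 (by decide)
  refine (terminates_answer (p := fun q =>
    table (s.arr 4) (s.arr 5) (s.reg 3) (s.reg 4) (s.arr 9) (s.arr 10) (s.reg 6) q ≤ s.reg 4 ∧
    (q = 0 ∨ (q < s.reg 6 - lastStart (s.arr 4) (s.arr 5) (s.reg 6) ∧
      s.reg 4 + q * (s.reg 3 - s.reg 4) < finish (s.arr 4) (s.arr 5) (s.reg 6))))
    (by omega) ?_).mono ?_
  · intro q hq
    rw [f6] at hq
    rw [h7' q hq, h18, h19, f4, f11, h11 q hq, e3, e4, e6, d4, d5, d9, d10]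
  · intro s₃ _ h
    rw [h, exists_valid_iff _ _ _ _ _ _ hCD, f6, e6]

/-! ### The program that writes down a schedule

Register 5 contains the unit of time, array 6 the original numbers of the jobs, and array 12 the
amounts of work that are still to be done. The current time is in register 32. -/

/-- The job in register 35 is served until its planned work is done or the next job arrives. Pieces
of length zero are suppressed, since pieces of a schedule have to be nondegenerate. -/
def pieceProgram : Program :=
  34 ::= .get 4 (.reg 30 + 1) - .reg 32 ;;
  34 ::= .reg 34 - (.reg 34 - .get 12 (.reg 35)) ;;
  .ite (.reg 34)
    (.emit (.get 6 (.reg 35)) ;;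
    .emit (.reg 32) ;;
    .emit (.reg 32 + .reg 34) ;;
    .emit (.reg 5) ;;
    32 ::= .reg 32 + .reg 34 ;;
    .store 12 (.reg 35) (.get 12 (.reg 35) - .reg 34))
    .skip

/-- The index `reg 30 - reg 31` runs downwards: later arrivals have priority, so a job with a
partial amount is not kept waiting. -/
def firstPassProgram : Program :=
  .forLoop 31 (.reg 30 + 1)
    (35 ::= .reg 30 - .reg 31 ;; .ite (.get 9 (.reg 35)) pieceProgram .skip)

def secondPassProgram : Program :=
  .forLoop 31 (.reg 30 + 1)
    (35 ::= .reg 30 - .reg 31 ;; .ite (.get 9 (.reg 35)) .skip pieceProgram)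

def simulateProgram : Program :=
  .forLoop 30 (.reg 6) (32 ::= .get 4 (.reg 30) ;; firstPassProgram ;; secondPassProgram)

/-! ### Correctness of the simulation -/

theorem terminates_piece {B : ℕ} {s : State} {i d : ℕ} (hi : s.reg 35 = i)
    (hd : d = min (s.arr 12 i) (s.arr 4 (s.reg 30 + 1) - s.reg 32)) :
    Terminates B pieceProgram (fun s' => s'.reg 32 = s.reg 32 + d ∧
      s'.arr 12 = Function.update (s.arr 12) i (s.arr 12 i - d) ∧
      s'.out = s.out ++ if d = 0 then [] else [s.arr 6 i, s.reg 32, s.reg 32 + d, s.reg 5]) s := by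
  have hd' : s.arr 4 (s.reg 30 + 1) - s.reg 32 -
      (s.arr 4 (s.reg 30 + 1) - s.reg 32 - s.arr 12 i) = d := by omega
  refine .seq (.assign (.seq (.assign (.ite (fun h => .seq (.emit (.seq (.emit (.seq (.emit
    (.seq (.emit (.seq (.assign (.store ?_))))))))))) (fun h => .skip ?_)))))
  · simp [hi, hd'] at h ⊢
    refine ⟨?_, by simp [h]⟩
    funext l
    simp [Function.update_apply]
  · simp [hi, hd'] at h ⊢
    simp [h]

section Simulate

variable {I : Instance} {D₀ m : ℕ} {P : Fin m → Fin I.n} {a₀ t₀ : ℕ → ℕ} {F : ℕ} {a t : ℕ → ℕ}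
  {D C : ℕ} {N : ℕ → Bool} {y : ℕ → ℕ}

/-- The state after the pieces `L`, in units of `1 / F`, have been appended to the output `o`. -/
structure Written (I : Instance) {m : ℕ} (P : Fin m → Fin I.n) (F : ℕ) (y : ℕ → ℕ) (o : List ℕ)
    (rem : ℕ → ℕ) (τ : ℕ) (s : State) : Prop where
  rem_eq : s.arr 12 = rem
  exists_trace : ∃ L : List (PieceCode I), s.out = o ++ encodePieces L ∧ Trace P F y rem L τ

theorem Plan.arrival_mono (hp : Plan m a t D C N y) {i j : ℕ} (hij : i ≤ j) (hj : j ≤ m) :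
    a i ≤ a j := by
  induction j, hij using Nat.le_induction with
  | base => exact le_rfl
  | succ j _ ih => exact (ih (by omega)).trans (hp.mono j (by omega))

theorem terminates_piece_written {B : ℕ} {s : State} {o : List ℕ} {rem : ℕ → ℕ} {j i τ d : ℕ}
    (hs : Scaled F m a₀ t₀ D₀ a t D) (h : Sorted I D₀ m P a₀ t₀) (hp : Plan m a t D C N y)
    (hF : s.reg 5 = F) (ha : s.arr 4 = a) (hP : ∀ j (hj : j < m), s.arr 6 j = P ⟨j, hj⟩)
    (hj : s.reg 30 = j) (hi : s.reg 35 = i) (hij : i ≤ j) (hτ : s.reg 32 = τ)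
    (hsn : Snapshot a t m D C N y j τ rem) (hpend : N i = true → Pending m N rem)
    (hW : Written I P F y o rem τ s) (hd : d = min (rem i) (a (j + 1) - τ)) :
    Terminates B pieceProgram (fun s' => s'.reg 32 = τ + d ∧
      Written I P F y o (Function.update rem i (rem i - d)) (τ + d) s') s := by
  obtain ⟨hrem, L, hout, hT⟩ := hW
  have him : i < m := hij.trans_lt hsn.lt
  refine (terminates_piece (d := d) hi (by rw [hrem, ha, hj, hτ, hd])).mono ?_
  rintro s' - ⟨h32, h12, ho⟩
  rw [hτ] at h32 ho
  rw [hrem] at h12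
  refine ⟨h32, h12, ?_⟩
  rcases Nat.eq_zero_or_pos d with h0 | h0
  · refine ⟨L, by simpa [h0, hout] using ho, ?_⟩
    simpa [h0] using hT
  · obtain ⟨h₁, h₂⟩ := hsn.executable hp hij (by omega) hpend
    have := hp.le_deadline
    refine ⟨L ++ [⟨P ⟨i, him⟩, τ, τ + d, F⟩], ?_, hT.step hs h him
      ((hp.arrival_mono hij hsn.lt.le).trans hsn.arrival_le) h0 (by omega) (by omega)
      (hp.le_len i him) h₁⟩
    rw [ho, hout, if_neg h0.ne', hP i him, hF]
    simp [encodePieces]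

theorem terminates_firstPass {B : ℕ} {s : State} {o : List ℕ} {rem : ℕ → ℕ} {j τ : ℕ}
    (hs : Scaled F m a₀ t₀ D₀ a t D) (h : Sorted I D₀ m P a₀ t₀) (hp : Plan m a t D C N y)
    (hF : s.reg 5 = F) (ha : s.arr 4 = a) (hP : ∀ j (hj : j < m), s.arr 6 j = P ⟨j, hj⟩)
    (hN : ∀ i < m, N i = true ↔ s.arr 9 i ≠ 0) (hB : m ≤ B)
    (hj : s.reg 30 = j) (hτ : s.reg 32 = τ) (hfp : FirstPass a t m D C N y j (j + 1) τ rem)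
    (hW : Written I P F y o rem τ s) :
    Terminates B firstPassProgram (fun s' => ∃ rem' τ', s'.reg 32 = τ' ∧
      FirstPass a t m D C N y j 0 τ' rem' ∧ Written I P F y o rem' τ' s') s := by
  have hjm := hfp.lt
  refine .forLoop (j + 1) (by omega) (by decide)
    (fun s' hf => by simp [hf.reg 30 (by decide), hj])
    (fun i s' => ∃ rem' τ', s'.reg 32 = τ' ∧
      FirstPass a t m D C N y j (j + 1 - i) τ' rem' ∧ Written I P F y o rem' τ' s')
    ⟨rem, τ, hτ, hfp, hW.1, hW.2⟩ ?_ (fun s' _ h => by simpa using h)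
  rintro i hi s' hf hir ⟨rem, τ, hτ, hfp, hW⟩
  have h30 : s'.reg 30 = j := (hf.reg 30 (by decide)).trans hj
  have h5 : s'.reg 5 = F := (hf.reg 5 (by decide)).trans hF
  have h4 : s'.arr 4 = a := (hf.arr 4 (by decide)).trans ha
  have h6 := hf.arr 6 (by decide)
  have h9 := hf.arr 9 (by decide)
  obtain ⟨k, hk⟩ : ∃ k, k = j - i := ⟨_, rfl⟩
  rw [show j + 1 - i = k + 1 by omega] at hfp
  rw [show j + 1 - (i + 1) = k by omega]
  have hkm : k < m := by omega
  have hkr : s'.reg 30 - s'.reg 31 = k := by omega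
  refine .seq (.assign (.ite (fun h' => ?_) (fun h' => .skip ?_)))
  · have hNk : N k = true := (hN k hkm).2 (by simpa [hkr, h9] using h')
    refine (terminates_piece_written (i := k) hs h hp (by simpa using h5) (by simpa using h4)
      (fun j hj => by simpa [h6] using hP j hj) (by simpa using h30) (by simpa using hkr)
      (by omega) (by simpa using hτ) hfp.toSnapshot (fun _ => hfp.pending)
      ⟨by simpa using hW.1, by simpa using hW.2⟩ rfl).mono ?_
    rintro s'' - ⟨e₁, e₂⟩
    by_cases hd : min (rem k) (a (j + 1) - τ) = 0
    · rw [hd] at e₁ e₂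
      simp only [Nat.sub_zero, Function.update_eq_self, Nat.add_zero] at e₁ e₂
      exact ⟨rem, τ, by simpa using e₁, hfp.skip fun _ => hd, e₂.1, e₂.2⟩
    · exact ⟨_, _, by simpa using e₁, hfp.step hp (by omega) hNk hd, e₂.1, e₂.2⟩
  · refine ⟨rem, τ, by simpa using hτ, hfp.skip fun hNk => ?_, hW.1, hW.2⟩
    exact absurd (by simpa [hkr, h9] using h') ((hN k hkm).1 hNk)

theorem terminates_secondPass {B : ℕ} {s : State} {o : List ℕ} {rem : ℕ → ℕ} {j τ : ℕ}
    (hs : Scaled F m a₀ t₀ D₀ a t D) (h : Sorted I D₀ m P a₀ t₀) (hp : Plan m a t D C N y)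
    (hF : s.reg 5 = F) (ha : s.arr 4 = a) (hP : ∀ j (hj : j < m), s.arr 6 j = P ⟨j, hj⟩)
    (hN : ∀ i < m, N i = true ↔ s.arr 9 i ≠ 0) (hB : m ≤ B)
    (hj : s.reg 30 = j) (hτ : s.reg 32 = τ) (hfp : SecondPass a t m D C N y j (j + 1) τ rem)
    (hW : Written I P F y o rem τ s) :
    Terminates B secondPassProgram (fun s' => ∃ rem' τ', s'.reg 32 = τ' ∧
      SecondPass a t m D C N y j 0 τ' rem' ∧ Written I P F y o rem' τ' s') s := by
  have hjm := hfp.lt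
  refine .forLoop (j + 1) (by omega) (by decide)
    (fun s' hf => by simp [hf.reg 30 (by decide), hj])
    (fun i s' => ∃ rem' τ', s'.reg 32 = τ' ∧
      SecondPass a t m D C N y j (j + 1 - i) τ' rem' ∧ Written I P F y o rem' τ' s')
    ⟨rem, τ, hτ, hfp, hW.1, hW.2⟩ ?_ (fun s' _ h => by simpa using h)
  rintro i hi s' hf hir ⟨rem, τ, hτ, hfp, hW⟩
  have h30 : s'.reg 30 = j := (hf.reg 30 (by decide)).trans hj
  have h5 : s'.reg 5 = F := (hf.reg 5 (by decide)).trans hF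
  have h4 : s'.arr 4 = a := (hf.arr 4 (by decide)).trans ha
  have h6 := hf.arr 6 (by decide)
  have h9 := hf.arr 9 (by decide)
  obtain ⟨k, hk⟩ : ∃ k, k = j - i := ⟨_, rfl⟩
  rw [show j + 1 - i = k + 1 by omega] at hfp
  rw [show j + 1 - (i + 1) = k by omega]
  have hkm : k < m := by omega
  have hkr : s'.reg 30 - s'.reg 31 = k := by omega
  refine .seq (.assign (.ite (fun h' => .skip ?_) (fun h' => ?_)))
  · refine ⟨rem, τ, by simpa using hτ, hfp.skip fun hNk => ?_, hW.1, hW.2⟩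
    have := (hN k hkm).2 (by simpa [hkr, h9] using h')
    simp [hNk] at this
  · have hNk : N k = false := by
      rw [← Bool.not_eq_true, hN k hkm]
      simpa [hkr, h9] using h'
    refine (terminates_piece_written (i := k) hs h hp (by simpa using h5) (by simpa using h4)
      (fun j hj => by simpa [h6] using hP j hj) (by simpa using h30) (by simpa using hkr)
      (by omega) (by simpa using hτ) hfp.toSnapshot (fun h' => by simp [hNk] at h')
      ⟨by simpa using hW.1, by simpa using hW.2⟩ rfl).mono ?_
    rintro s'' - ⟨e₁, e₂⟩
    by_cases hd : min (rem k) (a (j + 1) - τ) = 0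
    · rw [hd] at e₁ e₂
      simp only [Nat.sub_zero, Function.update_eq_self, Nat.add_zero] at e₁ e₂
      exact ⟨rem, τ, by simpa using e₁, hfp.skip fun _ => hd, e₂.1, e₂.2⟩
    · exact ⟨_, _, by simpa using e₁, hfp.step (by omega) hNk hd, e₂.1, e₂.2⟩

/-- The invariant keeps the time `τ` up to which the output is known to be feasible apart from the
arrival `a j`, to which the clock is then set: between them the processor may idle, which is
harmless because all earlier jobs are kept and complete. -/
theorem terminates_simulate {B : ℕ} {s : State}
    (hs : Scaled F m a₀ t₀ D₀ a t D) (h : Sorted I D₀ m P a₀ t₀) (hp : Plan m a t D C N y)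
    (hF : s.reg 5 = F) (hm : s.reg 6 = m) (ha : s.arr 4 = a)
    (hP : ∀ j (hj : j < m), s.arr 6 j = P ⟨j, hj⟩)
    (hN : ∀ i < m, N i = true ↔ s.arr 9 i ≠ 0) (hy : s.arr 12 = y) (hB : m ≤ B) :
    Terminates B simulateProgram (fun s' => ∃ L : List (PieceCode I),
      s'.out = s.out ++ encodePieces L ∧ (toSchedule L).Feasible ∧
      (toSchedule L).makespan ≤ (C : ℝ) / F) s := by
  have hF0 : (0 : ℝ) < F := by exact_mod_cast hs.pos
  refine .forLoop m hB (by decide) (fun s' hf => by simp [hf.reg 6 (by decide), hm])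
    (fun j s' => ∃ rem τ, Written I P F y s.out rem τ s' ∧
      (j < m → FirstPass a t m D C N y j (j + 1) (a j) rem ∧
        (τ = a j ∨ (τ ≤ a j ∧ ∀ i < j, N i = false ∧ rem i = 0))) ∧
      (j = m → τ ≤ C ∧ (∀ i < m, rem i = 0) ∧ (count N m ≠ 0 → τ = C)))
    ⟨y, 0, ⟨hy, [], by simp [encodePieces], trace_nil⟩, fun hm' => ⟨firstPass_zero hp hm',
      Or.inr ⟨Nat.zero_le _, by simp⟩⟩, fun h0 => ?_⟩ ?_ ?_
  · subst h0
    exact ⟨Nat.zero_le _, by simp, fun h0 => absurd rfl h0⟩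
  · rintro j hj s' hf hjr ⟨rem, τ, ⟨hrem, L, hout, hT⟩, h₁, -⟩
    obtain ⟨hfp, hτ⟩ := h₁ hj
    have h5 : s'.reg 5 = F := (hf.reg 5 (by decide)).trans hF
    have h4 : s'.arr 4 = a := (hf.arr 4 (by decide)).trans ha
    have h6 := hf.arr 6 (by decide)
    have h9 := hf.arr 9 (by decide)
    have hT' : Trace P F y rem L (a j) := by
      rcases hτ with rfl | ⟨hτ, hd⟩
      · exact hT
      · refine hT.idle hs h hτ fun l hl => ?_
        rcases Nat.lt_or_ge l j with hlj | hlj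
        · exact Or.inl ⟨(hd l hlj).2, hp.kept l hl (hd l hlj).1⟩
        · exact Or.inr (hp.arrival_mono hlj hl.le)
    refine .seq (.assign ?_)
    simp only [Expr.eval_get, Expr.eval_reg, hjr, h4]
    refine .seq_of (terminates_firstPass (o := s.out) hs h hp (by simpa using h5)
      (by simpa using h4) (fun j hj => by simpa [h6] using hP j hj)
      (fun i hi => by simpa [h9] using hN i hi) hB (by simpa using hjr) (by simp) hfp
      ⟨hrem, L, hout, hT'⟩) ?_
    rintro s₁ hf₁ ⟨rem₁, τ₁, hτ₁, hfp₁, hW₁⟩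
    have g30 : s₁.reg 30 = j := by rw [hf₁.reg 30 (by decide)]; simpa using hjr
    have g5 : s₁.reg 5 = F := by rw [hf₁.reg 5 (by decide)]; simpa using h5
    have g4 : s₁.arr 4 = a := by rw [hf₁.arr 4 (by decide)]; simpa using h4
    have g6 : s₁.arr 6 = s.arr 6 := by rw [hf₁.arr 6 (by decide)]; simpa using h6
    have g9 : s₁.arr 9 = s.arr 9 := by rw [hf₁.arr 9 (by decide)]; simpa using h9
    refine (terminates_secondPass (o := s.out) hs h hp g5 g4
      (fun j hj => by rw [g6]; exact hP j hj) (fun i hi => by rw [g9]; exact hN i hi) hB g30 hτ₁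
      hfp₁.toSecondPass hW₁).mono ?_
    rintro s₂ - ⟨rem₂, τ₂, -, hsp, hW₂⟩
    refine ⟨rem₂, τ₂, ⟨hW₂.1, hW₂.2⟩, fun hj' => ?_, fun hj' => hsp.final hp hj'⟩
    obtain ⟨h₁, h₂⟩ := hsp.next hp hj'
    exact ⟨h₁, h₂.imp_right fun h' => ⟨h'.1, fun i hi => h'.2 i (by omega)⟩⟩
  · rintro s' - ⟨rem, τ, ⟨-, L, hout, hT⟩, -, h₂⟩
    obtain ⟨hτ, hrem, hc⟩ := h₂ rfl
    have hCD := hp.le_deadline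
    obtain ⟨h₃, h₄⟩ := hT.final hs h fun j hj => ⟨hrem j hj, by
      cases hNj : N j with
      | false => exact Or.inl (hp.kept j hj hNj)
      | true =>
        right
        have h₁ := hp.cut j hj hNj
        have h₂ := hc (by have := count_pos hj hNj; omega)
        omega⟩
    refine ⟨L, hout, h₃, h₄.trans ?_⟩
    have : (τ : ℝ) ≤ C := by exact_mod_cast hτ
    gcongr

end Simulate

/-! ### The program that chooses the jobs to be completed -/

/-- Determines, one job after the other, whether the job has to be completed. -/
def recoverProgram : Program :=
  .forLoop 28 (.reg 6)
    (.store 9 (.reg 28) 1 ;;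
    decideProgram ;;
    .ite (.reg 23) .skip (.store 9 (.reg 28) 0 ;; .store 10 (.reg 28) 1))

/-- Computes the amounts of work for all jobs, from the set of jobs in array 9. -/
def planProgram : Program :=
  24 ::= .reg 3 - .reg 4 + 1 ;;
  18 ::= 0 ;;
  29 ::= 0 ;;
  .forLoop 30 (.reg 6)
    (18 ::= .reg 18 + (.get 4 (.reg 30) - .reg 18) + .get 5 (.reg 30) ;;
    .ite (.get 9 (.reg 30)) (29 ::= .reg 29 + .get 5 (.reg 30)) .skip) ;;
  29 ::= .reg 29 + .reg 4 - .reg 18 ;;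
  .forLoop 30 (.reg 6)
    (13 ::= .get 5 (.reg 30) ;;
    .ite (.get 9 (.reg 30))
      (13 ::= .reg 13 - .reg 24 ;;
      13 ::= .reg 13 - (.reg 13 - .reg 29) ;;
      29 ::= .reg 29 - .reg 13) .skip ;;
    .store 12 (.reg 30) (.reg 13))

def scheduleProgram : Program :=
  recoverProgram ;; planProgram ;; simulateProgram

theorem Plan.congr {m : ℕ} {a t : ℕ → ℕ} {D C : ℕ} {N : ℕ → Bool} {y y' : ℕ → ℕ}
    (h : Plan m a t D C N y) (hy : ∀ j < m, y' j = y j) : Plan m a t D C N y' := by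
  have hf : ∀ j ≤ m, finish a y' j = finish a y j := fun j hj =>
    finish_congr fun i hi => hy i (by omega)
  refine ⟨h.horizon, h.mono, h.window, h.le_deadline, h.len_pos, fun i hi => ?_, fun i hi hN => ?_,
    fun i hi hN => ?_, fun i hi hN => ?_, ?_, fun h0 => ?_, fun j hj h0 => ?_,
    fun j hj h0 hall => ?_⟩
  · rw [hy i hi]; exact h.le_len i hi
  · rw [hy i hi]; exact h.kept i hi hN
  · rw [hy i hi]; exact h.cut i hi hN
  · rw [hy i hi]
    exact (h.partial_last i hi hN).imp_right fun h' l hl hil hNl => by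
      rw [hy l hl]; exact h' l hl hil hNl
  · rw [hf m le_rfl]; exact h.finish_le
  · rw [hf m le_rfl]; exact h.finish_eq h0
  · rw [hf j hj.le]; exact h.not_idle j hj h0
  · rw [hf j hj.le]; exact h.waiting j hj h0 hall

/-- Self-reduction: the invariant is that the marks made so far extend to some valid choice. Once
every job is marked, the marks determine this choice. -/
theorem terminates_recover {B : ℕ} {s : State} (hB : s.reg 6 + 1 ≤ B) (hCD : s.reg 4 ≤ s.reg 3)
    (h₀ : ∀ i < s.reg 6, s.arr 9 i = 0 ∧ s.arr 10 i = 0)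
    (hv : ∃ N, Valid (s.reg 6) (s.arr 4) (s.arr 5) (s.reg 3) (s.reg 4) N) :
    Terminates B recoverProgram (fun s' => ∃ N,
      Valid (s.reg 6) (s.arr 4) (s.arr 5) (s.reg 3) (s.reg 4) N ∧
      ∀ i < s.reg 6, N i = true ↔ s'.arr 9 i ≠ 0) s := by
  refine .forLoop (s.reg 6) (by omega) (by decide)
    (fun s' hf => by simp [hf.reg 6 (by decide)])
    (fun i s' => (∃ N, Valid (s.reg 6) (s.arr 4) (s.arr 5) (s.reg 3) (s.reg 4) N ∧
        Consistent (s'.arr 9) (s'.arr 10) (s.reg 6) N) ∧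
      (∀ l < i, s'.arr 9 l ≠ 0 ∨ s'.arr 10 l ≠ 0) ∧
      ∀ l, i ≤ l → l < s.reg 6 → s'.arr 9 l = 0 ∧ s'.arr 10 l = 0) ?_ ?_ ?_
  · obtain ⟨N, hN⟩ := hv
    refine ⟨⟨N, hN, fun i hi => ?_⟩, by simp, fun l _ hl => by simpa using h₀ l hl⟩
    have := h₀ i hi
    simp [this]
  · rintro i hi s' hf hir ⟨⟨N, hN, hc⟩, hd, hz⟩
    have h3 := hf.reg 3 (by decide)
    have h4 := hf.reg 4 (by decide)
    have h6 := hf.reg 6 (by decide)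
    have a4 := hf.arr 4 (by decide)
    have a5 := hf.arr 5 (by decide)
    refine .seq (.store ?_)
    simp only [Expr.eval_reg, Expr.eval_one, hir]
    refine .seq_of (terminates_decide (by simpa [h6] using hB) (by simpa [h3, h4] using hCD)) ?_
    intro s₁ hf₁ h23
    have e28 : s₁.reg 28 = i := by rw [hf₁.reg 28 (by decide)]; simpa using hir
    have e9 : ∀ l, s₁.arr 9 l = if l = i then 1 else s'.arr 9 l := fun l => by
      rw [hf₁.arr 9 (by decide)]; simp
    have e10 : s₁.arr 10 = s'.arr 10 := by
      rw [hf₁.arr 10 (by decide)]; funext l; simp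
    have d4 : (s'.setArr 9 i 1).arr 4 = s.arr 4 := by funext l; simp [a4]
    have d5 : (s'.setArr 9 i 1).arr 5 = s.arr 5 := by funext l; simp [a5]
    have d9 : (s'.setArr 9 i 1).arr 9 = s₁.arr 9 := (hf₁.arr 9 (by decide)).symm
    have d10 : (s'.setArr 9 i 1).arr 10 = s₁.arr 10 := (hf₁.arr 10 (by decide)).symm
    rw [d4, d5, d9, d10] at h23
    simp only [State.setArr_reg, h3, h4, h6] at h23
    refine .ite (fun h => .skip ?_) (fun h => .seq (.store (.store ?_)))
    · refine ⟨?_, fun l hl => ?_, fun l hl hlm => ?_⟩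
      · simpa using h23.1 h
      · rcases Nat.lt_succ_iff_lt_or_eq.1 hl with hl | rfl
        · simpa [e9, hl.ne, e10] using hd l hl
        · simp [e9]
      · have : l ≠ i := by omega
        simpa [e9, e10, this] using hz l (by omega) hlm
    -- Forcing job `i` into `N` has failed, so the valid choice known from the invariant must leave
    -- it out and remains consistent with the opposite mark.
    · have hNi : N i = false := by
        by_contra hNi
        refine h23.not.1 (by simpa using h) ⟨N, hN, fun l hl => ?_⟩
        rw [e9, e10]
        by_cases hli : l = i
        · subst hli
          simpa [hNi] using (hz l le_rfl hl).2
        · simpa [hli] using hc l hl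
      simp only [Expr.eval_reg, State.setArr_reg, e28, Expr.eval_zero, Expr.eval_one]
      refine ⟨⟨N, hN, fun l hl => ?_⟩, fun l hl => ?_, fun l hl hlm => ?_⟩
      · by_cases hli : l = i
        · subst hli
          simp [hNi]
        · simpa [hli, e9, e10] using hc l hl
      · rcases Nat.lt_succ_iff_lt_or_eq.1 hl with hl | rfl
        · simpa [e9, hl.ne, e10] using hd l hl
        · simp
      · have : l ≠ i := by omega
        simpa [e9, e10, this] using hz l (by omega) hlm
  · rintro s' - ⟨⟨N, hN, hc⟩, hd, -⟩
    refine ⟨N, hN, fun i hi => ?_⟩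
    have h₁ := hc i hi
    have h₂ := hd i hi
    cases hNi : N i <;> simp only [hNi] at h₁ ⊢ <;> simp at h₁ ⊢ <;> omega

theorem terminates_plan {B : ℕ} {s : State} {N : ℕ → Bool} (hB : s.reg 6 ≤ B)
    (hN : ∀ i < s.reg 6, N i = true ↔ s.arr 9 i ≠ 0) :
    Terminates B planProgram (fun s' => ∀ j < s.reg 6, s'.arr 12 j =
      allot (s.arr 5) (s.reg 3 - s.reg 4) ((∑ i ∈ Finset.range (s.reg 6), dropped (s.arr 5) N i) +
        s.reg 4 - finish (s.arr 4) (s.arr 5) (s.reg 6)) N j) s := by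
  refine .seq (.assign (.seq (.assign (.seq (.assign (.seq_of
    (R := fun s' => s'.reg 18 = finish (s.arr 4) (s.arr 5) (s.reg 6) ∧
      s'.reg 29 = ∑ i ∈ Finset.range (s.reg 6), dropped (s.arr 5) N i) ?_ ?_))))))
  · refine .forLoop (s.reg 6) hB (by decide)
      (fun s' hf => by simp [hf.reg 6 (by decide)])
      (fun j s' => s'.reg 18 = finish (s.arr 4) (s.arr 5) j ∧
        s'.reg 29 = ∑ i ∈ Finset.range j, dropped (s.arr 5) N i)
      (by simp [finish]) ?_ (fun _ _ h => h)
    rintro j hj s' hf hjr ⟨h18, h29⟩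
    have a4 : s'.arr 4 = s.arr 4 := by rw [hf.arr 4 (by decide)]; simp
    have a5 : s'.arr 5 = s.arr 5 := by rw [hf.arr 5 (by decide)]; simp
    have a9 : s'.arr 9 = s.arr 9 := by rw [hf.arr 9 (by decide)]; simp
    have hNj := hN j hj
    have hmax : finish (s.arr 4) (s.arr 5) j + (s.arr 4 j - finish (s.arr 4) (s.arr 5) j) =
      max (finish (s.arr 4) (s.arr 5) j) (s.arr 4 j) := by omega
    refine .seq (.assign (.ite (fun h => .assign ?_) (fun h => .skip ?_)))
    · simp [hjr, a9, ← hNj] at h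
      simp [hjr, h18, h29, a4, a5, finish, Finset.sum_range_succ, dropped, h, hmax]
    · simp [hjr, a9] at h
      simp [h] at hNj
      simp [hjr, h18, h29, a4, a5, finish, Finset.sum_range_succ, dropped, hNj, hmax]
  rintro s₁ hf₁ ⟨h18, h29⟩
  have e4 : s₁.reg 4 = s.reg 4 := by rw [hf₁.reg 4 (by decide)]; simp
  have e6 : s₁.reg 6 = s.reg 6 := by rw [hf₁.reg 6 (by decide)]; simp
  have e24 : s₁.reg 24 = s.reg 3 - s.reg 4 + 1 := by rw [hf₁.reg 24 (by decide)]; simp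
  have e5 : s₁.arr 5 = s.arr 5 := by rw [hf₁.arr 5 (by decide)]; simp
  have e9 : s₁.arr 9 = s.arr 9 := by rw [hf₁.arr 9 (by decide)]; simp
  refine .seq (.assign ?_)
  simp only [Expr.eval_sub, Expr.eval_add, Expr.eval_reg, h18, h29, e4]
  set b := (∑ i ∈ Finset.range (s.reg 6), dropped (s.arr 5) N i) + s.reg 4 -
    finish (s.arr 4) (s.arr 5) (s.reg 6) with hb
  refine .forLoop (s.reg 6) hB (by decide)
    (fun s' hf => by rw [Expr.eval_reg, hf.reg 6 (by decide)]; simpa using e6)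
    (fun j s' => s'.reg 29 = budget (s.arr 5) (s.reg 3 - s.reg 4) b N j ∧
      ∀ i < j, s'.arr 12 i = allot (s.arr 5) (s.reg 3 - s.reg 4) b N i)
    (by simp [budget]) ?_ (fun _ _ h => h.2)
  rintro j hj s' hf hjr ⟨h29, h12⟩
  have f24 : s'.reg 24 = s.reg 3 - s.reg 4 + 1 := by rw [hf.reg 24 (by decide)]; simpa using e24
  have a5 : s'.arr 5 = s.arr 5 := by rw [hf.arr 5 (by decide)]; simpa using e5
  have a9 : s'.arr 9 = s.arr 9 := by rw [hf.arr 9 (by decide)]; simpa using e9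
  have hNj := hN j hj
  refine .seq (.assign (.seq_of (R := fun s'' => s''.arr = s'.arr ∧
    s''.reg 29 = budget (s.arr 5) (s.reg 3 - s.reg 4) b N (j + 1) ∧
    s''.reg 13 = allot (s.arr 5) (s.reg 3 - s.reg 4) b N j)
    (.ite (fun h => .seq (.assign (.seq (.assign (.assign ?_))))) (fun h => .skip ?_)) ?_))
  · have hmin : ∀ x z : ℕ, x - (x - z) = min z x := fun x z => by omega
    simp [hjr, a9, ← hNj] at h
    simp [hjr, h29, a5, f24, budget, allot, h, hmin]
  · simp [hjr, a9] at h
    simp [h] at hNj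
    simp [hjr, h29, a5, budget, allot, hNj]
  · rintro s₂ hf₂ ⟨g, g29, g13⟩
    have g30 : s₂.reg 30 = j := by rw [hf₂.reg 30 (by decide)]; simpa using hjr
    refine .store ⟨by simpa using g29, fun i hi => ?_⟩
    by_cases hij : i = j
    · simp [hij, g30, g13]
    · simp [hij, g30, g]
      exact h12 i (by omega)

/-- The number `g` occurs only in the proof: it certifies that the unit of time is fine enough for
`plan_of_valid`. -/
theorem terminates_schedule {I : Instance} {D₀ m : ℕ} {P : Fin m → Fin I.n} {a₀ t₀ : ℕ → ℕ}
    {g B : ℕ} {s : State} (h : Sorted I D₀ m P a₀ t₀)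
    (hs : Scaled (s.reg 5) m a₀ t₀ D₀ (s.arr 4) (s.arr 5) (s.reg 3))
    (hm : s.reg 6 = m) (hP : ∀ j (hj : j < m), s.arr 6 j = P ⟨j, hj⟩) (hB : m + 1 ≤ B)
    (hCD : s.reg 4 ≤ s.reg 3) (ham : s.arr 4 m = s.reg 4)
    (hgm : m < g) (hgF : g ∣ s.reg 5) (hgC : g ∣ s.reg 4)
    (h₀ : ∀ i < m, s.arr 9 i = 0 ∧ s.arr 10 i = 0)
    (hv : ∃ N, Valid m (s.arr 4) (s.arr 5) (s.reg 3) (s.reg 4) N) :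
    Terminates B scheduleProgram (fun s' => ∃ L : List (PieceCode I),
      s'.out = s.out ++ encodePieces L ∧ (toSchedule L).Feasible ∧
      (toSchedule L).makespan ≤ (s.reg 4 : ℝ) / s.reg 5) s := by
  subst hm
  refine .seq_of (terminates_recover hB hCD h₀ hv) ?_
  rintro s₁ hf₁ ⟨N, hN, h9⟩
  have e3 := hf₁.reg 3 (by decide)
  have e4 := hf₁.reg 4 (by decide)
  have e5 := hf₁.reg 5 (by decide)
  have e6 := hf₁.reg 6 (by decide)
  have d4 := hf₁.arr 4 (by decide)
  have d5 := hf₁.arr 5 (by decide)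
  have d6 := hf₁.arr 6 (by decide)
  refine .seq_of (terminates_plan (N := N) (by omega) (by rwa [e6])) ?_
  intro s₂ hf₂ h12
  rw [e3, e4, e6, d4, d5] at h12
  have f5 := (hf₂.reg 5 (by decide)).trans e5
  have f6 := (hf₂.reg 6 (by decide)).trans e6
  have g4 := (hf₂.arr 4 (by decide)).trans d4
  have g6 := (hf₂.arr 6 (by decide)).trans d6
  have g9 := hf₂.arr 9 (by decide)
  have hF := hs.pos
  have hp := plan_of_valid (g := g) hgm
    (fun j hj => ⟨by rw [hs.arrival j hj]; exact hgF.mul_left _,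
      by rw [hs.len j hj]; exact hgF.mul_left _⟩)
    (by rw [hs.deadline]; exact hgF.mul_left _) hgC hCD
    (fun i j hij hj => by
      rw [hs.arrival i (by omega), hs.arrival j hj]
      exact Nat.mul_le_mul_right _ (h.mono i j hij hj))
    (fun i hi => by
      rw [hs.arrival i hi, hs.len i hi, hs.deadline, ← add_mul]
      exact Nat.mul_le_mul_right _ (h.add_le hi))
    (fun i hi => by rw [hs.len i hi]; exact Nat.mul_pos (h.len_pos hi) hF) ham hN
  have ho : s₂.out = s.out := (hf₂.out rfl).trans (hf₁.out rfl)
  rw [← ho]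
  exact terminates_simulate hs h (hp.congr h12) f5 f6 g4 (by rwa [g6]) (by rwa [g9]) rfl
    (by omega)

/-! ### Valid choices and feasible schedules -/

theorem finish_congr_left {α : Type*} [Semiring α] [LinearOrder α] {a a' w : ℕ → α} {j : ℕ}
    (h : ∀ i < j, a' i = a i) : finish a' w j = finish a w j := by
  induction j with
  | zero => rfl
  | succ j ih => simp [finish, ih fun i hi => h i (by omega), h j (by omega)]

theorem lastStart_congr {α : Type*} [Semiring α] [LinearOrder α] {a a' t t' : ℕ → α} {j : ℕ}
    (ha : ∀ i < j, a' i = a i) (ht : ∀ i < j, t' i = t i) :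
    lastStart a' t' j = lastStart a t j := by
  induction j with
  | zero => rfl
  | succ j ih =>
    rw [lastStart, lastStart, ih (fun i hi => ha i (by omega)) fun i hi => ht i (by omega),
      ha j (by omega), finish_congr_left fun i hi => ha i (by omega),
      finish_congr fun i hi => ht i (by omega)]

theorem Valid.congr {α : Type*} [Semiring α] [LinearOrder α] {m : ℕ} {a a' t t' : ℕ → α} {D C : α}
    {N : ℕ → Bool} (h : Valid m a t D C N) (ha : ∀ i < m, a' i = a i) (ht : ∀ i < m, t' i = t i) :
    Valid m a' t' D C N := by
  have hf : ∀ j ≤ m, finish a' t' j = finish a t j := fun j hj => by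
    rw [finish_congr_left fun i hi => ha i (by omega), finish_congr fun i hi => ht i (by omega)]
  refine ⟨fun i hi hN => ?_, ?_, fun j hj => ?_, ?_⟩
  · rw [ht i hi]; exact h.long i hi hN
  · rw [finish_congr_left fun i hi => ha i hi,
      finish_congr (w' := keep t N) fun i hi => by simp [keep, ht i hi]]
    exact h.fits
  · rw [hf j hj.le, ha j hj]; exact h.busy j hj
  · rw [hf m le_rfl, lastStart_congr ha ht]; exact h.last

theorem Scaled.valid_iff {F m : ℕ} {a₀ t₀ : ℕ → ℕ} {D₀ : ℕ} {a t : ℕ → ℕ} {D C : ℕ}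
    {N : ℕ → Bool} (h : Scaled F m a₀ t₀ D₀ a t D) :
    Valid m a t D C N ↔
      Valid m (fun i => (a₀ i : ℝ)) (fun i => (t₀ i : ℝ)) D₀ ((C : ℝ) / F) N := by
  have hF : (0 : ℝ) < F := by exact_mod_cast h.pos
  rw [← valid_cast, ← valid_scale (a := fun i => (a₀ i : ℝ)) hF, mul_div_cancel₀ _ hF.ne',
    h.deadline, Nat.cast_mul,
    mul_comm (D₀ : ℝ)]
  have ha : ∀ i < m, (a i : ℝ) = F * a₀ i := fun i hi => by rw [h.arrival i hi]; push_cast; ring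
  have ht : ∀ i < m, (t i : ℝ) = F * t₀ i := fun i hi => by rw [h.len i hi]; push_cast; ring
  exact ⟨fun h' => h'.congr (fun i hi => (ha i hi).symm) fun i hi => (ht i hi).symm,
    fun h' => h'.congr ha ht⟩

namespace Sorted

variable {I : Instance} {D m : ℕ} {P : Fin m → Fin I.n} {a t : ℕ → ℕ}

theorem exists_valid_of_makespan_le (h : Sorted I D m P a t) {S : Schedule I} (hS : S.Feasible)
    {T : ℝ} (hT : S.makespan ≤ T) :
    ∃ N, Valid m (fun i => (a i : ℝ)) (fun i => (t i : ℝ)) D T N :=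
  (h.exists_valid hS).imp fun _ hN => hN.mono hT

/-- The schedule is taken from the output of the schedule program, run on a state made by hand; so
the construction is verified only once. Refining the unit by the factor `m + 1` supplies the divisor
`g = m + 1`. -/
theorem exists_feasible (h : Sorted I D m P a t) {F C : ℕ} (hF : 0 < F) (hC : C ≤ D * F)
    (hv : ∃ N, Valid m (fun i => (a i : ℝ)) (fun i => (t i : ℝ)) D ((C : ℝ) / F) N) :
    ∃ S : Schedule I, S.Feasible ∧ S.makespan ≤ (C : ℝ) / F := by
  let s : State :=
    { reg := fun r => if r = 3 then D * (F * (m + 1)) else if r = 4 then C * (m + 1)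
        else if r = 5 then F * (m + 1) else if r = 6 then m else 0
      arr := fun x j => if x = 4 then (if j = m then C * (m + 1) else a j * (F * (m + 1)))
        else if x = 5 then t j * (F * (m + 1))
        else if x = 6 then (if hj : j < m then P ⟨j, hj⟩ else 0) else 0
      out := [] }
  have hs : Scaled (s.reg 5) m a t D (s.arr 4) (s.arr 5) (s.reg 3) :=
    ⟨Nat.mul_pos hF (by omega), fun j hj => by simp [s, hj.ne], fun j hj => by simp [s],
      by simp [s]⟩
  have hCF : ((s.reg 4 : ℕ) : ℝ) / (s.reg 5 : ℕ) = C / F := by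
    have : (m : ℝ) + 1 ≠ 0 := by positivity
    simp only [s]
    push_cast
    exact mul_div_mul_right _ _ this
  obtain ⟨-, s', -, -, L, -, hL, hT⟩ := terminates_schedule (g := m + 1) (B := m + 1) (s := s) h hs
    rfl (fun j hj => by simp [s, hj]) le_rfl
    (by simpa [s, ← mul_assoc] using Nat.mul_le_mul_right (m + 1) hC) (by simp [s]) (by omega)
    (by simp [s]) (by simp [s]) (by simp [s])
    (by
      obtain ⟨N, hN⟩ := hv
      exact ⟨N, hs.valid_iff.2 (by rwa [hCF])⟩)
  exact ⟨_, hL, hCF ▸ hT⟩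

/-- The optimal makespan lies just above or at half of the least half-integral multiple of `1 / f`
at which there is a valid choice. -/
theorem isGLB_makespans (h : Sorted I D m P a t) {f p : ℕ} (hf0 : 0 < f)
    (hf : ∀ q, 0 < q → q ≤ m → q ∣ f) (hp : p ≤ D * (f + f))
    (hv : ∃ N, Valid m (fun i => (a i : ℝ)) (fun i => (t i : ℝ)) D ((p : ℝ) / (f + f : ℕ)) N)
    (hmin : ∀ p' < p,
      ¬ ∃ N, Valid m (fun i => (a i : ℝ)) (fun i => (t i : ℝ)) D ((p' : ℝ) / (f + f : ℕ)) N) :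
    IsGLB I.makespans (((p / 2 : ℕ) : ℝ) / f) := by
  have hfR : (0 : ℝ) < f := by exact_mod_cast hf0
  obtain ⟨k, hk⟩ : ∃ k, k = p / 2 := ⟨_, rfl⟩
  have hhalf : ∀ l : ℕ, ((l + l : ℕ) : ℝ) / (f + f : ℕ) = l / f := fun l => by
    push_cast
    rw [← two_mul, ← two_mul, mul_div_mul_left _ _ two_ne_zero]
  have hodd : ∀ l : ℕ, (f : ℝ) * (((l + l + 1 : ℕ) : ℝ) / (f + f : ℕ)) = l + 1 / 2 := fun l => by
    push_cast
    field_simp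
    ring
  rw [← hk]
  -- Even `p`: the threshold is the grid point `l / f` itself, and there is a schedule. Odd `p`: the
  -- grid point is not valid but the midpoint after it is, so every value above `l / f` is valid and
  -- the infimum is not attained.
  rcases Nat.even_or_odd' p with ⟨l, hl | hl⟩
  · obtain rfl : l = k := by omega
    rw [show p = l + l by omega] at hv hmin hp
    rw [hhalf] at hv
    constructor
    · rintro x ⟨S, hS, rfl⟩
      by_contra hx
      push Not at hx
      rcases Nat.eq_zero_or_pos l with rfl | hl0
      · simp at hx
        exact absurd S.makespan_nonneg (not_le.2 hx)
      obtain ⟨N, hN⟩ := h.exists_valid hS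
      obtain ⟨r, rfl⟩ : ∃ r, l = r + 1 := ⟨l - 1, by omega⟩
      -- A makespan below `(r + 1) / f` would make the midpoint of the preceding interval valid,
      -- against the minimality of `p`.
      refine hmin (r + r + 1) (by omega) ⟨N, hN.of_same_interval (k := r) hf hf0 ?_ ?_⟩
      · rw [lt_div_iff₀ hfR] at hx
        push_cast at hx
        linarith
      · rw [hodd]; linarith
    · intro b hb
      obtain ⟨S, hS, hT⟩ := h.exists_feasible hf0 (by nlinarith) hv
      exact (hb ⟨S, hS, rfl⟩).trans hT
  · obtain rfl : l = k := by omega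
    rw [show p = l + l + 1 by omega] at hv hmin hp
    constructor
    · rintro x ⟨S, hS, rfl⟩
      by_contra hx
      push Not at hx
      refine hmin (l + l) (by omega) ?_
      rw [hhalf]
      exact h.exists_valid_of_makespan_le hS hx.le
    · intro b hb
      by_contra hbk
      push Not at hbk
      have hlt : (l : ℝ) / f < ((l + l + 1 : ℕ) : ℝ) / (f + f : ℕ) := by
        rw [div_lt_iff₀ hfR, mul_comm, hodd]
        linarith
      -- A rational bound strictly above the grid point, below both the supposed lower bound and the
      -- midpoint; it has to be rational because schedules are constructed only for such horizons.
      obtain ⟨c, hc₁, hc₂⟩ := exists_rat_btwn (lt_min hbk hlt)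
      rw [lt_min_iff] at hc₂
      have hc0 : (0 : ℚ) ≤ c := by
        have : (0 : ℝ) ≤ (l : ℝ) / f := by positivity
        exact_mod_cast this.trans hc₁.le
      have hcast : (c : ℝ) = ((c.num.toNat : ℕ) : ℝ) / (c.den : ℕ) := by
        conv_lhs => rw [Rat.cast_def]
        congr 1
        exact_mod_cast (Int.toNat_of_nonneg (Rat.num_nonneg.2 hc0)).symm
      have hden : (0 : ℝ) < (c.den : ℕ) := by exact_mod_cast c.den_pos
      have hcD : c.num.toNat ≤ D * c.den := by
        have h₁ : ((l + l + 1 : ℕ) : ℝ) / (f + f : ℕ) ≤ D := by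
          rw [div_le_iff₀ (by push_cast; linarith)]
          exact_mod_cast hp
        have h₂ := hc₂.2.le.trans h₁
        rw [hcast, div_le_iff₀ hden] at h₂
        exact_mod_cast h₂
      obtain ⟨N, hN⟩ := hv
      have hNc := hN.of_same_interval (k := l) (C' := c) hf hf0 (by rw [hodd]; linarith)
        (by rw [div_lt_iff₀ hfR] at hc₁; linarith)
      rw [hcast] at hNc
      obtain ⟨S, hS, hT⟩ := h.exists_feasible c.den_pos hcD ⟨N, hNc⟩
      rw [← hcast] at hT
      exact absurd (hb ⟨S, hS, rfl⟩) (not_le.2 (hT.trans_lt hc₂.1))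

end Sorted

/-! ### Preparation of the input

Register 1 contains the number of jobs, register 2 the deadline and register 5 the scaling factor;
the jobs are described in array 0, from the index `o + 1` on. -/

/-- Collects the jobs that can be executed at all, and scales their times. -/
def filterProgram (o : ℕ) : Program :=
  6 ::= 0 ;;
  7 ::= .const (o + 1) ;;
  .forLoop 11 (.reg 1)
    (13 ::= .get 0 (.reg 7) ;;
    14 ::= .get 0 (.reg 7 + 1) ;;
    7 ::= .reg 7 + .const 3 ;;
    .ite (.reg 14)
      (.ite (.reg 13 + .reg 14 - .reg 2) .skip
        (8 ::= .reg 13 ;; 9 ::= .reg 5 ;; mulProgram ;; .store 1 (.reg 6) (.reg 10) ;;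
        8 ::= .reg 14 ;; 9 ::= .reg 5 ;; mulProgram ;; .store 2 (.reg 6) (.reg 10) ;;
        .store 3 (.reg 6) (.reg 11) ;;
        6 ::= .reg 6 + 1)) .skip) ;;
  8 ::= .reg 2 ;; 9 ::= .reg 5 ;; mulProgram ;; 3 ::= .reg 10

/-- Ties between arrival times are broken by the index, so distinct jobs have distinct ranks and
sorting is a permutation. -/
def rankProgram : Program :=
  15 ::= 0 ;;
  .forLoop 12 (.reg 6)
    (.ite (.get 1 (.reg 11) - .get 1 (.reg 12))
      (15 ::= .reg 15 + 1)
      (.ite (.get 1 (.reg 12) - .get 1 (.reg 11)) .skip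
        (.ite (.reg 11 - .reg 12) (15 ::= .reg 15 + 1) .skip)))

/-- Sorts the collected jobs by their arrival times. -/
def sortProgram : Program :=
  .forLoop 11 (.reg 6)
    (rankProgram ;;
    .store 4 (.reg 15) (.get 1 (.reg 11)) ;;
    .store 5 (.reg 15) (.get 2 (.reg 11)) ;;
    .store 6 (.reg 15) (.get 3 (.reg 11)))

/-- Arrays 1, 2 and 3 list the scaled arrival times, the scaled processing times and the numbers
of those among the first `i` jobs that can be executed at all. -/
structure Filtered (α τ : ℕ → ℕ) (D F i : ℕ) (s : State) : Prop where
  card_le : s.reg 6 ≤ i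
  lt : ∀ j < s.reg 6, s.arr 3 j < i
  relevant : ∀ j < s.reg 6, 0 < τ (s.arr 3 j) ∧ α (s.arr 3 j) + τ (s.arr 3 j) ≤ D
  arrival : ∀ j < s.reg 6, s.arr 1 j = α (s.arr 3 j) * F
  len : ∀ j < s.reg 6, s.arr 2 j = τ (s.arr 3 j) * F
  inj : ∀ j < s.reg 6, ∀ k < s.reg 6, s.arr 3 j = s.arr 3 k → j = k
  surj : ∀ l < i, 0 < τ l → α l + τ l ≤ D → ∃ j < s.reg 6, s.arr 3 j = l

theorem Filtered.congr {α τ : ℕ → ℕ} {D F i : ℕ} {s s' : State} (h : Filtered α τ D F i s)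
    (h6 : s'.reg 6 = s.reg 6) (h1 : s'.arr 1 = s.arr 1) (h2 : s'.arr 2 = s.arr 2)
    (h3 : s'.arr 3 = s.arr 3) : Filtered α τ D F i s' := by
  obtain ⟨e₁, e₂, e₃, e₄, e₅, e₆, e₇⟩ := h
  constructor <;> simp only [h6, h1, h2, h3] <;> assumption

theorem Filtered.skip {α τ : ℕ → ℕ} {D F i : ℕ} {s : State} (h : Filtered α τ D F i s)
    (hi : ¬ (0 < τ i ∧ α i + τ i ≤ D)) : Filtered α τ D F (i + 1) s := by
  refine ⟨h.card_le.trans (by omega), fun j hj => (h.lt j hj).trans (by omega), h.relevant,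
    h.arrival, h.len, h.inj, fun l hl h₁ h₂ => ?_⟩
  rcases Nat.lt_succ_iff_lt_or_eq.1 hl with hl | rfl
  · exact h.surj l hl h₁ h₂
  · exact absurd ⟨h₁, h₂⟩ hi

theorem Filtered.add {α τ : ℕ → ℕ} {D F i : ℕ} {s s' : State} (h : Filtered α τ D F i s)
    (hi : 0 < τ i ∧ α i + τ i ≤ D) (h6 : s'.reg 6 = s.reg 6 + 1)
    (h1 : ∀ j, s'.arr 1 j = if j = s.reg 6 then α i * F else s.arr 1 j)
    (h2 : ∀ j, s'.arr 2 j = if j = s.reg 6 then τ i * F else s.arr 2 j)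
    (h3 : ∀ j, s'.arr 3 j = if j = s.reg 6 then i else s.arr 3 j) :
    Filtered α τ D F (i + 1) s' := by
  have hc := h.card_le
  have hsplit : ∀ j < s.reg 6 + 1, j = s.reg 6 ∨ (j ≠ s.reg 6 ∧ j < s.reg 6) := by omega
  constructor <;> simp only [h6, h1, h2, h3]
  · omega
  · intro j hj
    split
    · omega
    · have := h.lt j (by omega); omega
  · intro j hj
    split
    · exact hi
    · exact h.relevant j (by omega)
  · intro j hj
    split
    · rfl
    · exact h.arrival j (by omega)
  · intro j hj
    split
    · rfl
    · exact h.len j (by omega)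
  · intro j hj k hk
    rcases hsplit j hj with hj' | ⟨hj₁, hj₂⟩ <;> rcases hsplit k hk with hk' | ⟨hk₁, hk₂⟩
    · omega
    · have := h.lt k hk₂
      simp only [hj', hk₁, if_true, if_false]; omega
    · have := h.lt j hj₂
      simp only [hk', hj₁, if_true, if_false]; omega
    · simp only [hk₁, hj₁, if_false]
      exact h.inj j hj₂ k hk₂
  · intro l hl h₁ h₂
    rcases Nat.lt_succ_iff_lt_or_eq.1 hl with hl | rfl
    · obtain ⟨j, hj, hjl⟩ := h.surj l hl h₁ h₂
      exact ⟨j, by omega, by rw [if_neg hj.ne, hjl]⟩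
    · exact ⟨s.reg 6, by omega, by simp⟩

theorem terminates_filter {B o n : ℕ} {α τ : ℕ → ℕ} {s : State} (hn : s.reg 1 = n) (hB : n ≤ B)
    (hF : (s.reg 5).size ≤ B) (hα : ∀ i < n, s.arr 0 (o + 1 + 3 * i) = α i)
    (hτ : ∀ i < n, s.arr 0 (o + 1 + 3 * i + 1) = τ i) :
    Terminates B (filterProgram o) (fun s' => Filtered α τ (s.reg 2) (s.reg 5) n s' ∧
      s'.reg 3 = s.reg 2 * s.reg 5) s := by
  refine .seq (.assign (.seq (.assign (.seq_of (R := Filtered α τ (s.reg 2) (s.reg 5) n) ?_ ?_))))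
  · refine .forLoop n hB (by decide) (fun s' hf => by simp [hf.reg 1 (by decide), hn])
      (fun i s' => Filtered α τ (s.reg 2) (s.reg 5) i s' ∧ s'.reg 7 = o + 1 + 3 * i)
      ⟨?_, by simp⟩ ?_ (fun _ _ h => h.1)
    · constructor <;> simp
    rintro i hi s' hf hir ⟨h, h7⟩
    have h2 : s'.reg 2 = s.reg 2 := by rw [hf.reg 2 (by decide)]; simp
    have h5 : s'.reg 5 = s.reg 5 := by rw [hf.reg 5 (by decide)]; simp
    have h0 : s'.arr 0 = s.arr 0 := by rw [hf.arr 0 (by decide)]; simp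
    refine .seq (.assign (.seq (.assign (.seq (.assign ?_)))))
    simp only [Expr.eval_get, Expr.eval_reg, Expr.eval_add, Expr.eval_one, Expr.eval_const,
      State.setReg_reg, State.setReg_arr, h7, h0, hα i hi, hτ i hi, Nat.reduceEqDiff, reduceIte]
    set s₁ := ((s'.setReg 13 (α i)).setReg 14 (τ i)).setReg 7 (o + 1 + 3 * i + 3) with hs₁
    have g6 : s₁.reg 6 = s'.reg 6 := by simp [hs₁]
    have g7 : s₁.reg 7 = o + 1 + 3 * i + 3 := by simp [hs₁]
    have g11 : s₁.reg 11 = i := by simpa [hs₁] using hir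
    have g13 : s₁.reg 13 = α i := by simp [hs₁]
    have g14 : s₁.reg 14 = τ i := by simp [hs₁]
    have g2 : s₁.reg 2 = s.reg 2 := by simp [hs₁, h2]
    have g5 : s₁.reg 5 = s.reg 5 := by simp [hs₁, h5]
    have ga : s₁.arr = s'.arr := rfl
    clear_value s₁
    have hskip : ¬ (0 < τ i ∧ α i + τ i ≤ s.reg 2) →
        Filtered α τ (s.reg 2) (s.reg 5) (i + 1) (s₁.setReg 11 (i + 1)) ∧
          (s₁.setReg 11 (i + 1)).reg 7 = o + 1 + 3 * (i + 1) := fun hno =>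
      ⟨(h.skip hno).congr (by simpa using g6) (by simp [ga]) (by simp [ga]) (by simp [ga]),
        by simp [g7]; ring⟩
    refine .ite (fun e₁ => .ite (fun e₂ => .skip (hskip ?_)) (fun e₂ => ?_))
      (fun e₁ => .skip (hskip ?_))
    · simp [g13, g14, g2] at e₁ e₂; omega
    · simp [g13, g14, g2] at e₁ e₂
      refine .seq (.assign (.seq (.assign ?_)))
      refine .seq (terminates_mul (by simpa [g5] using hF) fun s₂ f₂ m₂ => ?_)
      refine .seq (.store (.seq (.assign (.seq (.assign ?_)))))
      have k5 : s₂.reg 5 = s.reg 5 := by rw [f₂.reg 5 (by decide)]; simpa using g5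
      have k6 : s₂.reg 6 = s'.reg 6 := by rw [f₂.reg 6 (by decide)]; simpa using g6
      have k7 : s₂.reg 7 = o + 1 + 3 * i + 3 := by rw [f₂.reg 7 (by decide)]; simpa using g7
      have k11 : s₂.reg 11 = i := by rw [f₂.reg 11 (by decide)]; simpa using g11
      have k14 : s₂.reg 14 = τ i := by rw [f₂.reg 14 (by decide)]; simpa using g14
      have ka : s₂.arr = s'.arr := by
        funext x; rw [f₂.arr x (by simp [mulProgram, Program.arrs])]; simp [ga]
      have k10 : s₂.reg 10 = α i * s.reg 5 := by simpa [g13, g5] using m₂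
      refine .seq (terminates_mul (by simpa [k5] using hF) fun s₃ f₃ m₃ => ?_)
      refine .seq (.store (.seq (.store (.assign ?_))))
      have l6 : s₃.reg 6 = s'.reg 6 := by rw [f₃.reg 6 (by decide)]; simpa using k6
      have l7 : s₃.reg 7 = o + 1 + 3 * i + 3 := by rw [f₃.reg 7 (by decide)]; simpa using k7
      have l11 : s₃.reg 11 = i := by rw [f₃.reg 11 (by decide)]; simpa using k11
      have la : s₃.arr = (s₂.setArr 1 (s'.reg 6) (α i * s.reg 5)).arr := by
        funext x; rw [f₃.arr x (by simp [mulProgram, Program.arrs])]; simp [k6, k10]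
      have l10 : s₃.reg 10 = τ i * s.reg 5 := by simpa [k14, k5] using m₃
      refine ⟨h.add (by omega) (by simp [l6]) (fun j => ?_) (fun j => ?_) (fun j => ?_),
        by simp [l7]; ring⟩
      · simp [la, ka]
      · simp [la, ka, l6, l10]
      · simp [la, ka, l6, l11]
    · simp [g14] at e₁; omega
  · intro s₁ f₁ h
    have e2 : s₁.reg 2 = s.reg 2 := by rw [f₁.reg 2 (by decide)]; simp
    have e5 : s₁.reg 5 = s.reg 5 := by rw [f₁.reg 5 (by decide)]; simp
    refine .seq (.assign (.seq (.assign (.seq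
      (terminates_mul (by simpa [e5] using hF) fun s₂ f₂ m₂ => .assign ?_)))))
    have ha : ∀ x, s₂.arr x = s₁.arr x := fun x => by
      rw [f₂.arr x (by simp [mulProgram, Program.arrs])]; simp
    refine ⟨h.congr ?_ (by simp [ha]) (by simp [ha]) (by simp [ha]), ?_⟩
    · simp [f₂.reg 6 (by decide)]
    · simpa [e2, e5] using m₂

/-- The position of `k` in the order by the values of `A`. -/
def rank (A : ℕ → ℕ) (m k : ℕ) : ℕ :=
  ((Finset.range m).filter fun l => A l < A k ∨ A l = A k ∧ l < k).card

theorem rank_lt_rank {A : ℕ → ℕ} {m l k : ℕ} (hl : l < m) (h : A l < A k ∨ A l = A k ∧ l < k) :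
    rank A m l < rank A m k := by
  refine Finset.card_lt_card ⟨fun x hx => ?_, fun hsub => ?_⟩
  · simp only [Finset.mem_filter, Finset.mem_range] at hx ⊢
    exact ⟨hx.1, by omega⟩
  · have := hsub (show l ∈ _ by simpa using ⟨hl, h⟩)
    simp at this

theorem rank_lt {A : ℕ → ℕ} {m k : ℕ} (hk : k < m) : rank A m k < m := by
  have : ((Finset.range m).filter fun l => A l < A k ∨ A l = A k ∧ l < k) ⊂ Finset.range m :=
    ⟨Finset.filter_subset _ _, fun hsub => by
      have := hsub (show k ∈ _ by simpa using hk)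
      simp at this⟩
  simpa [rank] using Finset.card_lt_card this

theorem rank_inj {A : ℕ → ℕ} {m l k : ℕ} (hl : l < m) (hk : k < m) (h : rank A m l = rank A m k) :
    l = k := by
  by_contra hne
  rcases (by omega : (A l < A k ∨ A l = A k ∧ l < k) ∨ (A k < A l ∨ A k = A l ∧ k < l)) with h' | h'
  · have := rank_lt_rank hl h'; omega
  · have := rank_lt_rank hk h'; omega

theorem exists_rank_eq (A : ℕ → ℕ) {m j : ℕ} (hj : j < m) : ∃ k < m, rank A m k = j := by
  have hinj : Function.Injective fun k : Fin m => (⟨rank A m k, rank_lt k.2⟩ : Fin m) :=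
    fun k l h => Fin.ext (rank_inj k.2 l.2 (by simpa using h))
  obtain ⟨k, hk⟩ := Finite.surjective_of_injective hinj ⟨j, hj⟩
  exact ⟨k, k.2, by simpa using hk⟩

theorem terminates_rank {B : ℕ} {s : State} (hB : s.reg 6 ≤ B) :
    Terminates B rankProgram (fun s' => s'.reg 15 = rank (s.arr 1) (s.reg 6) (s.reg 11)) s := by
  refine .seq (.assign ?_)
  refine .forLoop (s.reg 6) hB (by decide) (fun s' hf => by simp [hf.reg 6 (by decide)])
    (fun i s' => s'.reg 15 = ((Finset.range i).filter fun l => s.arr 1 l < s.arr 1 (s.reg 11) ∨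
      s.arr 1 l = s.arr 1 (s.reg 11) ∧ l < s.reg 11).card) (by simp) ?_ (fun _ _ h => h)
  intro i hi s' hf hir h
  have h11 : s'.reg 11 = s.reg 11 := by rw [hf.reg 11 (by decide)]; simp
  have a1 : s'.arr 1 = s.arr 1 := by rw [hf.arr 1 (by decide)]; simp
  rw [Finset.range_add_one]
  refine .ite (fun h₁ => .assign ?_) (fun h₁ => .ite (fun h₂ => .skip ?_)
    (fun h₂ => .ite (fun h₃ => .assign ?_) (fun h₃ => .skip ?_)))
  all_goals
    simp only [Expr.eval_get, Expr.eval_reg, Expr.eval_sub, Expr.eval_add, Expr.eval_one, h11, a1,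
      hir, State.setReg_reg, Nat.reduceEqDiff, reduceIte, h] at *
  · rw [Finset.filter_insert, if_pos (by omega), Finset.card_insert_of_notMem (by simp)]
  · rw [Finset.filter_insert, if_neg (by omega)]
  · rw [Finset.filter_insert, if_pos (by omega), Finset.card_insert_of_notMem (by simp)]
  · rw [Finset.filter_insert, if_neg (by omega)]

theorem terminates_sort {B : ℕ} {s : State} (hB : s.reg 6 ≤ B) :
    Terminates B sortProgram (fun s' => ∀ k < s.reg 6,
      s'.arr 4 (rank (s.arr 1) (s.reg 6) k) = s.arr 1 k ∧
      s'.arr 5 (rank (s.arr 1) (s.reg 6) k) = s.arr 2 k ∧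
      s'.arr 6 (rank (s.arr 1) (s.reg 6) k) = s.arr 3 k) s := by
  refine .forLoop (s.reg 6) hB (by decide) (fun s' hf => by simp [hf.reg 6 (by decide)])
    (fun i s' => ∀ k < i, s'.arr 4 (rank (s.arr 1) (s.reg 6) k) = s.arr 1 k ∧
      s'.arr 5 (rank (s.arr 1) (s.reg 6) k) = s.arr 2 k ∧
      s'.arr 6 (rank (s.arr 1) (s.reg 6) k) = s.arr 3 k) (by simp) ?_ (fun _ _ h => h)
  intro i hi s' hf hir h
  have h6 := hf.reg 6 (by decide)
  have a1 := hf.arr 1 (by decide)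
  have a2 := hf.arr 2 (by decide)
  have a3 := hf.arr 3 (by decide)
  refine .seq_of (terminates_rank (by omega)) ?_
  intro s₁ f₁ h15
  rw [a1, h6, hir] at h15
  have e11 : s₁.reg 11 = i := (f₁.reg 11 (by decide)).trans hir
  have ea : ∀ x, s₁.arr x = s'.arr x := fun x =>
    f₁.arr x (by simp [rankProgram, Program.forLoop, Program.arrs])
  refine .seq (.store (.seq (.store (.store ?_))))
  intro k hk
  rcases Nat.lt_succ_iff_lt_or_eq.1 hk with hk | rfl
  · have hne : rank (s.arr 1) (s.reg 6) k ≠ rank (s.arr 1) (s.reg 6) i := fun he =>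
      hk.ne (rank_inj (by omega) hi he)
    simpa [h15, hne, ea] using h k hk
  · simp [h15, e11, ea, a1, a2, a3]

theorem Filtered.sorted {I : Instance} {D F : ℕ} {α τ : ℕ → ℕ} {s s' : State}
    (h : Filtered α τ D F I.n s) (hα : ∀ i : Fin I.n, α i = I.arrival i)
    (hτ : ∀ i : Fin I.n, τ i = I.len i) (hD : ∀ i, I.deadline i = D) (hF : 0 < F)
    (hs : ∀ k < s.reg 6, s'.arr 4 (rank (s.arr 1) (s.reg 6) k) = s.arr 1 k ∧
      s'.arr 5 (rank (s.arr 1) (s.reg 6) k) = s.arr 2 k ∧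
      s'.arr 6 (rank (s.arr 1) (s.reg 6) k) = s.arr 3 k) :
    ∃ (P : Fin (s.reg 6) → Fin I.n) (a₀ t₀ : ℕ → ℕ), Sorted I D (s.reg 6) P a₀ t₀ ∧
      Scaled F (s.reg 6) a₀ t₀ D (s'.arr 4) (s'.arr 5) (D * F) ∧
      ∀ j (hj : j < s.reg 6), s'.arr 6 j = P ⟨j, hj⟩ := by
  have hlt : ∀ j < s.reg 6, s'.arr 6 j < I.n := fun j hj => by
    obtain ⟨k, hk, rfl⟩ := exists_rank_eq (s.arr 1) hj
    rw [(hs k hk).2.2]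
    exact h.lt k hk
  have ha : ∀ j < s.reg 6, s'.arr 4 j = α (s'.arr 6 j) * F := fun j hj => by
    obtain ⟨k, hk, rfl⟩ := exists_rank_eq (s.arr 1) hj
    rw [(hs k hk).1, (hs k hk).2.2]
    exact h.arrival k hk
  have ht : ∀ j < s.reg 6, s'.arr 5 j = τ (s'.arr 6 j) * F := fun j hj => by
    obtain ⟨k, hk, rfl⟩ := exists_rank_eq (s.arr 1) hj
    rw [(hs k hk).2.1, (hs k hk).2.2]
    exact h.len k hk
  refine ⟨fun j => ⟨s'.arr 6 j, hlt j j.2⟩, fun j => α (s'.arr 6 j), fun j => τ (s'.arr 6 j),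
    ⟨fun j k hjk => ?_, fun i => ?_, fun j => ?_, fun j => ?_, fun j k hjk hk => ?_, hD⟩,
    ⟨hF, ha, ht, rfl⟩, fun _ _ => rfl⟩
  · obtain ⟨k₁, hk₁, e₁⟩ := exists_rank_eq (s.arr 1) j.2
    obtain ⟨k₂, hk₂, e₂⟩ := exists_rank_eq (s.arr 1) k.2
    simp only [Fin.mk.injEq] at hjk
    rw [← e₁, ← e₂, (hs k₁ hk₁).2.2, (hs k₂ hk₂).2.2] at hjk
    have := h.inj k₁ hk₁ k₂ hk₂ hjk
    exact Fin.ext (by rw [← e₁, ← e₂, this])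
  · rw [← hα, ← hτ]
    constructor
    · rintro ⟨⟨j, hj⟩, rfl⟩
      obtain ⟨k, hk, rfl⟩ := exists_rank_eq (s.arr 1) hj
      simp only [(hs k hk).2.2]
      exact h.relevant k hk
    · rintro ⟨h₁, h₂⟩
      obtain ⟨k, hk, hki⟩ := h.surj i i.2 h₁ h₂
      exact ⟨⟨rank (s.arr 1) (s.reg 6) k, rank_lt hk⟩, Fin.ext (by simp [(hs k hk).2.2, hki])⟩
  · exact hα ⟨s'.arr 6 j, hlt j j.2⟩
  · exact hτ ⟨s'.arr 6 j, hlt j j.2⟩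
  · have hj : j < s.reg 6 := by omega
    refine Nat.le_of_mul_le_mul_right ?_ hF
    rw [← ha j hj, ← ha k hk]
    obtain ⟨k₁, hk₁, e₁⟩ := exists_rank_eq (s.arr 1) hj
    obtain ⟨k₂, hk₂, e₂⟩ := exists_rank_eq (s.arr 1) hk
    rw [← e₁, ← e₂, (hs k₁ hk₁).1, (hs k₂ hk₂).1]
    by_contra hlt
    have := rank_lt_rank hk₂ (Or.inl (not_le.1 hlt))
    omega

/-! ### The encoding of an instance -/

theorem getElem?_flatMap {β γ : Type*} {k : ℕ} (f : β → List γ) (l : List β)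
    (hf : ∀ x ∈ l, (f x).length = k) {r : ℕ} (hr : r < k) (i : ℕ) :
    (l.flatMap f)[k * i + r]? = l[i]?.bind fun x => (f x)[r]? := by
  induction l generalizing i with
  | nil => simp
  | cons x l ih =>
    have hx := hf x (by simp)
    rw [List.flatMap_cons]
    cases i with
    | zero => rw [List.getElem?_append_left (by omega)]; simp
    | succ i =>
      rw [List.getElem?_append_right (by rw [hx, Nat.mul_succ]; omega), hx,
        show k * (i + 1) + r - k = k * i + r by rw [Nat.mul_succ]; omega,
        ih fun y hy => hf y (by simp [hy])]
      simp

theorem Instance.encode_getElem? (I : Instance) (i : Fin I.n) {r : ℕ} (hr : r < 3) :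
    I.encode[1 + 3 * i + r]? = [I.arrival i, I.len i, I.deadline i][r]? := by
  rw [Instance.encode, show 1 + 3 * (i : ℕ) + r = (3 * i + r) + 1 by omega,
    List.getElem?_cons_succ, getElem?_flatMap (k := 3) _ _ (by simp) hr]
  simp

theorem Instance.encode_getD (I : Instance) (i : Fin I.n) (l : List ℕ) :
    (l ++ I.encode).getD (l.length + 1 + 3 * i) 0 = I.arrival i ∧
    (l ++ I.encode).getD (l.length + 1 + 3 * i + 1) 0 = I.len i ∧
    (l ++ I.encode).getD (l.length + 1 + 3 * i + 2) 0 = I.deadline i := by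
  have key : ∀ r < 3, (l ++ I.encode)[l.length + 1 + 3 * i + r]? =
      [I.arrival i, I.len i, I.deadline i][r]? := fun r hr => by
    rw [List.getElem?_append_right (by omega), ← I.encode_getElem? i hr]
    congr 1
    omega
  have h₀ := key 0 (by omega)
  have h₁ := key 1 (by omega)
  have h₂ := key 2 (by omega)
  rw [Nat.add_zero] at h₀
  simp only [List.getD_eq_getElem?_getD, h₀, h₁, h₂]
  simp

/-! ### Bit lengths -/

theorem size_add_one_le_inputSize {l : List ℕ} {x : ℕ} (h : x ∈ l) :
    Nat.size x + 1 ≤ inputSize l :=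
  List.single_le_sum (by simp) _ (List.mem_map.2 ⟨x, h, rfl⟩)

theorem size_getD_le_inputSize (l : List ℕ) (i : ℕ) : (l.getD i 0).size ≤ inputSize l := by
  rw [List.getD_eq_getElem?_getD]
  cases h : l[i]? with
  | none => simp
  | some x =>
    have := size_add_one_le_inputSize (List.mem_of_getElem? h)
    simp only [Option.getD_some]
    omega

theorem length_le_inputSize (l : List ℕ) : l.length ≤ inputSize l := by
  induction l with
  | nil => simp
  | cons x l ih =>
    simp only [inputSize, List.map_cons, List.sum_cons, List.length_cons] at ih ⊢
    omega

theorem Instance.add_one_le_inputSize (I : Instance) (l : List ℕ) :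
    I.n + 1 ≤ inputSize (l ++ I.encode) := by
  have h := length_le_inputSize (l ++ I.encode)
  have : I.encode.length = 1 + I.n * 3 := by
    simp [Instance.encode, List.length_flatMap, Nat.add_comm]
  rw [List.length_append, this] at h
  omega

theorem size_mul_le (x y : ℕ) : (x * y).size ≤ x.size + y.size := by
  rw [Nat.size_le, pow_add]
  exact Nat.mul_lt_mul'' (Nat.lt_size_self _) (Nat.lt_size_self _)

theorem size_le_self (x : ℕ) : x.size ≤ x := Nat.size_le.2 Nat.lt_two_pow_self

/-- The scaling factor is exponentially large, but its bit length, which bounds the rounds of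
multiplication and bisection, is only quadratic. -/
theorem size_factorial_le (n : ℕ) : (n.factorial).size ≤ n * n + 1 := by
  rw [Nat.size_le, pow_succ]
  calc n.factorial ≤ n ^ n := Nat.factorial_le_pow n
    _ ≤ (2 ^ n) ^ n := Nat.pow_le_pow_left Nat.lt_two_pow_self.le n
    _ = 2 ^ (n * n) := (pow_mul _ _ _).symm
    _ < 2 ^ (n * n) * 2 := by have := Nat.two_pow_pos (n * n); omega

/-! ### Preparation of an instance -/

/-- Reads the number of jobs and the deadline. -/
def readProgram (o : ℕ) : Program :=
  1 ::= .get 0 (.const o) ;; 2 ::= .get 0 (.const (o + 3))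

def prepareProgram (o : ℕ) : Program := filterProgram o ;; sortProgram

/-- The state contains the jobs of `I` that can be executed, in the order of arrival and with times
in units of `1 / F`, where `F` is in register 5. -/
structure Prepared (I : Instance) {m : ℕ} (D₀ : ℕ) (P : Fin m → Fin I.n) (a₀ t₀ : ℕ → ℕ)
    (s : State) : Prop where
  sorted : Sorted I D₀ m P a₀ t₀
  scaled : Scaled (s.reg 5) m a₀ t₀ D₀ (s.arr 4) (s.arr 5) (s.reg 3)
  card : s.reg 6 = m
  card_le : m ≤ I.n
  jobs : ∀ j (hj : j < m), s.arr 6 j = P ⟨j, hj⟩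

theorem Prepared.congr {I : Instance} {m D₀ : ℕ} {P : Fin m → Fin I.n} {a₀ t₀ : ℕ → ℕ}
    {s s' : State} (h : Prepared I D₀ P a₀ t₀ s) (h3 : s'.reg 3 = s.reg 3)
    (h5 : s'.reg 5 = s.reg 5) (h6 : s'.reg 6 = s.reg 6) (h4 : ∀ j < m, s'.arr 4 j = s.arr 4 j)
    (ha5 : s'.arr 5 = s.arr 5) (ha6 : s'.arr 6 = s.arr 6) : Prepared I D₀ P a₀ t₀ s' := by
  obtain ⟨e₁, e₂, e₃, e₄, e₅⟩ := h
  refine ⟨e₁, ⟨by rw [h5]; exact e₂.pos, fun j hj => ?_, fun j hj => ?_, ?_⟩, by rw [h6, e₃], e₄,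
    fun j hj => by rw [ha6]; exact e₅ j hj⟩
  · rw [h4 j hj, h5]; exact e₂.arrival j hj
  · rw [ha5, h5]; exact e₂.len j hj
  · rw [h3, h5]; exact e₂.deadline

theorem terminates_prepare {B : ℕ} {I : Instance} {l : List ℕ} {s : State}
    (h0 : s.arr 0 = fun j => (l ++ I.encode).getD j 0) (h1 : s.reg 1 = I.n)
    (h2 : ∀ i, I.deadline i = s.reg 2) (hF : 0 < s.reg 5) (hFB : (s.reg 5).size ≤ B)
    (hB : I.n ≤ B) :
    Terminates B (prepareProgram l.length) (fun s' => ∃ (m : ℕ) (P : Fin m → Fin I.n)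
      (a₀ t₀ : ℕ → ℕ), Prepared I (s.reg 2) P a₀ t₀ s') s := by
  have hc := I.encode_getD
  refine .seq_of (terminates_filter (n := I.n) h1 hB hFB
    (α := fun i => s.arr 0 (l.length + 1 + 3 * i))
    (τ := fun i => s.arr 0 (l.length + 1 + 3 * i + 1)) (fun _ _ => rfl) (fun _ _ => rfl)) ?_
  rintro s₁ f₁ ⟨hfil, h3⟩
  have hcard := hfil.card_le
  refine (terminates_sort (by omega)).mono ?_
  intro s₂ f₂ hs
  obtain ⟨P, a₀, t₀, hP, hsc, h6⟩ := hfil.sorted (fun i => by rw [h0]; exact (hc i l).1)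
    (fun i => by rw [h0]; exact (hc i l).2.1) h2 hF hs
  have e5 : s₂.reg 5 = s.reg 5 := (f₂.reg 5 (by decide)).trans (f₁.reg 5 (by
    simp [filterProgram, mulProgram, Program.forLoop, Program.regs]))
  refine ⟨s₁.reg 6, P, a₀, t₀, hP, ?_, f₂.reg 6 (by decide), hcard, h6⟩
  rw [e5, f₂.reg 3 (by decide), h3]
  exact hsc

theorem terminates_read {B : ℕ} {I : Instance} {l : List ℕ} {s : State} (hI : I.CommonDeadline)
    (h0 : s.arr 0 = fun j => (l ++ I.encode).getD j 0) :
    Terminates B (readProgram l.length) (fun s' => s'.reg 1 = I.n ∧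
      (s'.reg 2).size ≤ inputSize (l ++ I.encode) ∧ ∀ i, I.deadline i = s'.reg 2) s := by
  refine .seq (.assign (.assign ⟨?_, ?_, fun i => ?_⟩))
  · simp [h0, Instance.encode]
  · simp only [Expr.eval_get, State.setReg_reg, State.setReg_arr, h0, if_true]
    exact size_getD_le_inputSize _ _
  · obtain ⟨D, hD⟩ := hI
    have := (I.encode_getD ⟨0, by have := i.2; omega⟩ l).2.2
    simp only [Nat.mul_zero, Nat.add_zero, Nat.add_assoc, Nat.reduceAdd] at this
    simp only [Expr.eval_get, State.setReg_reg, State.setReg_arr, h0, if_true, Expr.eval_const,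
      this, hD]

theorem Prepared.valid_iff {I : Instance} {m D₀ : ℕ} {P : Fin m → Fin I.n} {a₀ t₀ : ℕ → ℕ}
    {s : State} (h : Prepared I D₀ P a₀ t₀ s) {C : ℕ} :
    (∃ N, Valid m (s.arr 4) (s.arr 5) (s.reg 3) C N) ↔
      ∃ N, Valid m (fun i => (a₀ i : ℝ)) (fun i => (t₀ i : ℝ)) D₀ ((C : ℝ) / s.reg 5) N :=
  exists_congr fun _ => h.scaled.valid_iff

theorem Prepared.valid_mono {I : Instance} {m D₀ : ℕ} {P : Fin m → Fin I.n} {a₀ t₀ : ℕ → ℕ}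
    {s : State} (h : Prepared I D₀ P a₀ t₀ s) {C C' : ℕ} (hC : C ≤ C')
    (hv : ∃ N, Valid m (s.arr 4) (s.arr 5) (s.reg 3) C N) :
    ∃ N, Valid m (s.arr 4) (s.arr 5) (s.reg 3) C' N := by
  rw [h.valid_iff] at hv ⊢
  exact hv.imp fun N hN => hN.mono (by gcongr)

theorem Prepared.valid_deadline {I : Instance} {m D₀ : ℕ} {P : Fin m → Fin I.n} {a₀ t₀ : ℕ → ℕ}
    {s : State} (h : Prepared I D₀ P a₀ t₀ s) :
    ∃ N, Valid m (s.arr 4) (s.arr 5) (s.reg 3) (s.reg 3) N := by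
  obtain ⟨N, hN⟩ := exists_valid_deadline h.sorted.mono (fun i hi => h.sorted.add_le hi)
    fun i hi => h.sorted.len_pos hi
  have hF : (s.reg 5 : ℝ) ≠ 0 := by exact_mod_cast h.scaled.pos.ne'
  refine h.valid_iff.2 ⟨N, ?_⟩
  rw [h.scaled.deadline, Nat.cast_mul, mul_div_cancel_right₀ _ hF]
  exact valid_cast.2 hN

theorem terminates_decide_valid {B m : ℕ} {s : State} (hm : s.reg 6 = m) (hB : m + 1 ≤ B)
    (hCD : s.reg 4 ≤ s.reg 3) (h9 : ∀ i < m, s.arr 9 i = 0) (h10 : ∀ i < m, s.arr 10 i = 0) :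
    Terminates B decideProgram (fun s' => s'.reg 23 ≠ 0 ↔
      ∃ N, Valid m (s.arr 4) (s.arr 5) (s.reg 3) (s.reg 4) N) s := by
  subst hm
  refine (terminates_decide hB hCD).mono fun s' _ h => h.trans (exists_congr fun N => ?_)
  exact and_iff_left fun i hi => by simp [h9 i hi, h10 i hi]

/-! ### Computing the optimal makespan -/

/-- Register 5 := the factorial of register 1. -/
def factorialProgram : Program :=
  5 ::= 1 ;;
  .forLoop 11 (.reg 1) (8 ::= .reg 5 ;; 9 ::= .reg 11 + 1 ;; mulProgram ;; 5 ::= .reg 10)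

/-- Register 27 := the least number, up to register 3, for which there is a valid choice. -/
def bisectProgram : Program :=
  26 ::= 0 ;;
  27 ::= .reg 3 ;;
  .loop (.reg 27 - .reg 26)
    (4 ::= .half (.reg 26 + .reg 27) ;;
    decideProgram ;;
    .ite (.reg 23) (27 ::= .reg 4) (26 ::= .reg 4 + 1))

/-- The grid is `1 / f` with `f = n!`, kept in register 36; the unit of time in register 5 is half
of it, so that midpoints are integers. The factorial of `n` is used because the number `m ≤ n` of
relevant jobs is not known before filtering. Halving the threshold rounds a midpoint down to its
grid point. -/
def optimumProgram : Program :=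
  readProgram 0 ;;
  factorialProgram ;;
  36 ::= .reg 5 ;;
  5 ::= .reg 5 + .reg 5 ;;
  prepareProgram 0 ;;
  bisectProgram ;;
  .emit (.half (.reg 27)) ;;
  .emit (.reg 36)

theorem terminates_factorial {B n : ℕ} {s : State} (hn : s.reg 1 = n) (hB : n ≤ B) :
    Terminates B factorialProgram (fun s' => s'.reg 5 = n.factorial) s := by
  refine .seq (.assign (.forLoop n hB (by decide)
    (fun s' hf => by simp [hf.reg 1 (by decide), hn]) (fun i s' => s'.reg 5 = i.factorial)
    (by simp) ?_ (fun _ _ h => h)))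
  intro i hi s' _ hir h
  refine .seq (.assign (.seq (.assign (.seq (terminates_mul ?_ fun s₁ _ hm => .assign ?_)))))
  · have := size_le_self (i + 1)
    simp [hir]
    omega
  · simp [hir, h] at hm
    simp [hm, Nat.factorial_succ, mul_comm]

/-- The right end is always valid and everything before the left end is not. The gap is less than `2
^ k` with `k` rounds left, so the number of rounds is the bit length of the scaled deadline. -/
theorem terminates_bisect {B m : ℕ} {s : State} (hm : s.reg 6 = m) (hB : m + 1 ≤ B)
    (hsize : (s.reg 3).size ≤ B) (h9 : ∀ i < m, s.arr 9 i = 0) (h10 : ∀ i < m, s.arr 10 i = 0)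
    (hmono : ∀ C C', C ≤ C' → (∃ N, Valid m (s.arr 4) (s.arr 5) (s.reg 3) C N) →
      ∃ N, Valid m (s.arr 4) (s.arr 5) (s.reg 3) C' N)
    (hD : ∃ N, Valid m (s.arr 4) (s.arr 5) (s.reg 3) (s.reg 3) N) :
    Terminates B bisectProgram (fun s' => s'.reg 27 ≤ s.reg 3 ∧
      (∃ N, Valid m (s.arr 4) (s.arr 5) (s.reg 3) (s'.reg 27) N) ∧
      ∀ C < s'.reg 27, ¬ ∃ N, Valid m (s.arr 4) (s.arr 5) (s.reg 3) C N) s := by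
  refine .seq (.assign (.seq (.assign ?_)))
  refine .loop (fun k s' => s'.reg 27 - s'.reg 26 < 2 ^ k ∧ s'.reg 26 ≤ s'.reg 27 ∧
    s'.reg 27 ≤ s.reg 3 ∧ (∃ N, Valid m (s.arr 4) (s.arr 5) (s.reg 3) (s'.reg 27) N) ∧
    ∀ C < s'.reg 26, ¬ ∃ N, Valid m (s.arr 4) (s.arr 5) (s.reg 3) C N) hsize
    ⟨by simpa using Nat.lt_size_self _, by simp, by simp, by simpa using hD, by simp⟩ ?_ ?_
  · rintro k s' hf ⟨hk, hle, h27, hv, hno⟩ hne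
    simp only [Expr.eval_sub, Expr.eval_reg] at hne
    obtain ⟨k, rfl⟩ : ∃ l, k = l + 1 := by
      cases k with
      | zero => simp at hk; omega
      | succ l => exact ⟨l, rfl⟩
    rw [pow_succ] at hk
    have h3 : s'.reg 3 = s.reg 3 := by rw [hf.reg 3 (by decide)]; simp
    have h6 : s'.reg 6 = m := by rw [hf.reg 6 (by decide)]; simpa using hm
    have a4 : s'.arr 4 = s.arr 4 := by rw [hf.arr 4 (by decide)]; simp
    have a5 : s'.arr 5 = s.arr 5 := by rw [hf.arr 5 (by decide)]; simp
    have a9 : s'.arr 9 = s.arr 9 := by rw [hf.arr 9 (by decide)]; simp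
    have a10 : s'.arr 10 = s.arr 10 := by rw [hf.arr 10 (by decide)]; simp
    obtain ⟨c, hc⟩ : ∃ c, c = (s'.reg 26 + s'.reg 27) / 2 := ⟨_, rfl⟩
    refine ⟨k, rfl, .seq (.assign ?_)⟩
    simp only [Expr.eval_half, Expr.eval_add, Expr.eval_reg, ← hc]
    refine .seq_of (terminates_decide_valid (m := m) (by simpa using h6) hB
      (by simp [h3]; omega) (by simpa [a9] using h9) (by simpa [a10] using h10)) ?_
    intro s₁ f₁ h23
    have e4 : s₁.reg 4 = c := by rw [f₁.reg 4 (by decide)]; simp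
    have e26 : s₁.reg 26 = s'.reg 26 := by rw [f₁.reg 26 (by decide)]; simp
    have e27 : s₁.reg 27 = s'.reg 27 := by rw [f₁.reg 27 (by decide)]; simp
    simp only [State.setReg_arr, State.setReg_reg, a4, a5, h3, Nat.reduceEqDiff, reduceIte] at h23
    refine .ite (fun h => .assign ?_) (fun h => .assign ?_)
    · simp only [Expr.eval_reg, State.setReg_reg, e4, e26, Nat.reduceEqDiff, reduceIte] at h ⊢
      exact ⟨by omega, by omega, by omega, h23.1 h, hno⟩
    · simp only [Expr.eval_reg, Expr.eval_add, Expr.eval_one, State.setReg_reg, e4, e27,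
        Nat.reduceEqDiff, reduceIte] at h ⊢
      exact ⟨by omega, by omega, h27, hv,
        fun C hC hV => h23.not.1 (by simpa using h) (hmono C c (by omega) hV)⟩
  · rintro k s' - ⟨-, hle, h27, hv, hno⟩ h0
    simp only [Expr.eval_sub, Expr.eval_reg] at h0
    exact ⟨h27, hv, fun C hC => hno C (by omega)⟩

theorem terminates_optimum {I : Instance} (hI : I.CommonDeadline) :
    Terminates (inputSize I.encode * inputSize I.encode + inputSize I.encode + 2) optimumProgram
      (fun s => CorrectOptimum I s.out) (State.init I.encode) := by
  obtain ⟨X, hX⟩ : ∃ X, X = inputSize I.encode := ⟨_, rfl⟩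
  obtain ⟨B, hB⟩ : ∃ B, B = X * X + X + 2 := ⟨_, rfl⟩
  rw [← hX, ← hB]
  have hn : I.n + 1 ≤ X := hX ▸ I.add_one_le_inputSize []
  have hnn : I.n * I.n ≤ X * X := Nat.mul_le_mul (by omega) (by omega)
  have hfac := size_factorial_le I.n
  have hpos := I.n.factorial_pos
  refine .seq_of (terminates_read (l := []) hI (by simp [State.init])) ?_
  rintro s₁ f₁ ⟨h1, h2, hD⟩
  rw [List.nil_append, ← hX] at h2
  have e0 : s₁.arr 0 = fun j => ([] ++ I.encode).getD j 0 := f₁.arr 0 (by decide)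
  refine .seq_of (terminates_factorial h1 (by omega)) ?_
  intro s₂ f₂ h5
  refine .seq (.assign (.seq (.assign ?_)))
  simp only [Expr.eval_reg, Expr.eval_add, State.setReg_reg, h5, Nat.reduceEqDiff, reduceIte]
  set s₃ := (s₂.setReg 36 I.n.factorial).setReg 5 (I.n.factorial + I.n.factorial) with hs₃
  have k5 : s₃.reg 5 = I.n.factorial + I.n.factorial := by simp [hs₃]
  have k36 : s₃.reg 36 = I.n.factorial := by simp [hs₃]
  have k2 : s₃.reg 2 = s₁.reg 2 := by simp [hs₃, f₂.reg 2 (by decide)]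
  have k1 : s₃.reg 1 = I.n := by simp [hs₃, f₂.reg 1 (by decide), h1]
  have ka : s₃.arr = s₁.arr := by
    funext x
    simp only [hs₃, State.setReg_arr]
    exact f₂.arr x (by simp [factorialProgram, mulProgram, Program.forLoop, Program.arrs])
  have ko : s₃.out = [] := by
    simp only [hs₃, State.setReg_out]
    rw [f₂.out rfl, f₁.out rfl]
    rfl
  have hz : ∀ x, x ≠ 0 → ∀ j, s₃.arr x j = 0 := fun x hx j => by
    rw [ka, f₁.arr x (by simp [readProgram, Program.arrs])]
    simp [State.init, hx]
  clear_value s₃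
  have hsize : (s₃.reg 5).size ≤ I.n * I.n + 2 := by
    rw [k5, Nat.size_le, pow_succ, mul_two]
    have := Nat.size_le.1 hfac
    omega
  refine .seq_of (terminates_prepare (l := []) (by rw [ka, e0]) k1 (by rwa [k2])
    (by omega) (by omega) (by omega)) ?_
  rintro s₄ f₄ ⟨m, P, a₀, t₀, hp⟩
  have hm := hp.card_le
  have g36 : s₄.reg 36 = I.n.factorial := by
    rw [f₄.reg 36 (by
      simp [prepareProgram, filterProgram, sortProgram, rankProgram, mulProgram, Program.forLoop,
        Program.regs]), k36]
  have g5 : s₄.reg 5 = I.n.factorial + I.n.factorial := by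
    rw [f₄.reg 5 (by
      simp [prepareProgram, filterProgram, sortProgram, rankProgram, mulProgram, Program.forLoop,
        Program.regs]), k5]
  have gz : ∀ x, 7 ≤ x → ∀ j, s₄.arr x j = 0 := fun x hx j => by
    rw [f₄.arr x (by
      simp [prepareProgram, filterProgram, sortProgram, rankProgram, mulProgram, Program.forLoop,
        Program.arrs]; omega)]
    exact hz x (by omega) j
  have go : s₄.out = [] := (f₄.out rfl).trans ko
  have hdl := hp.scaled.deadline
  refine .seq_of (terminates_bisect hp.card (by omega) ?_ (fun i _ => gz 9 (by omega) i)
    (fun i _ => gz 10 (by omega) i) (fun C C' => hp.valid_mono) hp.valid_deadline) ?_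
  -- The range of the bisection has at most as many bits as the deadline and `2 n!` together.
  · rw [hdl, g5, ← k5, k2]
    refine (size_mul_le _ _).trans ?_
    omega
  rintro s₅ f₅ ⟨h27, hv, hmin⟩
  refine .seq (.emit (.emit ?_))
  have l36 : s₅.reg 36 = I.n.factorial := (f₅.reg 36 (by decide)).trans g36
  have lo : s₅.out = [] := (f₅.out rfl).trans go
  refine ⟨s₅.reg 27 / 2, I.n.factorial, hpos, by simp [lo, l36], ?_⟩
  rw [hp.valid_iff, g5] at hv
  simp only [hp.valid_iff, g5] at hmin
  rw [hdl, g5] at h27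
  exact hp.sorted.isGLB_makespans hpos
    (fun q h₀ hq => Nat.dvd_factorial h₀ (hq.trans hm)) h27 hv hmin

/-! ### Finding a schedule -/

/-- Reads `T = p / q`, and puts `q * (n + 1)` into register 5. -/
def unitProgram : Program :=
  8 ::= .get 0 1 ;; 9 ::= .reg 1 + 1 ;; mulProgram ;; 5 ::= .reg 10

/-- Register 4 := the minimum of `T` and the deadline, in units of `1 / F`. -/
def horizonProgram : Program :=
  8 ::= .get 0 0 ;; 9 ::= .reg 1 + 1 ;; mulProgram ;;
  4 ::= .reg 10 - (.reg 10 - .reg 3) ;;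
  .store 4 (.reg 6) (.reg 4)

def searchProgram : Program :=
  readProgram 2 ;;
  unitProgram ;;
  prepareProgram 2 ;;
  horizonProgram ;;
  decideProgram ;;
  .ite (.reg 23) (.emit 1 ;; scheduleProgram) (.emit 0)

theorem terminates_search {I : Instance} (hI : I.CommonDeadline) {p q : ℕ} (hq : 0 < q) :
    Terminates (inputSize (p :: q :: I.encode) + inputSize (p :: q :: I.encode)) searchProgram
      (fun s => CorrectSchedule I ((p : ℝ) / (q : ℝ)) s.out)
      (State.init (p :: q :: I.encode)) := by
  obtain ⟨X, hX⟩ : ∃ X, X = inputSize (p :: q :: I.encode) := ⟨_, rfl⟩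
  rw [← hX]
  have hn : I.n + 1 ≤ X := hX ▸ I.add_one_le_inputSize [p, q]
  have hqX : q.size + 1 ≤ X := hX ▸ size_add_one_le_inputSize (by simp)
  have hn1 := size_le_self (I.n + 1)
  have hqR : (0 : ℝ) < q := by exact_mod_cast hq
  refine .seq_of (terminates_read (l := [p, q]) hI (by simp [State.init])) ?_
  rintro s₁ f₁ ⟨h1, -, hD⟩
  have e0 : s₁.arr 0 = fun j => ([p, q] ++ I.encode).getD j 0 := f₁.arr 0 (by decide)
  refine .seq_of (R := fun s' => s'.reg 5 = q * (I.n + 1)) (.seq (.assign (.seq (.assign (.seq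
    (terminates_mul ?_ fun s' _ hm => .assign ?_)))))) ?_
  · simp [h1]; omega
  · simp [h1, e0] at hm
    simp [hm]
  intro s₂ f₂ h5
  have k2 : s₂.reg 2 = s₁.reg 2 := f₂.reg 2 (by decide)
  have k1 : s₂.reg 1 = I.n := (f₂.reg 1 (by decide)).trans h1
  have ka : s₂.arr = s₁.arr := by
    funext x
    exact f₂.arr x (by simp [unitProgram, mulProgram, Program.arrs])
  have ko : s₂.out = [] := by rw [f₂.out rfl, f₁.out rfl]; rfl
  have hz : ∀ x, x ≠ 0 → ∀ j, s₂.arr x j = 0 := fun x hx j => by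
    rw [ka, f₁.arr x (by simp [readProgram, Program.arrs])]
    simp [State.init, hx]
  have hsize : (s₂.reg 5).size ≤ X + X := by
    rw [h5]
    refine (size_mul_le _ _).trans ?_
    omega
  refine .seq_of (terminates_prepare (l := [p, q]) (by rw [ka, e0]) k1 (by rwa [k2])
    (by rw [h5]; positivity) hsize (by omega)) ?_
  rintro s₃ f₃ ⟨m, P, a₀, t₀, hp⟩
  have hm := hp.card_le
  have g1 : s₃.reg 1 = I.n := by
    rw [f₃.reg 1 (by
      simp [prepareProgram, filterProgram, sortProgram, rankProgram, mulProgram, Program.forLoop,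
        Program.regs]), k1]
  have g5 : s₃.reg 5 = q * (I.n + 1) := by
    rw [f₃.reg 5 (by
      simp [prepareProgram, filterProgram, sortProgram, rankProgram, mulProgram, Program.forLoop,
        Program.regs]), h5]
  have ga : ∀ x, (x = 0 ∨ 7 ≤ x) → s₃.arr x = s₂.arr x := fun x hx =>
    f₃.arr x (by
      simp [prepareProgram, filterProgram, sortProgram, rankProgram, mulProgram, Program.forLoop,
        Program.arrs]; omega)
  have go : s₃.out = [] := (f₃.out rfl).trans ko
  refine .seq_of (R := fun s' => s'.reg 4 = min (p * (I.n + 1)) (s₃.reg 3) ∧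
    ∀ j, s'.arr 4 j = if j = m then min (p * (I.n + 1)) (s₃.reg 3) else s₃.arr 4 j)
    (.seq (.assign (.seq (.assign (.seq
      (terminates_mul ?_ fun s' f' hm' => .seq (.assign (.store ?_)))))))) ?_
  · simp [g1]; omega
  · have hmin : ∀ x y : ℕ, x - (x - y) = min x y := fun x y => by omega
    simp [g1, ga 0 (Or.inl rfl), ka, e0] at hm'
    have h3 : s'.reg 3 = s₃.reg 3 := by rw [f'.reg 3 (by decide)]; simp
    have h6 : s'.reg 6 = m := by rw [f'.reg 6 (by decide)]; simpa using hp.card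
    have h4 : s'.arr 4 = s₃.arr 4 := by rw [f'.arr 4 (by decide)]; simp
    simp [hm', h3, h6, h4, hmin]
  rintro s₄ f₄ ⟨h4, ha4⟩
  have k3 : s₄.reg 3 = s₃.reg 3 := f₄.reg 3 (by decide)
  have k5 : s₄.reg 5 = s₃.reg 5 := f₄.reg 5 (by decide)
  have hp' : Prepared I (s₂.reg 2) P a₀ t₀ s₄ := hp.congr k3 k5
    (f₄.reg 6 (by decide)) (fun j hj => by rw [ha4, if_neg hj.ne]) (f₄.arr 5 (by decide))
    (f₄.arr 6 (by decide))
  have hz' : ∀ x, 7 ≤ x → ∀ j, s₄.arr x j = 0 := fun x hx j => by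
    rw [f₄.arr x (by simp [horizonProgram, mulProgram, Program.arrs]; omega), ga x (Or.inr hx)]
    exact hz x (by omega) j
  have hCD : s₄.reg 4 ≤ s₄.reg 3 := by rw [h4, k3]; exact min_le_right _ _
  have hdl := hp'.scaled.deadline
  have hT : ((s₄.reg 4 : ℕ) : ℝ) / s₄.reg 5 = min ((p : ℝ) / q) (s₂.reg 2) := by
    have hn0 : (0 : ℝ) < I.n + 1 := by positivity
    rw [h4, ← k3, hdl, k5, g5, Nat.cast_min, ← min_div_div_right (by positivity)]
    push_cast
    rw [mul_div_mul_right _ _ hn0.ne', mul_div_cancel_right₀ _ (by positivity)]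
  refine .seq_of (terminates_decide_valid hp'.card (by omega) hCD
    (fun i _ => hz' 9 (by omega) i) (fun i _ => hz' 10 (by omega) i)) ?_
  intro s₅ f₅ h23
  have e3 : s₅.reg 3 = s₄.reg 3 := f₅.reg 3 (by decide)
  have e4 : s₅.reg 4 = s₄.reg 4 := f₅.reg 4 (by decide)
  have e5 : s₅.reg 5 = s₄.reg 5 := f₅.reg 5 (by decide)
  have d4 : s₅.arr 4 = s₄.arr 4 := f₅.arr 4 (by decide)
  have d5 : s₅.arr 5 = s₄.arr 5 := f₅.arr 5 (by decide)
  have d9 : s₅.arr 9 = s₄.arr 9 := f₅.arr 9 (by decide)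
  have d10 : s₅.arr 10 = s₄.arr 10 := f₅.arr 10 (by decide)
  have ho : s₅.out = [] := (f₅.out rfl).trans ((f₄.out rfl).trans go)
  have hp₅ : Prepared I (s₂.reg 2) P a₀ t₀ s₅ := hp'.congr e3 e5
    (f₅.reg 6 (by decide)) (fun j hj => by rw [d4]) d5 (f₅.arr 6 (by decide))
  refine .ite (fun h => .seq (.emit ?_)) (fun h => .emit (Or.inl ⟨by simp [ho], ?_⟩))
  · have hgF : I.n + 1 ∣ s₅.reg 5 := by rw [e5, k5, g5]; exact dvd_mul_left _ _
    -- Both candidates for the horizon, the scaled `T` and the scaled deadline, are multiples of `n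
    -- + 1`.
    have hgC : I.n + 1 ∣ s₅.reg 4 := by
      rw [e4, h4, ← k3, hdl, ← e5]
      rcases min_choice (p * (I.n + 1)) (s₂.reg 2 * s₅.reg 5) with h' | h' <;> rw [h']
      · exact dvd_mul_left _ _
      · exact hgF.mul_left _
    have hv := h23.1 h
    refine (terminates_schedule (g := I.n + 1) (s := s₅.write _) hp'.sorted hp₅.scaled hp₅.card
      hp₅.jobs (by omega) (by simpa [e3, e4] using hCD) ?_ (by omega) hgF hgC
      (fun i _ => ⟨?_, ?_⟩) ?_).mono ?_
    · simp [d4, e4, ha4, h4]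
    · simpa [d9] using hz' 9 (by omega) i
    · simpa [d10] using hz' 10 (by omega) i
    · simpa [d4, d5, e3, e4] using hv
    · rintro s₆ - ⟨L, hout, hL, hmk⟩
      refine Or.inr ⟨L, by simpa [ho] using hout, hL, hmk.trans ?_⟩
      simp only [State.write_reg, e4, e5, hT]
      exact min_le_left _ _
  · rintro ⟨S, hS, hmk⟩
    refine h23.not.1 (by simpa using h) (hp'.valid_iff.2 ?_)
    rw [hT]
    exact hp'.sorted.exists_valid_of_makespan_le hS
      (le_min hmk (hp'.sorted.makespan_le_deadline hS))

/-- The step bound is a polynomial in the iteration bound, which is itself a polynomial in the input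
size; composition gives the running time. -/
theorem solvableInPolyTime_of_terminates {α : Type} {valid : α → Prop} {encode : α → List ℕ}
    {correct : α → List ℕ → Prop} (c : Program) (P : Polynomial ℕ)
    (h : ∀ x, valid x → Terminates (P.eval (inputSize (encode x))) c (fun s => correct x s.out)
      (State.init (encode x))) : SolvableInPolyTime valid encode correct := by
  obtain ⟨Q, hQ⟩ := c.exists_polynomial_bound
  refine ⟨c, Q.comp P, fun x hx => ?_⟩
  obtain ⟨k, s, he, hk, hc⟩ := h x hx
  exact ⟨k, s, he, by rwa [Polynomial.eval_comp, hQ], hc⟩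

end LazyBureaucrat

theorem mainTheorem1 :
    LazyBureaucrat.SolvableInPolyTime
      (fun I : LazyBureaucrat.Instance => I.CommonDeadline)
      (fun I => I.encode)
      (fun I out => LazyBureaucrat.CorrectOptimum I out) ∧
    LazyBureaucrat.SolvableInPolyTime
      (fun x : LazyBureaucrat.Instance × ℕ × ℕ => x.1.CommonDeadline ∧ 0 < x.2.2)
      (fun x => x.2.1 :: x.2.2 :: x.1.encode)
      (fun x out => LazyBureaucrat.CorrectSchedule x.1 ((x.2.1 : ℝ) / (x.2.2 : ℝ)) out) := by
  refine ⟨LazyBureaucrat.solvableInPolyTime_of_terminates LazyBureaucrat.optimumProgram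
    (Polynomial.X * Polynomial.X + Polynomial.X + 2) fun I hI => ?_,
    LazyBureaucrat.solvableInPolyTime_of_terminates LazyBureaucrat.searchProgram
      (Polynomial.X + Polynomial.X) fun x hx => ?_⟩
  · simpa using LazyBureaucrat.terminates_optimum hI
  · simpa using LazyBureaucrat.terminates_search hx.1 hx.2
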